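/- **Parikh automata.** A two-way finite automaton over a finite alphabet $\Sigma$ has a non-empty finite set $Q$ of states partitioned into left-reading states $Q^L$ and right-reading states $Q^R$, initial states $Q_I\subseteq Q^R$, accepting states $Q_F\subseteq Q_H$ among halting states $Q_H\subseteq Q$, and transitions $\Delta\subseteq Q\times(\Sigma\cup\{\vdash,\dashv\})\times Q$. No transition leaves a halting state; there is no transition in $Q^L\times\{\vdash\}\times Q^L$ or in $Q^R\times\{\dashv\}\times(Q^R\setminus Q_F)$; and a transition into a halting state starts in $Q^R$ and reads $\dashv$. On input $u$ the head stands between two letters of $\vdash u\dashv$ (or at an end of it); a transition $(p,a,q)$ with $p\in Q^R$ (resp. $p\in Q^L$) reads the letter $a$ to the right (resp. left) of the head and moves the head over it. An accepting run starts in an initial state at the left end and ends in an accepting state. A two-way Parikh automaton of dimension $d\in\mathbb N$ is such an automaton together with a weight map $\lambda:\Delta\to\mathbb Z^d$ and an existential Presburger formula $\psi$ with $d$ free variables (over $0,1,+$, doubling and $\le$, interpreted in $\mathbb Z$); it accepts $u$ if some accepting run on $u$ has a sum of weights that satisfies $\psi$. The automaton is *one-way* if $Q^L=\emptyset$; *unambiguous*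 if every word has at most one accepting run (whatever the sum of its weights); *deterministic* if it has at most one initial state and for all $p,a$ at most one $q$ with $(p,a,q)\in\Delta$; *co-deterministic* if it has at most one accepting state, for all $a,q$ there is at most one $p$ with $(p,a,q)\in\Delta$, and no state is entered both from a left-reading and from a right-reading state (so that every configuration has at most one predecessor); *reversible* if it is deterministic and co-deterministic. Let UPA denote the unambiguous one-way Parikh automata and 2DPA the deterministic two-way Parikh automata. **Theorem.** For every finite alphabet $\Sigma$ and every language $L\subseteq\Sigma^*$ the following are equivalent: $L$ is accepted by a UPA; $L$ is accepted by a 2DPA; $L$ is accepted by a reversible two-way Parikh automaton. Moreover the conversions are effective in exponential time: there are an algorithm that, given a UPA, outputs a reversible two-way Parikh automaton accepting the same language, and an algorithm that, given a 2DPA, outputs a UPA accepting the same language, each running in time $2^{p(N)}$ for some polynomial $p$, where $N$ is the size of the encoding of the input automaton (alphabet, dimension and states listed in unary, table of transitions with weights in binary, and formula). -/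

import Mathlib

/-! Two-way Parikh automata, their unambiguous one-way, deterministic and reversible
subclasses, and a programming language with a cost measure for effective conversions. -/

namespace TwoWayParikh

/-! ### Two-way finite automata -/

/-- The letters read by an automaton over `α`: the symbols of `α` and the delimiters
`lend` (left of the word) and `rend` (right of the word). -/
inductive Letter (α : Type*) where
  | lend : Letter α
  | rend : Letter α
  | sym : α → Letter α

/-- The side of the head on which a state reads (and towards which the head then moves). -/
inductive Side where
  | L : Side
  | R : Side

/-- Two-way finite automata. The head stands between two letters. -/
structure TwoWayAutomaton (α Q : Type*) where
  finite : Finite Q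
  nonempty : Nonempty Q
  /-- the partition of the states into left-reading and right-reading ones -/
  side : Q → Side
  init : Set Q
  halt : Set Q
  acc : Set Q
  trans : Set (Q × Letter α × Q)
  init_right : ∀ q ∈ init, side q = Side.R
  acc_halt : acc ⊆ halt
  /-- no outgoing transition from a halting state -/
  no_exit : ∀ p a q, (p, a, q) ∈ trans → p ∉ halt
  /-- the head does not move left when it is left of the left delimiter -/
  bound_left : ∀ p q, (p, Letter.lend, q) ∈ trans → ¬ (side p = Side.L ∧ side q = Side.L)
  /-- the head does not move right when it is right of the right delimiter -/
  bound_right : ∀ p q, (p, Letter.rend, q) ∈ trans →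
    ¬ (side p = Side.R ∧ side q = Side.R ∧ q ∉ acc)
  /-- halting states are entered by reading the right delimiter only -/
  halt_entry : ∀ p a q, (p, a, q) ∈ trans → q ∈ halt → side p = Side.R ∧ a = Letter.rend

/-- A configuration: the letters left of the head, the state, the letters right of the head. -/
structure Config (α Q : Type*) where
  left : List (Letter α)
  state : Q
  right : List (Letter α)

/-- The input word between its delimiters. -/
def tape {α : Type*} (u : List α) : List (Letter α) :=
  Letter.lend :: (u.map Letter.sym ++ [Letter.rend])

namespace TwoWayAutomaton

variable {α Q : Type*} (A : TwoWayAutomaton α Q)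

/-- The transition `t` leads from the configuration `c` to the configuration `c'`. -/
def Step (c : Config α Q) (t : A.trans) (c' : Config α Q) : Prop :=
  t.1.1 = c.state ∧ t.1.2.2 = c'.state ∧
    match A.side c.state with
    | Side.R => c.right = t.1.2.1 :: c'.right ∧ c'.left = c.left ++ [t.1.2.1]
    | Side.L => c.left = c'.left ++ [t.1.2.1] ∧ c'.right = t.1.2.1 :: c.right

/-- `A.IsRun c ts c'`: the transitions `ts`, in this order, form a run from `c` to `c'`. -/
inductive IsRun : Config α Q → List A.trans → Config α Q → Prop where
  | nil (c : Config α Q) : IsRun c [] c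
  | cons {c c' c'' : Config α Q} {t : A.trans} {ts : List A.trans} :
      A.Step c t c' → IsRun c' ts c'' → IsRun c (t :: ts) c''

/-- The run on `u` that starts in `q₀` with the head at the left end and takes the
transitions `ts` is an accepting run. (A run is determined by `q₀` and `ts`.) -/
def IsAcceptingRun (u : List α) (q₀ : Q) (ts : List A.trans) : Prop :=
  q₀ ∈ A.init ∧ ∃ c, A.IsRun ⟨[], q₀, tape u⟩ ts c ∧ c.state ∈ A.acc

/-- One-way automata: there is no left-reading state. -/
def OneWay : Prop := ∀ q, A.side q = Side.R

/-- Every word has at most one accepting run. -/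
def Unambiguous : Prop :=
  ∀ u q₀ ts q₀' ts', A.IsAcceptingRun u q₀ ts → A.IsAcceptingRun u q₀' ts' →
    q₀ = q₀' ∧ ts = ts'

/-- At most one initial state, and at most one target for each state and letter. -/
def Deterministic : Prop :=
  A.init.Subsingleton ∧
    ∀ p a q q', (p, a, q) ∈ A.trans → (p, a, q') ∈ A.trans → q = q'

/-- At most one accepting state, at most one source for each letter and target, and no state
is entered both from a left-reading and from a right-reading state. The last condition makes
the second one meaningful for the head moves used here: together they say that every
configuration has at most one predecessor. -/
def CoDeterministic : Prop :=
  A.acc.Subsingleton ∧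
    (∀ p p' a q, (p, a, q) ∈ A.trans → (p', a, q) ∈ A.trans → p = p') ∧
    ∀ p p' a a' q, (p, a, q) ∈ A.trans → (p', a', q) ∈ A.trans → A.side p = A.side p'

def Reversible : Prop := A.Deterministic ∧ A.CoDeterministic

end TwoWayAutomaton

/-! ### Existential Presburger formulas -/

/-- Terms over `0, 1, +` and doubling, with `d` free and `k` quantified variables. -/
inductive PTerm (d k : ℕ) where
  | zero : PTerm d k
  | one : PTerm d k
  | free : Fin d → PTerm d k
  | bound : Fin k → PTerm d k
  | add : PTerm d k → PTerm d k → PTerm d k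
  | dbl : PTerm d k → PTerm d k

/-- Quantifier-free Presburger formulas. -/
inductive QFFormula (d k : ℕ) where
  | le : PTerm d k → PTerm d k → QFFormula d k
  | and : QFFormula d k → QFFormula d k → QFFormula d k
  | or : QFFormula d k → QFFormula d k → QFFormula d k
  | not : QFFormula d k → QFFormula d k

def PTerm.eval {d k : ℕ} (v : Fin d → ℤ) (y : Fin k → ℤ) : PTerm d k → ℤ
  | .zero => 0
  | .one => 1
  | .free i => v i
  | .bound j => y j
  | .add s t => s.eval v y + t.eval v y
  | .dbl t => 2 * t.eval v y

def QFFormula.Holds {d k : ℕ} (v : Fin d → ℤ) (y : Fin k → ℤ) : QFFormula d k → Prop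
  | .le s t => s.eval v y ≤ t.eval v y
  | .and φ χ => φ.Holds v y ∧ χ.Holds v y
  | .or φ χ => φ.Holds v y ∨ χ.Holds v y
  | .not φ => ¬ φ.Holds v y

/-- Existential Presburger formulas with `d` free variables: a block of `numBound`
existential quantifiers in front of a quantifier-free formula. -/
structure ExFormula (d : ℕ) where
  numBound : ℕ
  matrix : QFFormula d numBound

/-- The vector `v` of integers satisfies the formula. -/
def ExFormula.Sat {d : ℕ} (ψ : ExFormula d) (v : Fin d → ℤ) : Prop :=
  ∃ y : Fin ψ.numBound → ℤ, ψ.matrix.Holds v y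

/-! ### Parikh automata -/

/-- Two-way Parikh automata of dimension `d`. -/
structure ParikhAutomaton (α Q : Type*) (d : ℕ) where
  aut : TwoWayAutomaton α Q
  weight : aut.trans → (Fin d → ℤ)
  constraint : ExFormula d

namespace ParikhAutomaton

variable {α Q : Type*} {d : ℕ} (P : ParikhAutomaton α Q d)

/-- The value of a run. -/
def value (ts : List P.aut.trans) : Fin d → ℤ := (ts.map P.weight).sum

def language : Language α :=
  {u | ∃ q₀ ts, P.aut.IsAcceptingRun u q₀ ts ∧ P.constraint.Sat (P.value ts)}

/-- Unambiguous (one-way) Parikh automata. -/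
def IsUPA : Prop := P.aut.OneWay ∧ P.aut.Unambiguous

/-- Two-way deterministic Parikh automata. -/
def Is2DPA : Prop := P.aut.Deterministic

/-- Two-way reversible Parikh automata. -/
def IsReversible2DPA : Prop := P.aut.Reversible

end ParikhAutomaton

/-- The languages over `α` of unambiguous Parikh automata. -/
def UPALanguages (α : Type*) : Set (Language α) :=
  {L | ∃ (Q : Type) (d : ℕ) (P : ParikhAutomaton α Q d), P.IsUPA ∧ P.language = L}

/-- The languages over `α` of two-way deterministic Parikh automata. -/
def TwoDPALanguages (α : Type*) : Set (Language α) :=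
  {L | ∃ (Q : Type) (d : ℕ) (P : ParikhAutomaton α Q d), P.Is2DPA ∧ P.language = L}

/-- The languages over `α` of two-way reversible Parikh automata. -/
def ReversibleLanguages (α : Type*) : Set (Language α) :=
  {L | ∃ (Q : Type) (d : ℕ) (P : ParikhAutomaton α Q d),
    P.IsReversible2DPA ∧ P.language = L}

/-! ### Programs and their running time -/

/-- Binary trees, the data of programs. -/
inductive Data where
  | nil : Data
  | node : Data → Data → Data

def Data.size : Data → ℕ
  | .nil => 1
  | .node l r => l.size + r.size + 1

def Data.fst : Data → Data
  | .nil => .nil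
  | .node l _ => l

def Data.snd : Data → Data
  | .nil => .nil
  | .node _ r => r

/-- While programs over binary trees, each transforming one tree into another. -/
inductive Prog where
  /-- constant `nil` -/
  | nil : Prog
  | id : Prog
  | fst : Prog
  | snd : Prog
  /-- run both programs on the input and pair the results -/
  | pair : Prog → Prog → Prog
  /-- run the first program, then the second one on its result -/
  | seq : Prog → Prog → Prog
  /-- run the second program if the first one yields a `node`, else the third one -/
  | ite : Prog → Prog → Prog → Prog
  /-- while the first program yields a `node`, apply the second one -/
  | loop : Prog → Prog → Prog

/-- `p.Runs x y c`: on input `x` the program `p` halts with output `y` at cost `c`. Executing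
an instruction on `x` costs `1 + x.size`, in addition to the cost of its parts. In particular
the size of the output is at most the cost, and a Turing machine can simulate a run in time
polynomial in its cost (and conversely). -/
inductive Prog.Runs : Prog → Data → Data → ℕ → Prop where
  | nil (x : Data) : Runs .nil x .nil (1 + x.size)
  | id (x : Data) : Runs .id x x (1 + x.size)
  | fst (x : Data) : Runs .fst x x.fst (1 + x.size)
  | snd (x : Data) : Runs .snd x x.snd (1 + x.size)
  | pair {p q : Prog} {x y z : Data} {c c' : ℕ} :
      Runs p x y c → Runs q x z c' → Runs (.pair p q) x (.node y z) (1 + x.size + c + c')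
  | seq {p q : Prog} {x y z : Data} {c c' : ℕ} :
      Runs p x y c → Runs q y z c' → Runs (.seq p q) x z (1 + x.size + c + c')
  | ite_node {b p q : Prog} {x l r y : Data} {c c' : ℕ} :
      Runs b x (.node l r) c → Runs p x y c' → Runs (.ite b p q) x y (1 + x.size + c + c')
  | ite_nil {b p q : Prog} {x y : Data} {c c' : ℕ} :
      Runs b x .nil c → Runs q x y c' → Runs (.ite b p q) x y (1 + x.size + c + c')
  | loop_nil {b p : Prog} {x : Data} {c : ℕ} :
      Runs b x .nil c → Runs (.loop b p) x x (1 + x.size + c)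
  | loop_node {b p : Prog} {x l r y z : Data} {c c' c'' : ℕ} :
      Runs b x (.node l r) c → Runs p x y c' → Runs (.loop b p) y z c'' →
      Runs (.loop b p) x z (1 + x.size + c + c' + c'')

/-! ### Encoding automata as data -/

namespace Data

def ofList : List Data → Data
  | [] => .nil
  | x :: xs => .node x (ofList xs)

def ofBool : Bool → Data
  | false => .nil
  | true => .node .nil .nil

open Classical in
noncomputable def ofProp (p : Prop) : Data := ofBool (decide p)

/-- unary encoding -/
def unary (n : ℕ) : Data := ofList (List.replicate n .nil)

/-- binary encoding, least significant digit first -/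
def binary (n : ℕ) : Data := ofList (n.bits.map ofBool)

/-- sign and absolute value in binary -/
def ofInt (z : ℤ) : Data := .node (ofBool (decide (z < 0))) (binary z.natAbs)

def ofVec {d : ℕ} (v : Fin d → ℤ) : Data := ofList (List.ofFn fun i => ofInt (v i))

end Data

def PTerm.encode {d k : ℕ} : PTerm d k → Data
  | .zero => .node (Data.unary 0) .nil
  | .one => .node (Data.unary 1) .nil
  | .free i => .node (Data.unary 2) (Data.binary i)
  | .bound j => .node (Data.unary 3) (Data.binary j)
  | .add s t => .node (Data.unary 4) (.node s.encode t.encode)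
  | .dbl t => .node (Data.unary 5) t.encode

def QFFormula.encode {d k : ℕ} : QFFormula d k → Data
  | .le s t => .node (Data.unary 0) (.node s.encode t.encode)
  | .and φ χ => .node (Data.unary 1) (.node φ.encode χ.encode)
  | .or φ χ => .node (Data.unary 2) (.node φ.encode χ.encode)
  | .not φ => .node (Data.unary 3) φ.encode

def ExFormula.encode {d : ℕ} (ψ : ExFormula d) : Data :=
  .node (Data.unary ψ.numBound) ψ.matrix.encode

namespace ParikhAutomaton

variable {m n d : ℕ} (P : ParikhAutomaton (Fin m) (Fin n) d)

/-- For a state: is it left-reading, initial, halting, accepting? -/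
noncomputable def encodeState (q : Fin n) : Data :=
  Data.ofList [Data.ofProp (P.aut.side q = Side.L), Data.ofProp (q ∈ P.aut.init),
    Data.ofProp (q ∈ P.aut.halt), Data.ofProp (q ∈ P.aut.acc)]

open Classical in
/-- The entry of the transition table: `nil` if `(p, a, q)` is no transition, and otherwise
a `node` with the weight vector of that transition. -/
noncomputable def encodeEntry (p : Fin n) (a : Letter (Fin m)) (q : Fin n) : Data :=
  if h : (p, a, q) ∈ P.aut.trans then .node .nil (Data.ofVec (P.weight ⟨(p, a, q), h⟩))
  else .nil

/-- The letters, delimiters first. -/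
def letters (m : ℕ) : List (Letter (Fin m)) :=
  Letter.lend :: Letter.rend :: List.ofFn Letter.sym

/-- The encoding of a Parikh automaton over the alphabet `{0, …, m - 1}` with states
`0, …, n - 1`: the size of the alphabet, the dimension, the list of states, the table of
transitions (indexed by source, letter, target), and the acceptance constraint. -/
noncomputable def encode : Data :=
  Data.ofList [
    Data.unary m,
    Data.unary d,
    Data.ofList (List.ofFn fun q => P.encodeState q),
    Data.ofList (List.ofFn fun p => Data.ofList ((letters m).map fun a =>
      Data.ofList (List.ofFn fun q => P.encodeEntry p a q))),
    P.constraint.encode]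

end ParikhAutomaton

end TwoWayParikh

open TwoWayParikh

/-!
An unambiguous Parikh automaton is made reversible in two stages. A run of a one-way automaton can
be found by a deterministic two-way machine: it runs the subset automaton to the right end and then
follows an accepting run backwards. To this end it has to know, at each position, the set of states
reached by the prefix left of it. The set one letter before is recovered by the method of Hopcroft
and Ullman: among the candidates, of which the current set is the successor, the head hunts to the
left until only one of them is still reachable, and then returns to where it was by letting a
representative of this candidate and one of another candidate race to the right until they merge
(`LookData.machine`). The transitions chosen on the way form some accepting run, and since there is
only one, its value is the right one (`lookMachine_accepts_iff`). A deterministic machine with one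
final state is made reversible by an Euler tour of the tree of the configurations from which the
final state is reached (`Machine.tour`). The tour is a permutation of the edge sides of this tree,
so every configuration has one predecessor, and since an edge traversed backwards contributes the
negative of its weight, the side branches contribute nothing to the value (`tour_explore`).

A deterministic two-way Parikh automaton becomes unambiguous and one-way by guessing its crossing
sequences: the states in which the head visits the position between two letters
(`ParikhAutomaton.crossSpec`). An accepting run of a deterministic automaton visits no configuration
twice, so these sequences have bounded length; that they belong to a run can be tested letter by
letter (`ParikhAutomaton.Replay`); and they are determined by the run, which is determined by the
input (`Trace.det`, `Consistent.exists_trace`).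

Both automata have exponentially many states, given by lists and Boolean functions (`Spec`). The
programs that write down their tables are composed from rules of the form "if `f` and `g` can be
computed in polynomial time, so can ..." (`PolyTime`). Exponential time is reduced to polynomial
time: a program first pads its input of size `N` with a tree of size about `2 ^ N ^ 2`, and all
lists of subsets, relations and crossing sequences, as well as all weights in unary, have polynomial
size in the padded input (`exists_prog_of_polyTime`).
-/

set_option autoImplicit false

namespace TwoWayParikh

/-! ### Weighted reachability and head moves -/

/-- Reachability along a weighted relation, with the sum of the weights. -/
inductive Star {C W : Type*} [AddMonoid W] (r : C → W → C → Prop) : C → W → C → Prop where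
  | refl (c : C) : Star r c 0 c
  | head {c c' c'' : C} {w v : W} : r c w c' → Star r c' v c'' → Star r c (w + v) c''

namespace Star

variable {C W : Type*} [AddGroup W] {r : C → W → C → Prop}

theorem trans {c c' c'' : C} {v v' : W} (h : Star r c v c') (h' : Star r c' v' c'') :
    Star r c (v + v') c'' := by
  induction h with
  | refl => simpa using h'
  | head h₁ _ ih => rw [add_assoc]; exact .head h₁ (ih h')

theorem single {c c' : C} {w : W} (h : r c w c') : Star r c w c' := by
  simpa using Star.head h (.refl c')

theorem snoc {c c' c'' : C} {v w : W} (h : Star r c v c') (h' : r c' w c'') :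
    Star r c (v + w) c'' := h.trans (single h')

/-- In a deterministic relation, a path to a dead end extends every other path. -/
theorem det (hr : ∀ c w c' w' c'', r c w c' → r c w' c'' → w = w' ∧ c' = c'')
    {c c₁ c₂ : C} {v v' : W} (h : Star r c v c₁) (h' : Star r c v' c₂)
    (dead : ∀ w c', ¬ r c₂ w c') : ∃ v'', Star r c₁ v'' c₂ ∧ v' = v + v'' := by
  induction h generalizing v' with
  | refl => exact ⟨v', h', by simp⟩
  | head h₁ _ ih =>
    cases h' with
    | refl => exact absurd h₁ (dead _ _)
    | head h₂ h₃ =>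
      obtain ⟨rfl, rfl⟩ := hr _ _ _ _ _ h₁ h₂
      obtain ⟨v'', h₄, rfl⟩ := ih h₃
      exact ⟨v'', h₄, by rw [add_assoc]⟩

theorem det_value (hr : ∀ c w c' w' c'', r c w c' → r c w' c'' → w = w' ∧ c' = c'')
    {c c₁ c₂ : C} {v v' : W} (h : Star r c v c₁) (h' : Star r c v' c₂)
    (dead₁ : ∀ w c', ¬ r c₁ w c') (dead : ∀ w c', ¬ r c₂ w c') : v = v' ∧ c₁ = c₂ := by
  obtain ⟨v'', h₃, rfl⟩ := det hr h h' dead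
  cases h₃ with
  | refl => simp
  | head h₄ => exact absurd h₄ (dead₁ _ _)

end Star

/-- `Mv b a l r l' r'`: reading `a` to the left (if `b`) or to the right moves the head from
between `l` and `r` to between `l'` and `r'`. -/
def Mv {β : Type*} (b : Bool) (a : β) (l r l' r' : List β) : Prop :=
  match b with
  | false => r = a :: r' ∧ l' = l ++ [a]
  | true => l = l' ++ [a] ∧ r' = a :: r

namespace Mv

variable {β : Type*} {b : Bool} {a a' : β} {l r l' r' l'' r'' : List β}

theorem symm (h : Mv b a l r l' r') : Mv (!b) a l' r' l r := by
  cases b <;> exact ⟨h.2, h.1⟩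

theorem det (h : Mv b a l r l' r') (h' : Mv b a' l r l'' r'') : a = a' ∧ l' = l'' ∧ r' = r'' := by
  cases b
  · obtain ⟨rfl, rfl⟩ := h
    obtain ⟨h₁, rfl⟩ := h'
    simp_all
  · obtain ⟨rfl, rfl⟩ := h
    obtain ⟨h₁, rfl⟩ := h'
    simp_all

theorem append (h : Mv b a l r l' r') : l' ++ r' = l ++ r := by
  cases b <;> obtain ⟨rfl, rfl⟩ := h <;> simp

theorem right (a : β) (l r : List β) : Mv false a l (a :: r) (l ++ [a]) r := ⟨rfl, rfl⟩

theorem left (a : β) (l r : List β) : Mv true a (l ++ [a]) r l (a :: r) := ⟨rfl, rfl⟩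

theorem map {γ : Type*} (f : β → γ) (h : Mv b a l r l' r') :
    Mv b (f a) (l.map f) (r.map f) (l'.map f) (r'.map f) := by
  cases b <;> obtain ⟨rfl, rfl⟩ := h <;> simp [Mv]

end Mv

namespace Side

/-- Is this the left side? -/
def isL : Side → Bool
  | L => true
  | R => false

/-- The left side for `true`. -/
def ofBool : Bool → Side
  | true => L
  | false => R

@[simp] theorem isL_ofBool (b : Bool) : (ofBool b).isL = b := by cases b <;> rfl

@[simp] theorem ofBool_eq_L {b : Bool} : ofBool b = L ↔ b = true := by cases b <;> simp [ofBool]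

@[simp] theorem ofBool_eq_R {b : Bool} : ofBool b = R ↔ b = false := by cases b <;> simp [ofBool]

theorem isL_eq_true {s : Side} : s.isL = true ↔ s = L := by cases s <;> simp [isL]

end Side

theorem TwoWayAutomaton.step_iff {α Q : Type*} (A : TwoWayAutomaton α Q) (c : Config α Q)
    (t : A.trans) (c' : Config α Q) : A.Step c t c' ↔
      t.1.1 = c.state ∧ t.1.2.2 = c'.state ∧
        Mv (A.side c.state).isL t.1.2.1 c.left c.right c'.left c'.right := by
  unfold TwoWayAutomaton.Step
  cases A.side c.state <;> exact Iff.rfl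

namespace ParikhAutomaton

variable {α Q : Type*} {d : ℕ} (P : ParikhAutomaton α Q d)

/-- A step of a Parikh automaton, with its weight. -/
def WStep (c : Config α Q) (w : Fin d → ℤ) (c' : Config α Q) : Prop :=
  ∃ t, P.aut.Step c t c' ∧ P.weight t = w

theorem star_wStep_iff {c c' : Config α Q} {v : Fin d → ℤ} :
    Star P.WStep c v c' ↔ ∃ ts, P.aut.IsRun c ts c' ∧ P.value ts = v := by
  constructor
  · intro h
    induction h with
    | refl c => exact ⟨[], .nil c, rfl⟩
    | head h _ ih =>
      obtain ⟨t, ht, rfl⟩ := h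
      obtain ⟨ts, hts, rfl⟩ := ih
      exact ⟨t :: ts, .cons ht hts, by simp [value]⟩
  · rintro ⟨ts, h, rfl⟩
    induction h with
    | nil c => exact .refl c
    | cons h _ ih =>
      simp only [value, List.map_cons, List.sum_cons] at ih ⊢
      exact .head ⟨_, h, rfl⟩ ih

theorem mem_language {u : List α} : u ∈ P.language ↔ ∃ q₀ ∈ P.aut.init, ∃ v c,
    Star P.WStep ⟨[], q₀, tape u⟩ v c ∧ c.state ∈ P.aut.acc ∧ P.constraint.Sat v := by
  constructor
  · rintro ⟨q₀, ts, ⟨h₀, c, hr, hc⟩, hs⟩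
    exact ⟨q₀, h₀, _, c, P.star_wStep_iff.2 ⟨ts, hr, rfl⟩, hc, hs⟩
  · rintro ⟨q₀, h₀, v, c, hr, hc, hs⟩
    obtain ⟨ts, hts, rfl⟩ := P.star_wStep_iff.1 hr
    exact ⟨q₀, ts, ⟨h₀, c, hts, hc⟩, hs⟩

end ParikhAutomaton

/-! ### Automata given by lists and Boolean functions -/

/-- An executable description of a two-way automaton with weights in `W`: its states are the
members of `states`, and the transitions are those of `tr` that respect the structural
conditions on two-way automata. The halting states are the accepting ones. -/
structure Spec (α σ W : Type*) where
  states : List σ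
  left : σ → Bool
  init : σ → Bool
  acc : σ → Bool
  tr : σ → Letter α → σ → Option W

namespace Spec

open Classical in
/-- The structural conditions on the transitions of a two-way automaton. -/
noncomputable def legal {α σ W : Type*} (S : Spec α σ W) (p : σ) (a : Letter α) (q : σ) : Bool :=
  !S.acc p && !(decide (a = .lend) && (S.left p && S.left q)) &&
    !(decide (a = .rend) && (!S.left p && (!S.left q && !S.acc q))) &&
    (!S.acc q || (!S.left p && decide (a = .rend)))

variable {α σ W : Type*} (S : Spec α σ W)

theorem legal_iff {p q : σ} {a : Letter α} : S.legal p a q = true ↔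
    S.acc p = false ∧ ¬ (a = .lend ∧ S.left p = true ∧ S.left q = true) ∧
    ¬ (a = .rend ∧ S.left p = false ∧ S.left q = false ∧ S.acc q = false) ∧
    (S.acc q = true → S.left p = false ∧ a = .rend) := by
  simp only [legal]
  by_cases h₁ : a = .lend <;> by_cases h₂ : a = .rend <;> cases S.acc p <;> cases S.acc q <;>
    cases S.left p <;> cases S.left q <;> simp [h₁, h₂]

/-- The weight of a transition, if there is one. -/
noncomputable def entry (p : σ) (a : Letter α) (q : σ) : Option W :=
  if S.legal p a q = true then S.tr p a q else none

theorem entry_eq_some {p q : σ} {a : Letter α} {w : W} :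
    S.entry p a q = some w ↔ S.legal p a q = true ∧ S.tr p a q = some w := by
  simp [entry]

/-- A weighted step between configurations. -/
def WStep (c : Config α σ) (w : W) (c' : Config α σ) : Prop :=
  c.state ∈ S.states ∧ c'.state ∈ S.states ∧ ∃ a, S.entry c.state a c'.state = some w ∧
    Mv (S.left c.state) a c.left c.right c'.left c'.right

/-- The word `u` is accepted with value `v`. -/
def Accepts [AddMonoid W] (u : List α) (v : W) : Prop :=
  ∃ s ∈ S.states, S.init s = true ∧ S.left s = false ∧
    ∃ c, Star S.WStep ⟨[], s, tape u⟩ v c ∧ S.acc c.state = true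

section toPA

variable {d : ℕ} (S : Spec α σ (Fin d → ℤ))

/-- The Parikh automaton described by `S`; its states are the indices of `S.states`. -/
noncomputable def toPA (hne : S.states ≠ []) (ψ : ExFormula d) :
    ParikhAutomaton α (Fin S.states.length) d where
  aut :=
    { finite := inferInstance
      nonempty := ⟨⟨0, List.length_pos_of_ne_nil hne⟩⟩
      side := fun i => Side.ofBool (S.left (S.states.get i))
      init := {i | S.init (S.states.get i) = true ∧ S.left (S.states.get i) = false}
      halt := {i | S.acc (S.states.get i) = true}
      acc := {i | S.acc (S.states.get i) = true}
      trans := {t | (S.entry (S.states.get t.1) t.2.1 (S.states.get t.2.2)).isSome = true}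
      init_right := fun q hq => Side.ofBool_eq_R.2 hq.2
      acc_halt := fun _ h => h
      no_exit := by
        intro p a q h
        obtain ⟨w, hw⟩ := Option.isSome_iff_exists.1 h
        have := (S.legal_iff.1 (S.entry_eq_some.1 hw).1).1
        simpa using this
      bound_left := by
        intro p q h
        obtain ⟨w, hw⟩ := Option.isSome_iff_exists.1 h
        have := (S.legal_iff.1 (S.entry_eq_some.1 hw).1).2.1
        simpa using this
      bound_right := by
        intro p q h
        obtain ⟨w, hw⟩ := Option.isSome_iff_exists.1 h
        have := (S.legal_iff.1 (S.entry_eq_some.1 hw).1).2.2.1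
        simpa using this
      halt_entry := by
        intro p a q h hq
        obtain ⟨w, hw⟩ := Option.isSome_iff_exists.1 h
        have := (S.legal_iff.1 (S.entry_eq_some.1 hw).1).2.2.2 hq
        simpa using this }
  weight := fun t => (S.entry (S.states.get t.1.1) t.1.2.1 (S.states.get t.1.2.2)).get t.2
  constraint := ψ

variable {S} {hne : S.states ≠ []} {ψ : ExFormula d}

theorem mem_trans_toPA {p q : Fin S.states.length} {a : Letter α} :
    (p, a, q) ∈ (S.toPA hne ψ).aut.trans ↔
      ∃ w, S.entry (S.states.get p) a (S.states.get q) = some w :=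
  Option.isSome_iff_exists

theorem weight_toPA {p q : Fin S.states.length} {a : Letter α} {w : Fin d → ℤ}
    (h : (p, a, q) ∈ (S.toPA hne ψ).aut.trans)
    (hw : S.entry (S.states.get p) a (S.states.get q) = some w) :
    (S.toPA hne ψ).weight ⟨(p, a, q), h⟩ = w :=
  Option.get_of_mem _ hw

/-- Replace indices by the states they stand for. -/
def unindex (c : Config α (Fin S.states.length)) : Config α σ :=
  ⟨c.left, S.states.get c.state, c.right⟩

theorem wStep_toPA_iff {c c' : Config α (Fin S.states.length)} {w : Fin d → ℤ} :
    (S.toPA hne ψ).WStep c w c' ↔ S.WStep (unindex c) w (unindex c') := by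
  constructor
  · rintro ⟨⟨⟨p, a, q⟩, ht⟩, hs, rfl⟩
    obtain ⟨rfl, rfl, hm⟩ := (TwoWayAutomaton.step_iff _ _ _ _).1 hs
    obtain ⟨w, hw⟩ := mem_trans_toPA.1 ht
    refine ⟨List.get_mem _ _, List.get_mem _ _, a, ?_, ?_⟩
    · rw [weight_toPA ht hw]; exact hw
    · simpa [toPA, unindex] using hm
  · rintro ⟨-, -, a, he, hm⟩
    have ht : (c.state, a, c'.state) ∈ (S.toPA hne ψ).aut.trans := mem_trans_toPA.2 ⟨w, he⟩
    refine ⟨⟨_, ht⟩, (TwoWayAutomaton.step_iff _ _ _ _).2 ⟨rfl, rfl, ?_⟩, weight_toPA ht he⟩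
    simpa [toPA, unindex] using hm

theorem star_toPA {c c' : Config α (Fin S.states.length)} {v : Fin d → ℤ}
    (h : Star (S.toPA hne ψ).WStep c v c') : Star S.WStep (unindex c) v (unindex c') := by
  induction h with
  | refl => exact .refl _
  | head h _ ih => exact .head (wStep_toPA_iff.1 h) ih

theorem exists_star_toPA {c : Config α (Fin S.states.length)} {c₀ c' : Config α σ}
    {v : Fin d → ℤ} (h : Star S.WStep c₀ v c') (hc : unindex c = c₀) :
    ∃ c₁, unindex c₁ = c' ∧ Star (S.toPA hne ψ).WStep c v c₁ := by
  induction h generalizing c with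
  | refl => exact ⟨c, hc, .refl _⟩
  | head h _ ih =>
    rename_i c₁ c₂ _ _ _
    obtain ⟨i, hi⟩ := List.get_of_mem h.2.1
    obtain ⟨c₃, h₃, h₄⟩ := ih (c := ⟨c₁.left, i, c₁.right⟩) (by rw [unindex, hi])
    refine ⟨c₃, h₃, .head (wStep_toPA_iff.2 ?_) h₄⟩
    have : unindex (⟨c₁.left, i, c₁.right⟩ : Config α (Fin S.states.length)) = c₁ := by
      rw [unindex, hi]
    rw [hc, this]
    exact h

theorem mem_language_toPA {u : List α} :
    u ∈ (S.toPA hne ψ).language ↔ ∃ v, S.Accepts u v ∧ ψ.Sat v := by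
  rw [ParikhAutomaton.mem_language]
  constructor
  · rintro ⟨q, hq, v, c, hr, hc, hs⟩
    exact ⟨v, ⟨_, List.get_mem _ q, hq.1, hq.2, _, star_toPA hr, hc⟩, hs⟩
  · rintro ⟨v, ⟨s, hs, h₁, h₂, c, hr, hc⟩, hv⟩
    obtain ⟨i, rfl⟩ := List.get_of_mem hs
    obtain ⟨c₁, rfl, h₃⟩ := exists_star_toPA (hne := hne) (ψ := ψ)
      (c := (⟨[], i, tape u⟩ : Config α (Fin S.states.length))) hr rfl
    exact ⟨i, ⟨h₁, h₂⟩, v, c₁, h₃, hc, hv⟩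

theorem deterministic_toPA (hnd : S.states.Nodup)
    (hinit : ∀ p q, S.init p = true → S.init q = true → p = q)
    (hdet : ∀ p a q q' w w', S.tr p a q = some w → S.tr p a q' = some w' → q = q') :
    (S.toPA hne ψ).aut.Deterministic := by
  have inj : ∀ {i j : Fin S.states.length}, S.states.get i = S.states.get j → i = j :=
    fun h => List.nodup_iff_injective_get.1 hnd h
  refine ⟨fun p hp q hq => inj (hinit _ _ hp.1 hq.1), fun p a q q' h h' => inj ?_⟩
  obtain ⟨w, hw⟩ := mem_trans_toPA.1 h
  obtain ⟨w', hw'⟩ := mem_trans_toPA.1 h'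
  exact hdet _ _ _ _ _ _ (S.entry_eq_some.1 hw).2 (S.entry_eq_some.1 hw').2

theorem reversible_toPA (hnd : S.states.Nodup)
    (hinit : ∀ p q, S.init p = true → S.init q = true → p = q)
    (hacc : ∀ p q, S.acc p = true → S.acc q = true → p = q)
    (hdet : ∀ p a q q' w w', S.tr p a q = some w → S.tr p a q' = some w' → q = q')
    (hcodet : ∀ p ∈ S.states, ∀ p' ∈ S.states, ∀ a q w w', S.tr p a q = some w →
      S.tr p' a q = some w' → p = p')
    (hside : ∀ p p' a a' q w w', S.tr p a q = some w → S.tr p' a' q = some w' →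
      S.left p = S.left p') :
    (S.toPA hne ψ).IsReversible2DPA := by
  have inj : ∀ {i j : Fin S.states.length}, S.states.get i = S.states.get j → i = j :=
    fun h => List.nodup_iff_injective_get.1 hnd h
  refine ⟨deterministic_toPA hnd hinit hdet, fun p hp q hq => inj (hacc _ _ hp hq),
    fun p p' a q h h' => inj ?_, fun p p' a a' q h h' => ?_⟩
  · obtain ⟨w, hw⟩ := mem_trans_toPA.1 h
    obtain ⟨w', hw'⟩ := mem_trans_toPA.1 h'
    exact hcodet _ (List.get_mem _ _) _ (List.get_mem _ _) _ _ _ _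
      (S.entry_eq_some.1 hw).2 (S.entry_eq_some.1 hw').2
  · obtain ⟨w, hw⟩ := mem_trans_toPA.1 h
    obtain ⟨w', hw'⟩ := mem_trans_toPA.1 h'
    exact congrArg Side.ofBool (hside _ _ _ _ _ _ _ (S.entry_eq_some.1 hw).2
      (S.entry_eq_some.1 hw').2)

end toPA

end Spec

/-! ### Renaming letters and states -/

/-- Rename the letters and keep the delimiters. -/
def Letter.map {α β : Type*} (e : α → β) : Letter α → Letter β
  | .lend => .lend
  | .rend => .rend
  | .sym a => .sym (e a)

theorem Letter.map_injective {α β : Type*} {e : α → β} (he : Function.Injective e) :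
    Function.Injective (Letter.map e) := by
  intro a b h
  cases a <;> cases b <;> simp_all [Letter.map]
  exact he h

@[simp] theorem Letter.map_eq_rend {α β : Type*} {e : α → β} {a : Letter α} :
    a.map e = .rend ↔ a = .rend := by cases a <;> simp [Letter.map]

@[simp] theorem tape_map {α β : Type*} (e : α → β) (u : List α) :
    tape (u.map e) = (tape u).map (Letter.map e) := by
  simp [tape, Letter.map, Function.comp_def]

theorem Letter.map_map {α β γ : Type*} (e : α → β) (f : β → γ) (a : Letter α) :
    (a.map e).map f = a.map (f ∘ e) := by cases a <;> rfl

theorem Letter.map_id {α : Type*} (a : Letter α) : a.map id = a := by cases a <;> rfl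

namespace ParikhAutomaton

variable {α β Q R : Type*} {d : ℕ}

/-- The automaton over `β` with states `R` obtained by reading letters and states through
bijections to `α` and `Q`. -/
def comap (P : ParikhAutomaton α Q d) (e : β ≃ α) (f : R ≃ Q) : ParikhAutomaton β R d where
  aut :=
    { finite := have := P.aut.finite; Finite.of_equiv _ f.symm
      nonempty := P.aut.nonempty.map f.symm
      side := fun q => P.aut.side (f q)
      init := {q | f q ∈ P.aut.init}
      halt := {q | f q ∈ P.aut.halt}
      acc := {q | f q ∈ P.aut.acc}
      trans := {t | (f t.1, t.2.1.map e, f t.2.2) ∈ P.aut.trans}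
      init_right := fun q hq => P.aut.init_right _ hq
      acc_halt := fun _ h => P.aut.acc_halt h
      no_exit := fun p a q h => P.aut.no_exit _ _ _ h
      bound_left := fun p q h => P.aut.bound_left _ _ h
      bound_right := fun p q h => P.aut.bound_right _ _ h
      halt_entry := fun p a q h hq => by simpa using P.aut.halt_entry _ _ _ h hq }
  weight := fun t => P.weight ⟨_, t.2⟩
  constraint := P.constraint

variable (P : ParikhAutomaton α Q d) (e : β ≃ α) (f : R ≃ Q)

theorem comap_comap : (P.comap e f).comap e.symm f.symm = P := by
  obtain ⟨A, w, ψ⟩ := P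
  have h : ∀ t : Q × Letter α × Q,
      (f (f.symm t.1), (t.2.1.map e.symm).map e, f (f.symm t.2.2)) = t := by
    rintro ⟨p, a, q⟩
    simp [Letter.map_map, Letter.map_id]
  have h' : ∀ a : Letter α, (a.map e.symm).map e = a := fun a => by
    simp [Letter.map_map, Letter.map_id]
  have hA : ((comap ⟨A, w, ψ⟩ e f).comap e.symm f.symm).aut = A := by
    cases A
    simp [comap, h']
  have hw : ∀ (B : TwoWayAutomaton α Q) (hB : B = A) (w' : B.trans → Fin d → ℤ),
      (∀ t (h₁ : t ∈ B.trans) (h₂ : t ∈ A.trans), w' ⟨t, h₁⟩ = w ⟨t, h₂⟩) →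
      (⟨B, w', ψ⟩ : ParikhAutomaton α Q d) = ⟨A, w, ψ⟩ := by
    rintro B rfl w' hw
    congr
    funext t
    exact hw t.1 t.2 t.2
  refine hw _ hA _ fun t h₁ h₂ => ?_
  change w _ = w _
  congr 2
  exact h t

/-- The image of a configuration. -/
def mapConfig (c : Config β R) : Config α Q :=
  ⟨c.left.map (Letter.map e), f c.state, c.right.map (Letter.map e)⟩

/-- The image of a transition. -/
def mapTrans (t : (P.comap e f).aut.trans) : P.aut.trans := ⟨_, t.2⟩

theorem mapTrans_injective : Function.Injective (mapTrans P e f) := by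
  rintro ⟨⟨p, a, q⟩, h⟩ ⟨⟨p', a', q'⟩, h'⟩ hh
  have hh' : (f p, a.map e, f q) = (f p', a'.map e, f q') := congrArg Subtype.val hh
  rw [Prod.mk.injEq, Prod.mk.injEq] at hh'
  obtain rfl := f.injective hh'.1
  obtain rfl := Letter.map_injective e.injective hh'.2.1
  obtain rfl := f.injective hh'.2.2
  rfl

theorem isRun_comap {c c' : Config β R} {ts : List (P.comap e f).aut.trans}
    (h : (P.comap e f).aut.IsRun c ts c') :
    P.aut.IsRun (mapConfig e f c) (ts.map (mapTrans P e f)) (mapConfig e f c') := by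
  induction h with
  | nil => exact .nil _
  | cons h _ ih =>
    refine .cons ?_ ih
    rw [TwoWayAutomaton.step_iff] at h ⊢
    exact ⟨congrArg f h.1, congrArg f h.2.1, h.2.2.map _⟩

theorem isAcceptingRun_comap {u : List β} {q₀ : R} {ts : List (P.comap e f).aut.trans}
    (h : (P.comap e f).aut.IsAcceptingRun u q₀ ts) :
    P.aut.IsAcceptingRun (u.map e) (f q₀) (ts.map (mapTrans P e f)) := by
  obtain ⟨h₀, c, hr, hc⟩ := h
  exact ⟨h₀, mapConfig e f c, by simpa [mapConfig] using isRun_comap P e f hr, hc⟩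

theorem language_comap_subset {u : List β} (h : u ∈ (P.comap e f).language) :
    u.map e ∈ P.language := by
  obtain ⟨q₀, ts, h, hs⟩ := h
  refine ⟨_, _, isAcceptingRun_comap P e f h, ?_⟩
  rw [value, List.map_map]
  exact hs

theorem mem_language_comap {u : List β} : u ∈ (P.comap e f).language ↔ u.map e ∈ P.language := by
  refine ⟨language_comap_subset P e f, fun h => ?_⟩
  rw [← comap_comap P e f] at h
  simpa using language_comap_subset (P.comap e f) e.symm f.symm h

theorem isUPA_comap (h : P.IsUPA) : (P.comap e f).IsUPA := by
  refine ⟨fun q => h.1 _, fun u q₀ ts q₀' ts' h₁ h₂ => ?_⟩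
  obtain ⟨h₃, h₄⟩ := h.2 _ _ _ _ _ (isAcceptingRun_comap P e f h₁) (isAcceptingRun_comap P e f h₂)
  exact ⟨f.injective h₃, (mapTrans_injective P e f).list_map h₄⟩

theorem is2DPA_comap (h : P.Is2DPA) : (P.comap e f).Is2DPA :=
  ⟨fun _ hp _ hq => f.injective (h.1 hp hq),
    fun _ _ _ _ h₁ h₂ => f.injective (h.2 _ _ _ _ h₁ h₂)⟩

theorem isReversible2DPA_comap (h : P.IsReversible2DPA) : (P.comap e f).IsReversible2DPA :=
  ⟨is2DPA_comap P e f h.1, fun _ hp _ hq => f.injective (h.2.1 hp hq),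
    fun _ _ _ _ h₁ h₂ => f.injective (h.2.2.1 _ _ _ _ h₁ h₂),
    fun _ _ _ _ _ h₁ h₂ => h.2.2.2 _ _ _ _ _ h₁ h₂⟩

end ParikhAutomaton

/-! ### Euler tours of deterministic machines -/

theorem tape_eq_lend {α : Type*} {u : List α} {l r : List (Letter α)}
    (h : l ++ .lend :: r = tape u) : l = [] := by
  cases l with
  | nil => rfl
  | cons x l =>
    simp only [tape, List.cons_append, List.cons.injEq] at h
    have : Letter.lend ∈ u.map Letter.sym ++ [Letter.rend] := by rw [← h.2]; simp
    simp at this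

theorem tape_eq_rend {α : Type*} {u : List α} {l r : List (Letter α)}
    (h : l ++ .rend :: r = tape u) : r = [] := by
  rcases List.eq_nil_or_concat r with rfl | ⟨r', x, rfl⟩
  · rfl
  · have h' : (l ++ .rend :: r') ++ [x] = (.lend :: u.map Letter.sym) ++ [.rend] := by
      simpa [tape] using h
    have h₁ := (List.append_inj_left' h' rfl)
    have : Letter.rend ∈ .lend :: u.map Letter.sym := by rw [← h₁]; simp
    simp at this

/-- The member of a list that follows the first occurrence of `p`. -/
def next {σ : Type*} [DecidableEq σ] (p : σ) : List σ → Option σ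
  | [] => none
  | x :: l => if x = p then l.head? else next p l

section next

variable {σ : Type*} [DecidableEq σ] {p q : σ} {l l₁ l₂ : List σ}

theorem next_append (h : p ∉ l₁) : next p (l₁ ++ p :: l₂) = l₂.head? := by
  induction l₁ with
  | nil => simp [next]
  | cons x l ih =>
    simp only [List.mem_cons, not_or] at h
    simp [next, Ne.symm h.1, ih h.2]

theorem next_mem (h : next p l = some q) : q ∈ l.tail := by
  induction l with
  | nil => simp [next] at h
  | cons x l ih =>
    simp only [next] at h
    split_ifs at h
    · exact List.mem_of_mem_head? h
    · exact List.mem_of_mem_tail (ih h)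

theorem head?_ne_next (hl : l.Nodup) (h : next p l = some q) : l.head? ≠ some q := by
  cases l with
  | nil => simp
  | cons x l =>
    rintro h'
    obtain rfl : x = q := by simpa using h'
    exact (List.nodup_cons.1 hl).1 (next_mem h)

theorem next_injOn (hl : l.Nodup) (hp : p ∈ l) (hq : q ∈ l) (h : next p l = next q l) : p = q := by
  have key : ∀ {q : σ} {t : List σ}, t.Nodup → q ∈ t → next q t ≠ t.head? := by
    intro q t ht hq h
    cases t with
    | nil => simp at hq
    | cons y t => exact head?_ne_next ht h rfl
  induction l with
  | nil => simp at hp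
  | cons x l ih =>
    obtain ⟨hx, hl⟩ := List.nodup_cons.1 hl
    simp only [next] at h
    by_cases h₁ : x = p
    · by_cases h₂ : x = q
      · rw [← h₁, h₂]
      · rw [if_pos h₁, if_neg h₂] at h
        exact absurd h.symm (key hl (List.mem_of_ne_of_mem (Ne.symm h₂) hq))
    · by_cases h₂ : x = q
      · rw [if_neg h₁, if_pos h₂] at h
        exact absurd h (key hl (List.mem_of_ne_of_mem (Ne.symm h₁) hp))
      · rw [if_neg h₁, if_neg h₂] at h
        exact ih hl (List.mem_of_ne_of_mem (Ne.symm h₁) hp)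
          (List.mem_of_ne_of_mem (Ne.symm h₂) hq) h

end next

/-- A deterministic two-way machine with one final state. The Boolean `back q` tells whether
`q` is entered from left-reading states, that is, by moving to the left. -/
structure Machine (α σ W : Type*) where
  states : List σ
  left : σ → Bool
  back : σ → Bool
  start : σ
  fin : σ
  step : σ → Letter α → Option (σ × W)

namespace Machine

/-- The conditions under which the Euler tour of the configuration graph can be performed by a
two-way automaton. By `back_of_lend` and `back_of_rend` the head of a configuration of the
graph always has a letter on the side from which its state is entered. -/
structure Lawful {α σ W : Type*} (M : Machine α σ W) : Prop where
  nodup : M.states.Nodup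
  start_mem : M.start ∈ M.states
  closed : ∀ {p a q w}, p ∈ M.states → M.step p a = some (q, w) → q ∈ M.states
  start_left : M.left M.start = false
  fin_step : ∀ a, M.step M.fin a = none
  back_of_step : ∀ {p a q w}, M.step p a = some (q, w) → M.back q = M.left p
  left_of_lend : ∀ {p q w}, M.step p .lend = some (q, w) → M.left p = true → M.left q = false
  left_of_rend : ∀ {p q w}, M.step p .rend = some (q, w) → M.left p = false →
    M.left q = true ∨ q = M.fin
  step_fin : ∀ {p a w}, M.step p a = some (M.fin, w) → M.left p = false ∧ a = .rend
  back_of_lend : ∀ {p q w}, M.step p .lend = some (q, w) → M.left p = false → M.back p = true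
  back_of_rend : ∀ {p q w}, M.step p .rend = some (q, w) → M.left p = true → M.back p = false

variable {α σ W : Type*} (M : Machine α σ W)

/-- A step between configurations. -/
def Step (c : Config α σ) (w : W) (c' : Config α σ) : Prop :=
  ∃ a, M.step c.state a = some (c'.state, w) ∧
    Mv (M.left c.state) a c.left c.right c'.left c'.right

/-- The word `u` is accepted with value `v`. -/
def Accepts [AddMonoid W] (u : List α) (v : W) : Prop :=
  ∃ c, Star M.Step ⟨[], M.start, tape u⟩ v c ∧ c.state = M.fin

theorem step_det {c c' c'' : Config α σ} {w w' : W} (h : M.Step c w c') (h' : M.Step c w' c'') :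
    w = w' ∧ c' = c'' := by
  obtain ⟨a, h₁, h₂⟩ := h
  obtain ⟨a', h₃, h₄⟩ := h'
  obtain ⟨rfl, h₅, h₆⟩ := h₂.det h₄
  rw [h₁] at h₃
  cases c'; cases c''
  simp_all

/-- The phases of an Euler tour at a state: about to take its transition; about to visit its
predecessors; about to return to this state, after a sibling of it, in order to visit it; about
to return to this state, which has no predecessors. -/
inductive Phase where
  | up | down | cross | turn
  deriving DecidableEq

variable [DecidableEq σ]

/-- The states from which `a` leads to `q`. -/
def preds (q : σ) (a : Letter α) : List σ :=
  M.states.filter fun p => decide ((M.step p a).map Prod.fst = some q)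

theorem mem_preds {p q : σ} {a : Letter α} :
    p ∈ M.preds q a ↔ p ∈ M.states ∧ ∃ w, M.step p a = some (q, w) := by
  simp [preds]

section tour

variable [AddCommGroup W]

/-- The step function of the Euler tour. -/
def tourStep : Phase × σ → Letter α → Option ((Phase × σ) × W)
  | (.up, p), a => (M.step p a).map fun t =>
    (((next p (M.preds t.1 a)).elim (.up, t.1) fun p' => (.cross, p')), t.2)
  | (.down, q), a => (M.preds q a).head?.elim (some ((.turn, q), 0)) fun p =>
    (M.step p a).map fun t => ((.down, p), -t.2)
  | (.cross, p), a => (M.step p a).bind fun t =>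
    if (M.preds t.1 a).head? = some p then none else some ((.down, p), -t.2)
  | (.turn, q), a => if (M.preds q a).head? = none then some ((.up, q), 0) else none

/-- The Euler tour of the configuration graph of a machine. Transitions are traversed forwards,
adding their weights, and backwards, subtracting them. -/
def tour : Spec α (Phase × σ) W where
  states := [Phase.up, .down, .cross, .turn].flatMap fun ph => M.states.map fun q => (ph, q)
  left := fun s => match s.1 with
    | .up => M.left s.2
    | .down => !M.back s.2
    | .cross => !M.left s.2
    | .turn => M.back s.2
  init := fun s => decide (s = (.up, M.start))
  acc := fun s => decide (s = (.up, M.fin))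
  tr := fun s a s' => (M.tourStep s a).bind fun t => if t.1 = s' then some t.2 else none

theorem tour_tr {s s' : Phase × σ} {a : Letter α} {w : W} :
    M.tour.tr s a s' = some w ↔ M.tourStep s a = some (s', w) := by
  simp only [tour]
  cases M.tourStep s a with
  | none => simp
  | some t =>
    obtain ⟨t, w'⟩ := t
    simp only [Option.bind_some, Option.some.injEq, Prod.mk.injEq]
    split_ifs with h <;> simp [h]

@[simp] theorem mem_tour_states {ph : Phase} {q : σ} :
    (ph, q) ∈ M.tour.states ↔ q ∈ M.states := by
  cases ph <;> simp [tour]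

theorem tour_states_nodup (h : M.states.Nodup) : M.tour.states.Nodup := by
  have inj : ∀ ph : Phase, (M.states.map fun q => (ph, q)).Nodup := fun ph =>
    h.map fun _ _ h => (Prod.mk.inj h).2
  have : ∀ {ph ph' : Phase}, ph ≠ ph' → List.Disjoint (M.states.map fun q => (ph, q))
      (M.states.map fun q => (ph', q)) := by
    intro ph ph' hne x hx hx'
    simp only [List.mem_map] at hx hx'
    obtain ⟨_, _, rfl⟩ := hx
    obtain ⟨_, _, h⟩ := hx'
    exact hne (Prod.mk.inj h).1.symm
  simp only [tour, List.flatMap_cons, List.flatMap_nil, List.append_nil]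
  refine List.Nodup.append (inj _) (List.Nodup.append (inj _) (List.Nodup.append (inj _) (inj _)
    (this ?_)) ?_) ?_
  · simp
  · rw [List.disjoint_append_right]; exact ⟨this (by simp), this (by simp)⟩
  · rw [List.disjoint_append_right, List.disjoint_append_right]
    exact ⟨this (by simp), this (by simp), this (by simp)⟩

section step

variable {M} {p q : σ} {a : Letter α} {t : Phase × σ} {w : W}

theorem tourStep_up : M.tourStep (.up, p) a = some (t, w) ↔ ∃ q, M.step p a = some (q, w) ∧
    ((next p (M.preds q a) = none ∧ t = (.up, q)) ∨
      ∃ p', next p (M.preds q a) = some p' ∧ t = (.cross, p')) := by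
  simp only [tourStep, Option.map_eq_some_iff, Prod.exists, Prod.mk.injEq]
  constructor
  · rintro ⟨q, w, h, h', rfl⟩
    refine ⟨q, h, ?_⟩
    cases hn : next p (M.preds q a) <;> simp_all
  · rintro ⟨q, h, ⟨h₁, rfl⟩ | ⟨p', h₁, rfl⟩⟩ <;> exact ⟨q, w, h, by simp [h₁], rfl⟩

theorem tourStep_down : M.tourStep (.down, q) a = some (t, w) ↔
    ((M.preds q a).head? = none ∧ t = (.turn, q) ∧ w = 0) ∨
      ∃ p, (M.preds q a).head? = some p ∧ t = (.down, p) ∧ M.step p a = some (q, -w) := by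
  simp only [tourStep]
  cases h : (M.preds q a).head? with
  | none => simp [eq_comm]
  | some p =>
    obtain ⟨-, w', hw⟩ := M.mem_preds.1 (List.mem_of_mem_head? h)
    simp [hw, eq_comm (b := t), neg_eq_iff_eq_neg]

theorem tourStep_cross : M.tourStep (.cross, p) a = some (t, w) ↔ t = (.down, p) ∧
    ∃ q, M.step p a = some (q, -w) ∧ (M.preds q a).head? ≠ some p := by
  simp only [tourStep]
  cases h : M.step p a with
  | none => simp
  | some s =>
    obtain ⟨q, w'⟩ := s
    simp only [Option.bind_some, Option.some.injEq, Prod.mk.injEq]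
    split_ifs with h' <;> simp [h', eq_comm (b := t), neg_eq_iff_eq_neg]

theorem tourStep_turn : M.tourStep (.turn, q) a = some (t, w) ↔
    (M.preds q a).head? = none ∧ t = (.up, q) ∧ w = 0 := by
  simp only [tourStep]
  split_ifs with h <;> simp [h, eq_comm]

end step

variable {M}

omit [AddCommGroup W] in
theorem preds_nodup (hM : M.Lawful) (q : σ) (a : Letter α) : (M.preds q a).Nodup :=
  hM.nodup.filter _

omit [AddCommGroup W] in
theorem eq_of_mem_preds {p q q' : σ} {a : Letter α} (h : p ∈ M.preds q a)
    (h' : p ∈ M.preds q' a) : q = q' := by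
  obtain ⟨-, w, h₁⟩ := M.mem_preds.1 h
  obtain ⟨-, w', h₂⟩ := M.mem_preds.1 h'
  simp_all

/-- Every configuration is visited from at most one configuration. -/
theorem tourStep_injective (hM : M.Lawful) {s s' t : Phase × σ} {a : Letter α} {w w' : W}
    (hs : s ∈ M.tour.states) (hs' : s' ∈ M.tour.states)
    (h : M.tourStep s a = some (t, w)) (h' : M.tourStep s' a = some (t, w')) : s = s' := by
  obtain ⟨ph, p⟩ := s
  obtain ⟨ph', p'⟩ := s'
  rw [mem_tour_states] at hs hs'
  cases ph <;> cases ph' <;>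
    simp only [tourStep_up, tourStep_down, tourStep_cross, tourStep_turn] at h h'
  · obtain ⟨q, h₁, ⟨h₂, rfl⟩ | ⟨r, h₂, rfl⟩⟩ := h <;>
    obtain ⟨q', h₃, ⟨h₄, h₅⟩ | ⟨r', h₄, h₅⟩⟩ := h' <;> simp only [Prod.mk.injEq, reduceCtorEq,
      false_and, true_and] at h₅
    · subst h₅
      rw [next_injOn (preds_nodup hM q a) (M.mem_preds.2 ⟨hs, _, h₁⟩)
        (M.mem_preds.2 ⟨hs', _, h₃⟩) (h₂.trans h₄.symm)]
    · subst h₅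
      obtain rfl := eq_of_mem_preds (List.mem_of_mem_tail (next_mem h₂))
        (List.mem_of_mem_tail (next_mem h₄))
      rw [next_injOn (preds_nodup hM q a) (M.mem_preds.2 ⟨hs, _, h₁⟩)
        (M.mem_preds.2 ⟨hs', _, h₃⟩) (h₂.trans h₄.symm)]
  · obtain ⟨q, h₁, ⟨h₂, rfl⟩ | ⟨r, h₂, rfl⟩⟩ := h <;> simp at h'
  · obtain ⟨q, h₁, ⟨h₂, rfl⟩ | ⟨r, h₂, rfl⟩⟩ := h <;> simp at h'
  · obtain ⟨q, h₁, ⟨h₂, rfl⟩ | ⟨r, h₂, rfl⟩⟩ := h <;> simp only [Prod.mk.injEq, reduceCtorEq,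
      false_and, true_and, and_false] at h'
    obtain ⟨h₃, rfl, -⟩ := h'
    have := M.mem_preds.2 ⟨hs, _, h₁⟩
    rw [List.head?_eq_none_iff] at h₃
    simp [h₃] at this
  · obtain ⟨q, h₁, ⟨h₂, rfl⟩ | ⟨r, h₂, rfl⟩⟩ := h' <;> simp at h
  · obtain ⟨h₁, rfl, -⟩ | ⟨r, h₁, rfl, h₂⟩ := h <;> simp at h'
    · rw [h'.2.1]
    · obtain ⟨h₃, h₄⟩ := h'
      rw [eq_of_mem_preds (List.mem_of_mem_head? h₁) (List.mem_of_mem_head? h₃)]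
  · obtain ⟨rfl, q, h₁, h₂⟩ := h'
    obtain ⟨h₃, h₄, -⟩ | ⟨r, h₃, h₄, h₅⟩ := h <;> simp at h₄
    subst h₄
    rw [eq_of_mem_preds (List.mem_of_mem_head? h₃) (M.mem_preds.2 ⟨hs', _, h₁⟩)] at h₃
    exact absurd h₃ h₂
  · obtain ⟨-, rfl, -⟩ := h'
    simp at h
  · obtain ⟨q, h₁, ⟨h₂, rfl⟩ | ⟨r, h₂, rfl⟩⟩ := h' <;> simp at h
  · obtain ⟨rfl, q, h₁, h₂⟩ := h
    obtain ⟨h₃, h₄, -⟩ | ⟨r, h₃, h₄, h₅⟩ := h' <;> simp at h₄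
    subst h₄
    rw [eq_of_mem_preds (List.mem_of_mem_head? h₃) (M.mem_preds.2 ⟨hs, _, h₁⟩)] at h₃
    exact absurd h₃ h₂
  · obtain ⟨rfl, -⟩ := h
    simp only [Prod.mk.injEq, true_and] at h'
    rw [h'.1]
  · obtain ⟨-, rfl, -⟩ := h'
    simp at h
  · obtain ⟨q, h₁, ⟨h₂, rfl⟩ | ⟨r, h₂, rfl⟩⟩ := h' <;> simp only [Prod.mk.injEq, reduceCtorEq,
      false_and, true_and, and_false] at h
    obtain ⟨h₃, rfl, -⟩ := h
    have := M.mem_preds.2 ⟨hs', _, h₁⟩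
    rw [List.head?_eq_none_iff] at h₃
    simp [h₃] at this
  · obtain ⟨-, rfl, -⟩ := h
    simp at h'
  · obtain ⟨-, rfl, -⟩ := h
    simp at h'
  · obtain ⟨-, rfl, -⟩ := h
    simp only [Prod.mk.injEq, true_and] at h'
    rw [h'.2.1]

/-- The side from which a state of the tour is entered. -/
theorem tourStep_left (hM : M.Lawful) {s t : Phase × σ} {a : Letter α} {w : W}
    (h : M.tourStep s a = some (t, w)) : M.tour.left s = match t.1 with
      | .up => M.back t.2
      | .down => !M.left t.2
      | .cross => M.left t.2
      | .turn => !M.back t.2 := by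
  obtain ⟨ph, p⟩ := s
  cases ph <;> simp only [tourStep_up, tourStep_down, tourStep_cross, tourStep_turn] at h
  · obtain ⟨q, h₁, ⟨h₂, rfl⟩ | ⟨r, h₂, rfl⟩⟩ := h
    · simp [tour, hM.back_of_step h₁]
    · obtain ⟨-, w', h₃⟩ := M.mem_preds.1 (List.mem_of_mem_tail (next_mem h₂))
      simp [tour, ← hM.back_of_step h₁, ← hM.back_of_step h₃]
  · obtain ⟨h₁, rfl, -⟩ | ⟨r, h₁, rfl, h₂⟩ := h
    · simp [tour]
    · simp [tour, hM.back_of_step h₂]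
  · obtain ⟨rfl, -⟩ := h
    simp [tour]
  · obtain ⟨-, rfl, -⟩ := h
    simp [tour]

theorem tour_reversible {d : ℕ} {M : Machine α σ (Fin d → ℤ)} (hM : M.Lawful)
    (hne : M.tour.states ≠ []) (ψ : ExFormula d) : (M.tour.toPA hne ψ).IsReversible2DPA := by
  refine Spec.reversible_toPA (tour_states_nodup _ hM.nodup) ?_ ?_ ?_ ?_ ?_
  · intro p q hp hq
    simp only [tour, decide_eq_true_eq] at hp hq
    rw [hp, hq]
  · intro p q hp hq
    simp only [tour, decide_eq_true_eq] at hp hq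
    rw [hp, hq]
  · intro p a q q' w w' h h'
    rw [tour_tr] at h h'
    simp_all
  · intro p hp p' hp' a q w w' h h'
    rw [tour_tr] at h h'
    exact tourStep_injective hM hp hp' h h'
  · intro p p' a a' q w w' h h'
    rw [tour_tr] at h h'
    rw [tourStep_left hM h, tourStep_left hM h']

end tour

end Machine

namespace Machine

variable {α σ W : Type*} [AddCommGroup W] {M : Machine α σ W}

/-- From `c` the final state is reached. -/
def Alive (M : Machine α σ W) (c : Config α σ) : Prop :=
  ∃ v c', Star M.Step c v c' ∧ c'.state = M.fin

theorem alive_iff_of_step (hM : M.Lawful) {c c' : Config α σ} {w : W} (h : M.Step c w c') :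
    M.Alive c ↔ M.Alive c' := by
  constructor
  · rintro ⟨v, c'', h₁, h₂⟩
    cases h₁ with
    | refl =>
      obtain ⟨a, h₃, -⟩ := h
      rw [h₂, hM.fin_step] at h₃
      simp at h₃
    | head h₃ h₄ =>
      obtain ⟨-, rfl⟩ := M.step_det h h₃
      exact ⟨_, _, h₄, h₂⟩
  · rintro ⟨v, c'', h₁, h₂⟩
    exact ⟨_, _, .head h h₁, h₂⟩

/-- No run from a configuration to the final state contains a cycle. -/
theorem not_transGen_of_alive (hM : M.Lawful) {c : Config α σ} (h : M.Alive c) :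
    ¬ Relation.TransGen (fun c c' => ∃ w, M.Step c w c') c c := by
  obtain ⟨v, c', h, hc⟩ := h
  induction h with
  | refl c =>
    intro ht
    obtain ⟨c₁, ⟨w, a, h, -⟩, -⟩ := Relation.TransGen.head'_iff.1 ht
    rw [hc, hM.fin_step] at h
    simp at h
  | head h h' ih =>
    intro ht
    obtain ⟨c₁, ⟨w, h₁⟩, h₂⟩ := Relation.TransGen.head'_iff.1 ht
    obtain ⟨-, rfl⟩ := M.step_det h h₁
    exact ih hc (.tail' h₂ ⟨_, h⟩)

/-- The configurations on the word `u` from which the final state is reached. -/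
structure Live (M : Machine α σ W) (u : List α) (c : Config α σ) : Prop where
  tape_eq : c.left ++ c.right = tape u
  mem : c.state ∈ M.states
  alive : M.Alive c

/-- Finiteness makes the tree of the live configurations well founded. -/
theorem finite_live (M : Machine α σ W) (u : List α) : {c | M.Live u c}.Finite := by
  have : {c : Config α σ | M.Live u c} ⊆
      (fun x : ℕ × σ => ⟨(tape u).take x.1, x.2, (tape u).drop x.1⟩) ''
        (Set.Iic (tape u).length ×ˢ {q | q ∈ M.states}) := by
    intro c hc
    refine ⟨(c.left.length, c.state), ⟨?_, hc.mem⟩, ?_⟩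
    · simp [← hc.tape_eq]
    · simp [← hc.tape_eq]
  exact ((Set.finite_Iic _).prod (List.finite_toSet _)).image _ |>.subset this

theorem Live.step (hM : M.Lawful) {u : List α} {c c' : Config α σ} {w : W} (h : M.Live u c)
    (hs : M.Step c w c') : M.Live u c' := by
  obtain ⟨a, h₁, h₂⟩ := hs
  exact ⟨h₂.append.trans h.tape_eq, hM.closed h.mem h₁,
    (alive_iff_of_step hM ⟨a, h₁, h₂⟩).1 h.alive⟩

/-- Induction over the tree of the live configurations, from the leaves to the root. -/
theorem live_induction (hM : M.Lawful) {u : List α} {p : Config α σ → Prop}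
    (ih : ∀ c, M.Live u c → (∀ c' w, M.Live u c' → M.Step c' w c → p c') → p c) {c : Config α σ}
    (hc : M.Live u c) : p c := by
  let r : {c | M.Live u c} → {c | M.Live u c} → Prop :=
    fun c c' => Relation.TransGen (fun c c' => ∃ w, M.Step c w c') c.1 c'.1
  have : Finite {c | M.Live u c} := finite_live M u
  have : IsTrans _ r := ⟨fun _ _ _ h h' => h.trans h'⟩
  have : Std.Irrefl r := ⟨fun c h => not_transGen_of_alive hM c.2.alive h⟩
  have wf : WellFounded r := Finite.wellFounded_of_trans_of_irrefl r
  exact wf.induction (C := fun c => p c.1) ⟨c, hc⟩ fun c hc =>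
    ih c.1 c.2 fun c' w h h' => hc ⟨c', h⟩ (.single ⟨w, h'⟩)

/-- A configuration of the tour. -/
def at' (ph : Phase) (c : Config α σ) : Config α (Phase × σ) := ⟨c.left, (ph, c.state), c.right⟩

/-- The letter on the side from which a live configuration is entered. -/
theorem Live.exists_mv (hM : M.Lawful) {u : List α} {c : Config α σ} (h : M.Live u c)
    (hf : c.state ≠ M.fin) : ∃ a l r, Mv (!M.back c.state) a c.left c.right l r ∧
      ¬ (a = .lend ∧ M.back c.state = true ∧ M.left c.state = true) ∧
      ¬ (a = .rend ∧ M.back c.state = false ∧ M.left c.state = false) := by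
  obtain ⟨v, c', hs, hc'⟩ := h.alive
  cases hs with
  | refl => exact absurd hc' hf
  | head h₁ h₂ =>
    obtain ⟨a₀, h₃, h₄⟩ := h₁
    have ht := h.tape_eq
    obtain ⟨l, q, r⟩ := c
    simp only at h₃ h₄ ht ⊢
    cases hb : M.back q <;> cases hl : M.left q <;> rw [hl] at h₄ <;> obtain ⟨h₄, -⟩ := h₄
    · rcases List.eq_nil_or_concat' l with rfl | ⟨l', a, rfl⟩
      · rw [h₄, List.nil_append, tape, List.cons.injEq] at ht
        obtain ⟨rfl, -⟩ := ht
        simp [hM.back_of_lend h₃ hl] at hb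
      · refine ⟨a, l', _, Mv.left _ _ _, by simp, ?_⟩
        rintro ⟨rfl, -⟩
        simp only [List.append_assoc, List.singleton_append] at ht
        simp [tape_eq_rend ht] at h₄
    · exact ⟨a₀, _, _, ⟨h₄, rfl⟩, by simp, by simp⟩
    · exact ⟨a₀, _, _, ⟨h₄, rfl⟩, by simp, by simp⟩
    · cases r with
      | nil =>
        rw [h₄, List.append_nil, tape, ← List.cons_append] at ht
        obtain rfl : a₀ = .rend := by simpa using List.append_inj_right' ht rfl
        simp [hM.back_of_rend h₃ hl] at hb
      | cons a r =>
        refine ⟨a, _, r, Mv.right _ _ _, ?_, by simp⟩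
        rintro ⟨rfl, -⟩
        simp [tape_eq_lend ht] at h₄

variable [DecidableEq σ]

theorem tour_wStep {u : List α} {ph ph' : Phase} {c c' : Config α σ} {w : W} (a : Letter α)
    (h : M.Live u c) (h' : M.Live u c')
    (hl : M.tour.legal (ph, c.state) a (ph', c'.state) = true)
    (hs : M.tourStep (ph, c.state) a = some ((ph', c'.state), w))
    (hm : Mv (M.tour.left (ph, c.state)) a c.left c.right c'.left c'.right) :
    M.tour.WStep (at' ph c) w (at' ph' c') :=
  ⟨M.mem_tour_states.2 h.mem, M.mem_tour_states.2 h'.mem, a,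
    Spec.entry_eq_some _ |>.2 ⟨hl, M.tour_tr.2 hs⟩, hm⟩

/-- After the subtree of a predecessor `p` of `c`, the tour visits the subtrees of the remaining
siblings of `p` and goes on to `c`. -/
theorem tour_ascend (hM : M.Lawful) {u : List α} {c : Config α σ} (hc : M.Live u c) {a : Letter α}
    {l r : List (Letter α)} (hmv : Mv (!M.back c.state) a c.left c.right l r)
    (ih : ∀ p ∈ M.preds c.state a, M.Live u ⟨l, p, r⟩ →
      Star M.tour.WStep (at' .down ⟨l, p, r⟩) 0 (at' .up ⟨l, p, r⟩))
    (l₁ l₂ : List σ) (p : σ) (hp : M.preds c.state a = l₁ ++ p :: l₂) {w : W}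
    (hw : M.step p a = some (c.state, w)) :
    Star M.tour.WStep (at' .up ⟨l, p, r⟩) w (at' .up c) := by
  have hmv' : Mv (M.back c.state) a l r c.left c.right := by simpa using hmv.symm
  have live : ∀ {p : σ}, p ∈ M.preds c.state a → M.Live u ⟨l, p, r⟩ := by
    intro p hp
    obtain ⟨h₁, w, h₂⟩ := M.mem_preds.1 hp
    refine ⟨hmv.append.trans hc.tape_eq, h₁, (alive_iff_of_step hM ⟨a, h₂, ?_⟩).2 hc.alive⟩
    rw [hM.back_of_step h₂] at hmv'
    exact hmv'
  have hnd := preds_nodup hM c.state a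
  induction l₂ generalizing l₁ p w with
  | nil =>
    have hp' : p ∈ M.preds c.state a := by simp [hp]
    have hn : next p (M.preds c.state a) = none := by
      rw [hp] at hnd ⊢
      exact next_append fun h => (List.disjoint_of_nodup_append hnd) h (by simp)
    refine .single (tour_wStep a (live hp') hc ?_
      (tourStep_up.2 ⟨c.state, hw, .inl ⟨hn, rfl⟩⟩) ?_)
    · rw [Spec.legal_iff]
      simp only [tour, decide_eq_true_eq, decide_eq_false_iff_not, Prod.mk.injEq, true_and]
      refine ⟨?_, ?_, ?_, ?_⟩
      · rintro rfl
        simp [hM.fin_step] at hw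
      · rintro ⟨rfl, h₁, h₂⟩
        simp [hM.left_of_lend hw h₁] at h₂
      · rintro ⟨rfl, h₁, h₂, h₃⟩
        rcases hM.left_of_rend hw h₁ with h | h
        · simp [h] at h₂
        · exact h₃ h
      · intro h
        rw [h] at hw
        exact hM.step_fin hw
    · rw [hM.back_of_step hw] at hmv'
      exact hmv'
  | cons p' l₂ ih₂ =>
    have hp₁ : p ∈ M.preds c.state a := by simp [hp]
    have hp₂ : p' ∈ M.preds c.state a := by simp [hp]
    have hpre : M.preds c.state a = (l₁ ++ [p]) ++ p' :: l₂ := by simp [hp]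
    obtain ⟨-, w', hw'⟩ := M.mem_preds.1 hp₂
    have hn : next p (M.preds c.state a) = some p' := by
      rw [hp] at hnd ⊢
      exact next_append fun h => (List.disjoint_of_nodup_append hnd) h (by simp)
    have hh := head?_ne_next hnd hn
    have hb := hM.back_of_step hw
    have hb' := hM.back_of_step hw'
    let c₁ : Config α (Phase × σ) := ⟨c.left, (.cross, p'), c.right⟩
    have s₁ : M.tour.WStep (at' .up ⟨l, p, r⟩) w c₁ := by
      refine ⟨M.mem_tour_states.2 (M.mem_preds.1 hp₁).1, M.mem_tour_states.2 (M.mem_preds.1 hp₂).1,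
        a, Spec.entry_eq_some _ |>.2 ⟨?_, M.tour_tr.2
          (tourStep_up.2 ⟨_, hw, .inr ⟨_, hn, rfl⟩⟩)⟩, ?_⟩
      · rw [Spec.legal_iff]
        simp only [tour, at', c₁]
        refine ⟨?_, ?_, ?_, ?_⟩
        · simp only [decide_eq_false_iff_not, Prod.mk.injEq, true_and]
          rintro rfl
          simp [hM.fin_step] at hw
        · rintro ⟨-, h₁, h₂⟩
          simp [← hb', hb, h₁] at h₂
        · rintro ⟨-, h₁, h₂, -⟩
          simp [← hb', hb, h₁] at h₂
        · simp
      · rw [hb] at hmv'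
        exact hmv'
    have s₂ : M.tour.WStep c₁ (-w') (at' .down ⟨l, p', r⟩) := by
      refine ⟨M.mem_tour_states.2 (M.mem_preds.1 hp₂).1, M.mem_tour_states.2 (M.mem_preds.1 hp₂).1,
        a, Spec.entry_eq_some _ |>.2 ⟨?_, M.tour_tr.2
          (tourStep_cross.2 ⟨rfl, _, by simpa using hw', hh⟩)⟩, ?_⟩
      · rw [Spec.legal_iff]
        simp only [tour, at', c₁]
        refine ⟨by simp, ?_, ?_, by simp⟩
        · rintro ⟨rfl, h₁, h₂⟩
          simp only [Bool.not_eq_true'] at h₁ h₂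
          simp [hM.back_of_lend hw' h₁] at h₂
        · rintro ⟨rfl, h₁, h₂, -⟩
          simp only [Bool.not_eq_false'] at h₁ h₂
          simp [hM.back_of_rend hw' h₁] at h₂
      · rw [hb'] at hmv
        exact hmv
    have s₃ := ih₂ (l₁ ++ [p]) p' hpre hw'
    have := (Star.head s₁ (.head s₂ (ih p' hp₂ (live hp₂)))).trans s₃
    simpa using this

/-- The tour visits the subtree of a live configuration; the weights cancel out. -/
theorem tour_explore (hM : M.Lawful) {u : List α} {c : Config α σ} (hc : M.Live u c)
    (hf : c.state ≠ M.fin) : Star M.tour.WStep (at' .down c) 0 (at' .up c) := by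
  revert hf
  refine live_induction (p := fun c => c.state ≠ M.fin → Star M.tour.WStep (at' .down c) 0
    (at' .up c)) hM (fun c hc ih hf => ?_) hc
  obtain ⟨a, l, r, hmv, ha₁, ha₂⟩ := hc.exists_mv hM hf
  have hmv' : Mv (M.back c.state) a l r c.left c.right := by simpa using hmv.symm
  have ih' : ∀ p ∈ M.preds c.state a, M.Live u ⟨l, p, r⟩ →
      Star M.tour.WStep (at' .down ⟨l, p, r⟩) 0 (at' .up ⟨l, p, r⟩) := by
    intro p hp h
    obtain ⟨-, w, hw⟩ := M.mem_preds.1 hp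
    refine ih _ w h ⟨a, hw, ?_⟩ ?_
    · rw [hM.back_of_step hw] at hmv'
      exact hmv'
    · rintro rfl
      simp [hM.fin_step] at hw
  cases hp : M.preds c.state a with
  | nil =>
    have hh : (M.preds c.state a).head? = none := by simp [hp]
    let c₁ : Config α (Phase × σ) := ⟨l, (.turn, c.state), r⟩
    have s₁ : M.tour.WStep (at' .down c) 0 c₁ := by
      refine ⟨M.mem_tour_states.2 hc.mem, M.mem_tour_states.2 hc.mem, a,
        Spec.entry_eq_some _ |>.2 ⟨?_, M.tour_tr.2 (tourStep_down.2 (.inl ⟨hh, rfl, rfl⟩))⟩, hmv⟩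
      rw [Spec.legal_iff]
      simp [tour, at', c₁]
    have s₂ : M.tour.WStep c₁ 0 (at' .up c) := by
      refine ⟨M.mem_tour_states.2 hc.mem, M.mem_tour_states.2 hc.mem, a,
        Spec.entry_eq_some _ |>.2 ⟨?_, M.tour_tr.2 (tourStep_turn.2 ⟨hh, rfl, rfl⟩)⟩, hmv'⟩
      rw [Spec.legal_iff]
      refine ⟨by simp [tour, c₁], ha₁, fun h => ha₂ ⟨h.1, h.2.1, h.2.2.1⟩, ?_⟩
      simp [tour, at', hf]
    simpa using Star.head s₁ (.single s₂)
  | cons p l₂ =>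
    have hp' : p ∈ M.preds c.state a := by simp [hp]
    obtain ⟨hps, w, hw⟩ := M.mem_preds.1 hp'
    have hb := hM.back_of_step hw
    have hlive : M.Live u ⟨l, p, r⟩ :=
      ⟨hmv.append.trans hc.tape_eq, hps,
        (alive_iff_of_step hM ⟨a, hw, hb ▸ hmv'⟩).2 hc.alive⟩
    have s₁ : M.tour.WStep (at' .down c) (-w) (at' .down ⟨l, p, r⟩) := by
      refine tour_wStep a hc hlive ?_ (tourStep_down.2 (.inr ⟨p, by simp [hp], rfl, by simpa⟩)) hmv
      rw [Spec.legal_iff]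
      simp only [tour]
      refine ⟨by simp, ?_, ?_, by simp⟩
      · rintro ⟨rfl, h₁, h₂⟩
        simp only [Bool.not_eq_true'] at h₁ h₂
        simp [hM.back_of_lend hw (hb ▸ h₁)] at h₂
      · rintro ⟨rfl, h₁, h₂, -⟩
        simp only [Bool.not_eq_false'] at h₁ h₂
        simp [hM.back_of_rend hw (hb ▸ h₁)] at h₂
    have := (Star.head s₁ (ih' p hp' hlive)).trans (tour_ascend hM hc hmv ih' [] l₂ p hp hw)
    simpa using this

theorem tour_star (hM : M.Lawful) {u : List α} {c c' : Config α σ} {v : W}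
    (h : Star M.Step c v c') (hc : M.Live u c) : Star M.tour.WStep (at' .up c) v (at' .up c') := by
  induction h with
  | refl => exact .refl _
  | @head c₁ c₂ _ w _ h h' ih =>
    refine Star.trans ?_ (ih (hc.step hM h))
    obtain ⟨a, hw, hm⟩ := id h
    have hp : c₁.state ∈ M.preds c₂.state a := M.mem_preds.2 ⟨hc.mem, _, hw⟩
    obtain ⟨l₁, l₂, h₁⟩ := List.append_of_mem hp
    refine tour_ascend hM (hc.step hM h) (l := c₁.left) (r := c₁.right) ?_ ?_ l₁ l₂ _ h₁ hw
    · rw [hM.back_of_step hw]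
      exact hm.symm
    · intro p hp hlive
      refine tour_explore hM hlive ?_
      rintro rfl
      obtain ⟨-, w, hw⟩ := M.mem_preds.1 hp
      simp [hM.fin_step] at hw

/-- The invariant of a tour that reaches the final state: it stays among the live
configurations. -/
def TourAlive (M : Machine α σ W) (c : Config α (Phase × σ)) : Prop :=
  match c.state.1 with
  | .up | .down => M.Alive ⟨c.left, c.state.2, c.right⟩
  | .cross => ∀ a l r, Mv (!M.left c.state.2) a c.left c.right l r → M.Alive ⟨l, c.state.2, r⟩
  | .turn => ∀ a l r, Mv (M.back c.state.2) a c.left c.right l r → M.Alive ⟨l, c.state.2, r⟩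

theorem tourAlive_of_wStep (hM : M.Lawful) {c c' : Config α (Phase × σ)} {w : W}
    (h : M.tour.WStep c w c') (h' : M.TourAlive c') : M.TourAlive c := by
  obtain ⟨-, -, a, he, hm⟩ := h
  have hs := M.tour_tr.1 ((Spec.entry_eq_some _).1 he).2
  obtain ⟨l, ⟨ph, p⟩, r⟩ := c
  obtain ⟨l', t, r'⟩ := c'
  simp only at he hm hs
  cases ph <;> simp only [tourStep_up, tourStep_down, tourStep_cross, tourStep_turn] at hs
  · obtain ⟨q, h₁, ⟨h₂, rfl⟩ | ⟨p', h₂, rfl⟩⟩ := hs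
    · exact (alive_iff_of_step hM (c := ⟨l, p, r⟩) (c' := ⟨l', q, r'⟩) ⟨a, h₁, hm⟩).2 h'
    · obtain ⟨-, w', h₃⟩ := M.mem_preds.1 (List.mem_of_mem_tail (next_mem h₂))
      have hl : M.left p' = M.left p := by rw [← hM.back_of_step h₁, ← hM.back_of_step h₃]
      have hm' : Mv (M.left p) a l r l' r' := hm
      have h₄ : M.Alive ⟨l, p', r⟩ := h' a l r (by simp only [hl]; exact hm'.symm)
      have h₅ : M.Alive ⟨l', q, r'⟩ :=
        (alive_iff_of_step hM ⟨a, h₃, by simp only [hl]; exact hm'⟩).1 h₄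
      exact (alive_iff_of_step hM ⟨a, h₁, hm'⟩).2 h₅
  · have hm' : Mv (!M.back p) a l r l' r' := hm
    obtain ⟨h₁, rfl, -⟩ | ⟨p', h₁, rfl, h₂⟩ := hs
    · exact h' a l r (by simpa using hm'.symm)
    · refine (alive_iff_of_step hM (c := ⟨l', p', r'⟩) ⟨a, h₂, ?_⟩).1 h'
      rw [hM.back_of_step h₂] at hm'
      simpa using hm'.symm
  · obtain ⟨rfl, q, h₁, h₂⟩ := hs
    intro a' l'' r'' hm'
    obtain ⟨rfl, rfl, rfl⟩ := Mv.det hm hm'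
    exact h'
  · obtain ⟨-, rfl, -⟩ := hs
    intro a' l'' r'' hm'
    obtain ⟨rfl, rfl, rfl⟩ := Mv.det hm hm'
    exact h'

theorem tourAlive_of_star (hM : M.Lawful) {c c' : Config α (Phase × σ)} {v : W}
    (h : Star M.tour.WStep c v c') (h' : M.TourAlive c') : M.TourAlive c := by
  induction h with
  | refl => exact h'
  | head h _ ih => exact tourAlive_of_wStep hM h (ih h')

omit [DecidableEq σ] in
theorem star_to_fin_unique (hM : M.Lawful) {c c₁ c₂ : Config α σ} {v v' : W}
    (h : Star M.Step c v c₁) (h' : Star M.Step c v' c₂) (h₁ : c₁.state = M.fin)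
    (h₂ : c₂.state = M.fin) : v = v' := by
  refine (Star.det_value (r := M.Step) (fun c w c' w' c'' h h' => M.step_det h h') h h' ?_ ?_).1
  all_goals
    rintro w c' ⟨a, h₃, -⟩
    simp_all [hM.fin_step]

/-- The tour follows every accepting run, exploring the side branches on the way. Conversely, it
is deterministic, and it can only reach the final state from a live configuration. -/
theorem tour_accepts_iff (hM : M.Lawful) {u : List α} {v : W} :
    M.tour.Accepts u v ↔ M.Accepts u v := by
  have key : ∀ {v}, M.Accepts u v → ∃ c, Star M.tour.WStep (at' .up ⟨[], M.start, tape u⟩) v c ∧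
      c.state = (.up, M.fin) := by
    rintro v ⟨c, h, hc⟩
    exact ⟨_, tour_star hM h ⟨rfl, hM.start_mem, _, _, h, hc⟩, by rw [at', hc]⟩
  constructor
  · rintro ⟨s, -, hs, -, c, h, hc⟩
    obtain rfl : s = (.up, M.start) := by simpa [tour] using hs
    have hc' : c.state = (.up, M.fin) := by simpa [tour] using hc
    have : M.TourAlive ⟨[], (.up, M.start), tape u⟩ :=
      tourAlive_of_star hM h (by
        rw [TourAlive, hc']
        exact ⟨0, _, .refl _, rfl⟩)
    obtain ⟨v', c', h₁, h₂⟩ := this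
    obtain ⟨c₂, h₃, h₄⟩ := key ⟨c', h₁, h₂⟩
    have dead : ∀ {c : Config α (Phase × σ)}, c.state = (.up, M.fin) →
        ∀ w c', ¬ M.tour.WStep c w c' := by
      rintro c hc w c' ⟨-, -, a, he, -⟩
      have hs := M.tour_tr.1 ((Spec.entry_eq_some _).1 he).2
      rw [hc, tourStep_up] at hs
      obtain ⟨q, hq, -⟩ := hs
      simp [hM.fin_step] at hq
    obtain ⟨rfl, -⟩ := Star.det_value (r := M.tour.WStep) (by
      rintro c w c' w' c'' ⟨-, -, a, he, hm⟩ ⟨-, -, a', he', hm'⟩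
      obtain ⟨rfl, h₅, h₆⟩ := hm.det hm'
      have hs := M.tour_tr.1 ((Spec.entry_eq_some _).1 he).2
      have hs' := M.tour_tr.1 ((Spec.entry_eq_some _).1 he').2
      cases c'; cases c''
      simp_all) h h₃ (dead hc') (dead h₄)
    exact ⟨c', h₁, h₂⟩
  · intro h
    obtain ⟨c, h₁, h₂⟩ := key h
    exact ⟨(.up, M.start), M.mem_tour_states.2 hM.start_mem, by simp [tour], hM.start_left, c, h₁,
      by simp [tour, h₂]⟩

end Machine

/-! ### Looking back along a one-way automaton -/

/-- A path of a one-way automaton with transition relation `T`, its label and its weight. -/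
inductive Path {Λ Q W : Type*} [AddMonoid W] (T : Q → Λ → Q → W → Prop) :
    Q → List Λ → Q → W → Prop where
  | nil (q : Q) : Path T q [] q 0
  | snoc {p q q' : Q} {u : List Λ} {a : Λ} {v w : W} :
      Path T p u q v → T q a q' w → Path T p (u ++ [a]) q' (v + w)

/-- The modes of the machine that runs a one-way automaton backwards: start at the left end;
run the subset automaton to the right end; step back to the left; decide on the previous set
and state; hunt to the left for the previous set; step to the right; let two sets race to the
right until they merge; leave the left end; go home to the right end; the final mode. -/
inductive Mode where
  | start | scan | back | look | hunt | hop | race | edge | home | fin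
  deriving DecidableEq

/-- The states of the machine that runs a one-way automaton backwards. -/
structure LookState (α Q X M : Type*) where
  mode : Mode
  x : X
  z : X
  m : M
  q : Option Q
  a : Letter α

noncomputable instance {α Q X M : Type*} : DecidableEq (LookState α Q X M) := Classical.decEq _

/-- The only member of a list with one member. -/
def sole {β : Type*} (l : List β) : Option β := if l.tail.isEmpty then l.head? else none

theorem sole_eq_some {β : Type*} {l : List β} {y : β} : sole l = some y ↔ l = [y] := by
  rcases l with _ | ⟨a, _ | ⟨b, l⟩⟩ <;> simp [sole]

/-- A deterministic automaton with states `xs`, next-state function `δ` and initial state `x₀`,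
standing for the subset automaton of a one-way automaton with states `qs`; the transformations
`ms` of `xs`, with action `act`, induced by words; and choice functions for the last transition
of a path from a member of a set to a state, and from a member of a set to acceptance. -/
structure LookData (α Q W X M : Type*) where
  xs : List X
  ms : List M
  qs : List Q
  as : List (Letter α)
  δ : X → Letter α → X
  x₀ : X
  act : X → M → X
  one : M
  cns : Letter α → M → M
  pick : X → Letter α → Q → Option (Q × W)
  pickEnd : X → Option (Q × W)

namespace LookData

variable {α Q W X M : Type*}

/-- What the choice of a machine by `LookData` has to do with the one-way automaton with
transitions `T`, initial states `I` and accepting states `F`. -/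
structure Lawful [AddCommGroup W] (D : LookData α Q W X M) (T : Q → Letter α → Q → W → Prop)
    (I F : Q → Prop) (mem : Q → X → Prop) : Prop where
  xs_nodup : D.xs.Nodup
  ms_nodup : D.ms.Nodup
  qs_nodup : D.qs.Nodup
  as_nodup : D.as.Nodup
  mem_as : ∀ a, a ∈ D.as
  mem_qs : ∀ q, q ∈ D.qs
  δ_mem : ∀ x a, D.δ x a ∈ D.xs
  x₀_mem : D.x₀ ∈ D.xs
  one_mem : D.one ∈ D.ms
  cns_mem : ∀ a m, D.cns a m ∈ D.ms
  mem_δ : ∀ q x a, mem q (D.δ x a) ↔ ∃ p w, mem p x ∧ T p a q w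
  mem_x₀ : ∀ q, mem q D.x₀ ↔ I q
  act_one : ∀ x ∈ D.xs, D.act x D.one = x
  act_cns : ∀ x a m, D.act x (D.cns a m) = D.act (D.δ x a) m
  pick_some : ∀ {x a q p w}, D.pick x a q = some (p, w) → mem p x ∧ T p a q w
  pick_isSome : ∀ {x a q p w}, mem p x → T p a q w → (D.pick x a q).isSome = true
  pickEnd_some : ∀ {x p w}, D.pickEnd x = some (p, w) → mem p x ∧ ∃ f, F f ∧ T p .rend f w
  pickEnd_isSome : ∀ {x p f w}, mem p x → F f → T p .rend f w → (D.pickEnd x).isSome = true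

variable (D : LookData α Q W X M)

/-- A state without memory. -/
def idle (t : Mode) : LookState α Q X M := ⟨t, D.x₀, D.x₀, D.one, none, .lend⟩

/-- A state that remembers a set and a state of the one-way automaton. -/
def walk (t : Mode) (x : X) (q : Option Q) : LookState α Q X M := ⟨t, x, D.x₀, D.one, q, .lend⟩

/-- A state that remembers two sets and a state of the one-way automaton. -/
def duo (t : Mode) (x z : X) (q : Option Q) : LookState α Q X M := ⟨t, x, z, D.one, q, .lend⟩

/-- The state with which a predecessor under `a` of the set `x` is hunted for, when the word
with transformation `m` has been read since. -/
def hunting (x : X) (q : Option Q) (m : M) (a : Letter α) : LookState α Q X M :=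
  ⟨.hunt, x, D.x₀, m, q, a⟩

open Classical in
/-- The predecessors of `x` under `a` that are reached by the transformation `m`. -/
noncomputable def cand (x : X) (a : Letter α) (m : M) : List X :=
  D.xs.filter fun y => decide (D.δ y a = x) && D.xs.any fun x' => decide (D.act x' m = y)

theorem mem_cand {x y : X} {a : Letter α} {m : M} : y ∈ D.cand x a m ↔
    y ∈ D.xs ∧ D.δ y a = x ∧ ∃ x' ∈ D.xs, D.act x' m = y := by
  simp [cand]

variable [Zero W]

/-- Choose a transition that leads to `q` and go on with its source. -/
def lookStep (x : X) (a : Letter α) (q : Option Q) (t : Mode) : Option (LookState α Q X M × W) :=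
  (q.bind (D.pick x a)).map fun pw => (D.walk t x (some pw.1), pw.2)

open Classical in
/-- Start the race of two sets, one of which yields `y` under `m` while the other one yields
another predecessor of `x` under `a`. -/
noncomputable def raceStep (x : X) (q : Option Q) (m : M) (a : Letter α) (y : X) :
    Option (LookState α Q X M × W) :=
  (D.xs.find? fun x' => decide (D.act x' m = y)).bind fun x' =>
    (D.xs.find? fun z => !decide (D.act z m = y) && decide (D.δ (D.act z m) a = x)).map fun z =>
      (D.duo .hop x' z q, 0)

open Classical in
/-- The step function of the machine. -/
noncomputable def step (s : LookState α Q X M) (b : Letter α) :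
    Option (LookState α Q X M × W) :=
  match s.mode with
  | .start => if b = .lend then some (D.walk .scan (D.δ D.x₀ b) none, 0) else none
  | .scan => if b = .lend then none else if b = .rend then
      (D.pickEnd s.x).map fun pw => (D.walk .back s.x (some pw.1), pw.2)
    else some (D.walk .scan (D.δ s.x b) none, 0)
  | .back => if b = .lend then none else some (D.walk .look s.x s.q, 0)
  | .look => if b = .rend then none else if b = .lend then
      (s.q.bind (D.pick D.x₀ b)).map fun pw => (D.idle .edge, pw.2)
    else (sole (D.cand s.x b D.one)).elim (some (D.hunting s.x s.q D.one b, 0)) fun y =>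
      D.lookStep y b s.q .look
  | .hunt => if b = .rend then none else
      (if b = .lend then some (D.act D.x₀ (D.cns b s.m))
        else sole (D.cand s.x s.a (D.cns b s.m))).elim
      (some (D.hunting s.x s.q (D.cns b s.m) s.a, 0)) (D.raceStep s.x s.q s.m s.a)
  | .hop => if b = .rend then none else some (D.duo .race s.x s.z s.q, 0)
  | .race => if b = .lend then none else if b = .rend then none else
      if D.δ s.x b = D.δ s.z b then D.lookStep s.x b s.q .back
      else some (D.duo .race (D.δ s.x b) (D.δ s.z b) s.q, 0)
  | .edge => if b = .lend then some (D.idle .home, 0) else none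
  | .home => if b = .lend then none else
      if b = .rend then some (D.idle .fin, 0) else some (D.idle .home, 0)
  | .fin => none

/-- The list of all modes. -/
def modes : List Mode := [.start, .scan, .back, .look, .hunt, .hop, .race, .edge, .home, .fin]

/-- The machine that runs the one-way automaton backwards, after a run of the subset automaton
to the right. When the head is right of the prefix `v`, the machine knows the set reached by
`v` and a state in it; it finds the set reached one letter before, and in this set the previous
state of an accepting run. The Boolean `triv` tells whether some initial state is accepting. -/
noncomputable def machine (triv : Bool) : Machine α (LookState α Q X M) W where
  states := (modes ×ˢ D.xs ×ˢ D.xs ×ˢ D.ms ×ˢ (none :: D.qs.map some) ×ˢ D.as).map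
    fun t => ⟨t.1, t.2.1, t.2.2.1, t.2.2.2.1, t.2.2.2.2.1, t.2.2.2.2.2⟩
  left := fun s => decide (s.mode = .back) || decide (s.mode = .look) || decide (s.mode = .hunt)
  back := fun s => decide (s.mode = .start) || decide (s.mode = .look) ||
    decide (s.mode = .hunt) || decide (s.mode = .hop) || decide (s.mode = .edge)
  start := if triv then D.idle .fin else D.idle .start
  fin := D.idle .fin
  step := D.step

theorem mem_machine_states {triv : Bool} {s : LookState α Q X M} :
    s ∈ (D.machine triv).states ↔ s.x ∈ D.xs ∧ s.z ∈ D.xs ∧ s.m ∈ D.ms ∧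
      (s.q = none ∨ ∃ q ∈ D.qs, s.q = some q) ∧ s.a ∈ D.as := by
  obtain ⟨t, x, z, m, q, a⟩ := s
  have ht : t ∈ modes := by cases t <;> simp [modes]
  simp only [machine, List.mem_map, Prod.exists, List.mem_product, List.mem_cons,
    LookState.mk.injEq]
  constructor
  · rintro ⟨t, x, z, m, q, a, ⟨-, h₁, h₂, h₃, h₄, h₅⟩, rfl, rfl, rfl, rfl, rfl, rfl⟩
    refine ⟨h₁, h₂, h₃, ?_, h₅⟩
    simpa [eq_comm] using h₄
  · rintro ⟨h₁, h₂, h₃, h₄, h₅⟩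
    refine ⟨t, x, z, m, q, a, ⟨ht, h₁, h₂, h₃, ?_, h₅⟩, rfl, rfl, rfl, rfl, rfl, rfl⟩
    simpa [eq_comm] using h₄

end LookData

namespace LookData

variable {α Q W X M : Type*} [AddCommGroup W] (D : LookData α Q W X M)

section

variable {D} {s t : LookState α Q X M} {b a : Letter α} {w : W} {x y : X} {q : Option Q} {m : M}

omit [AddCommGroup W] in
theorem lookStep_eq_some {k : Mode} : D.lookStep x a q k = some (t, w) ↔
    ∃ q₀ p, q = some q₀ ∧ D.pick x a q₀ = some (p, w) ∧ t = D.walk k x (some p) := by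
  cases q with
  | none => simp [lookStep]
  | some q₀ => simp [lookStep, eq_comm (b := t)]

theorem of_raceStep (h : D.raceStep x q m a y = some (t, w)) :
    ∃ x' ∈ D.xs, ∃ z ∈ D.xs, D.act x' m = y ∧ D.act z m ≠ y ∧ D.δ (D.act z m) a = x ∧
      t = D.duo .hop x' z q ∧ w = 0 := by
  simp only [raceStep, Option.bind_eq_some_iff, Option.map_eq_some_iff, Prod.mk.injEq] at h
  obtain ⟨x', h₁, z, h₂, rfl, rfl⟩ := h
  have h₃ := List.find?_some h₁
  have h₄ := List.find?_some h₂
  simp only [decide_eq_true_eq, Bool.and_eq_true, Bool.not_eq_true', decide_eq_false_iff_not]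
    at h₃ h₄
  exact ⟨x', List.mem_of_find?_eq_some h₁, z, List.mem_of_find?_eq_some h₂, h₃, h₄.1, h₄.2, rfl,
    rfl⟩

theorem raceStep_isSome {x' z : X} (hx : x' ∈ D.xs) (hz : z ∈ D.xs) (h₁ : D.act x' m = y)
    (h₂ : D.act z m ≠ y) (h₃ : D.δ (D.act z m) a = x) : ∃ t, D.raceStep x q m a y = some t := by
  classical
  obtain ⟨x'', hx'⟩ := Option.isSome_iff_exists.1
    (List.find?_isSome (p := fun x' => decide (D.act x' m = y)).2 ⟨x', hx, by simpa⟩)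
  obtain ⟨z', hz'⟩ := Option.isSome_iff_exists.1
    (List.find?_isSome (p := fun z => !decide (D.act z m = y) &&
      decide (D.δ (D.act z m) a = x)).2 ⟨z, hz, by simp [h₂, h₃]⟩)
  exact ⟨(D.duo .hop x'' z' q, 0), by simp only [raceStep, hx', hz']; rfl⟩

/-- The moves between modes, with the letters read. -/
theorem mode_of_step (h : D.step s b = some (t, w)) :
    (s.mode = .start ∧ b = .lend ∧ t.mode = .scan) ∨
    (s.mode = .scan ∧ b ≠ .lend ∧ (b = .rend ∧ t.mode = .back ∨ b ≠ .rend ∧ t.mode = .scan)) ∨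
    (s.mode = .back ∧ b ≠ .lend ∧ t.mode = .look) ∨
    (s.mode = .look ∧ b ≠ .rend ∧
      (b = .lend ∧ t.mode = .edge ∨ b ≠ .lend ∧ (t.mode = .look ∨ t.mode = .hunt))) ∨
    (s.mode = .hunt ∧ b ≠ .rend ∧ (b ≠ .lend ∧ t.mode = .hunt ∨ t.mode = .hop)) ∨
    (s.mode = .hop ∧ b ≠ .rend ∧ t.mode = .race) ∨
    (s.mode = .race ∧ b ≠ .lend ∧ b ≠ .rend ∧ (t.mode = .back ∨ t.mode = .race)) ∨
    (s.mode = .edge ∧ b = .lend ∧ t.mode = .home) ∨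
    (s.mode = .home ∧ b ≠ .lend ∧ (b = .rend ∧ t = D.idle .fin ∨ b ≠ .rend ∧ t.mode = .home)) := by
  obtain ⟨k, x, z, m, q, a⟩ := s
  cases k <;> simp only [step] at h
  · split_ifs at h with h₁
    simp only [Option.some.injEq, Prod.mk.injEq] at h
    obtain ⟨rfl, -⟩ := h
    simp [h₁, walk]
  · split_ifs at h with h₁ h₂
    · simp only [Option.map_eq_some_iff, Prod.mk.injEq] at h
      obtain ⟨_, -, rfl, -⟩ := h
      simp [h₂, walk]
    · simp only [Option.some.injEq, Prod.mk.injEq] at h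
      obtain ⟨rfl, -⟩ := h
      simp [h₁, h₂, walk]
  · split_ifs at h with h₁
    simp only [Option.some.injEq, Prod.mk.injEq] at h
    obtain ⟨rfl, -⟩ := h
    simp [h₁, walk]
  · split_ifs at h with h₁ h₂
    · simp only [Option.map_eq_some_iff, Prod.mk.injEq] at h
      obtain ⟨_, -, rfl, -⟩ := h
      simp [h₂, idle]
    · cases hs : sole (D.cand x b D.one) with
      | none =>
        simp only [hs, Option.elim_none, Option.some.injEq, Prod.mk.injEq] at h
        obtain ⟨rfl, -⟩ := h
        simp [h₁, h₂, hunting]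
      | some y =>
        simp only [hs, Option.elim_some, lookStep_eq_some] at h
        obtain ⟨_, _, -, -, rfl⟩ := h
        simp [h₁, h₂, walk]
  · split_ifs at h with h₁ h₂
    · simp only [Option.elim_some] at h
      obtain ⟨x', -, z', -, -, -, -, rfl, -⟩ := of_raceStep h
      simp [h₁, duo]
    · cases hs : sole (D.cand x a (D.cns b m)) with
      | none =>
        simp only [hs, Option.elim_none, Option.some.injEq, Prod.mk.injEq] at h
        obtain ⟨rfl, -⟩ := h
        simp [h₁, h₂, hunting]
      | some y =>
        simp only [hs, Option.elim_some] at h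
        obtain ⟨x', -, z', -, -, -, -, rfl, -⟩ := of_raceStep h
        simp [h₁, duo]
  · split_ifs at h with h₁
    simp only [Option.some.injEq, Prod.mk.injEq] at h
    obtain ⟨rfl, -⟩ := h
    simp [h₁, duo]
  · split_ifs at h with h₁ h₂ h₃
    · obtain ⟨_, _, -, -, rfl⟩ := lookStep_eq_some.1 h
      simp [h₁, h₂, walk]
    · simp only [Option.some.injEq, Prod.mk.injEq] at h
      obtain ⟨rfl, -⟩ := h
      simp [h₁, h₂, duo]
  · split_ifs at h with h₁
    simp only [Option.some.injEq, Prod.mk.injEq] at h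
    obtain ⟨rfl, -⟩ := h
    simp [h₁, idle]
  · split_ifs at h with h₁ h₂ <;> simp only [Option.some.injEq, Prod.mk.injEq] at h <;>
    obtain ⟨rfl, -⟩ := h
    · simp [h₂]
    · simp [h₁, h₂, idle]
  · simp at h

end

variable {D} {T : Q → Letter α → Q → W → Prop} {I F : Q → Prop} {mem : Q → X → Prop}

theorem closed_step (hD : D.Lawful T I F mem) {triv : Bool} {s t : LookState α Q X M}
    {b : Letter α} {w : W} (hs : s ∈ (D.machine triv).states) (h : D.step s b = some (t, w)) :
    t ∈ (D.machine triv).states := by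
  rw [mem_machine_states] at hs ⊢
  have hq : ∀ q : Option Q, (q = none ∨ ∃ q' ∈ D.qs, q = some q') := by
    rintro (_ | q)
    · exact .inl rfl
    · exact .inr ⟨q, hD.mem_qs q, rfl⟩
  suffices t.x ∈ D.xs ∧ t.z ∈ D.xs ∧ t.m ∈ D.ms from
    ⟨this.1, this.2.1, this.2.2, hq _, hD.mem_as _⟩
  obtain ⟨k, x, z, m, q, a⟩ := s
  have hx : x ∈ D.xs := hs.1
  have h₀ := hD.x₀_mem
  have h₁ := hD.one_mem
  have hδ := hD.δ_mem
  have hc := hD.cns_mem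
  cases k <;> simp only [step] at h
  · split_ifs at h
    simp only [Option.some.injEq, Prod.mk.injEq] at h
    obtain ⟨rfl, -⟩ := h
    simp [walk, *]
  · split_ifs at h
    · simp only [Option.map_eq_some_iff, Prod.mk.injEq] at h
      obtain ⟨_, -, rfl, -⟩ := h
      simp [walk, *]
    · simp only [Option.some.injEq, Prod.mk.injEq] at h
      obtain ⟨rfl, -⟩ := h
      simp [walk, *]
  · split_ifs at h
    simp only [Option.some.injEq, Prod.mk.injEq] at h
    obtain ⟨rfl, -⟩ := h
    simp [walk, *]
  · split_ifs at h
    · simp only [Option.map_eq_some_iff, Prod.mk.injEq] at h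
      obtain ⟨_, -, rfl, -⟩ := h
      simp [idle, *]
    · cases hs : sole (D.cand x b D.one) with
      | none =>
        simp only [hs, Option.elim_none, Option.some.injEq, Prod.mk.injEq] at h
        obtain ⟨rfl, -⟩ := h
        simp [hunting, *]
      | some y =>
        simp only [hs, Option.elim_some, lookStep_eq_some] at h
        obtain ⟨_, _, -, -, rfl⟩ := h
        have : y ∈ D.cand x b D.one := by simp [sole_eq_some.1 hs]
        simp [walk, *, (D.mem_cand.1 this).1]
  · split_ifs at h
    · simp only [Option.elim_some] at h
      obtain ⟨x', hx', z', hz', -, -, -, rfl, -⟩ := of_raceStep h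
      simp [duo, *]
    · cases hs : sole (D.cand x a (D.cns b m)) with
      | none =>
        simp only [hs, Option.elim_none, Option.some.injEq, Prod.mk.injEq] at h
        obtain ⟨rfl, -⟩ := h
        simp [hunting, *]
      | some y =>
        simp only [hs, Option.elim_some] at h
        obtain ⟨x', hx', z', hz', -, -, -, rfl, -⟩ := of_raceStep h
        simp [duo, *]
  · split_ifs at h
    simp only [Option.some.injEq, Prod.mk.injEq] at h
    obtain ⟨rfl, -⟩ := h
    exact ⟨hs.1, hs.2.1, h₁⟩
  · split_ifs at h
    · obtain ⟨_, _, -, -, rfl⟩ := lookStep_eq_some.1 h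
      simp [walk, *]
    · simp only [Option.some.injEq, Prod.mk.injEq] at h
      obtain ⟨rfl, -⟩ := h
      simp [duo, *]
  · split_ifs at h
    simp only [Option.some.injEq, Prod.mk.injEq] at h
    obtain ⟨rfl, -⟩ := h
    simp [idle, *]
  · split_ifs at h <;> simp only [Option.some.injEq, Prod.mk.injEq] at h <;>
    obtain ⟨rfl, -⟩ := h <;> simp [idle, *]
  · simp at h

theorem machine_lawful (hD : D.Lawful T I F mem) (triv : Bool) : (D.machine triv).Lawful where
  nodup := by
    refine List.Nodup.map ?_ ?_
    · rintro ⟨t, x, z, m, q, a⟩ ⟨t', x', z', m', q', a'⟩ h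
      simpa using h
    · refine List.Nodup.product (by decide) (hD.xs_nodup.product (hD.xs_nodup.product
        (hD.ms_nodup.product (List.Nodup.product ?_ hD.as_nodup))))
      simpa using hD.qs_nodup.map (Option.some_injective _)
  start_mem := by
    rw [mem_machine_states]
    cases triv <;> simp [machine, idle, hD.x₀_mem, hD.one_mem, hD.mem_as]
  closed := closed_step hD
  start_left := by cases triv <;> simp [machine, idle]
  fin_step a := by simp [machine, step, idle]
  back_of_step := by
    intro p a q w h
    rcases mode_of_step h with h | h | h | h | h | h | h | h | ⟨hm, -, ⟨-, rfl⟩ | ⟨-, h'⟩⟩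
    · simp [machine, h]
    · rcases h.2.2 with h' | h' <;> simp [machine, h, h']
    · simp [machine, h]
    · rcases h.2.2 with h' | ⟨-, h' | h'⟩ <;> simp [machine, h, h']
    · rcases h.2.2 with h' | h' <;> simp [machine, h, h']
    · simp [machine, h]
    · rcases h.2.2.2 with h' | h' <;> simp [machine, h, h']
    · simp [machine, h]
    · simp [machine, hm, idle]
    · simp [machine, hm, h']
  left_of_lend := by
    intro p q w h hl
    rcases mode_of_step h with h | h | h | h | h | h | h | h | h
    all_goals simp_all [machine]
  left_of_rend := by
    intro p q w h hl
    rcases mode_of_step h with h | h | h | h | h | h | h | h | h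
    all_goals simp_all [machine]
  step_fin := by
    intro p a w h
    rcases mode_of_step h with h | h | h | h | h | h | h | h | h
    all_goals simp_all [machine, idle]
  back_of_lend := by
    intro p q w h hl
    rcases mode_of_step h with h | h | h | h | h | h | h | h | h
    all_goals simp_all [machine]
  back_of_rend := by
    intro p q w h hl
    rcases mode_of_step h with h | h | h | h | h | h | h | h | h
    all_goals simp_all [machine]

end LookData

theorem Machine.step_right {α σ W : Type*} {M : Machine α σ W} {s t : σ} {a : Letter α} {w : W}
    {l r : List (Letter α)} (h : M.step s a = some (t, w)) (hl : M.left s = false) :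
    M.Step ⟨l, s, a :: r⟩ w ⟨l ++ [a], t, r⟩ :=
  ⟨a, h, by simp only [hl]; exact Mv.right _ _ _⟩

theorem Machine.step_left {α σ W : Type*} {M : Machine α σ W} {s t : σ} {a : Letter α} {w : W}
    {l r : List (Letter α)} (h : M.step s a = some (t, w)) (hl : M.left s = true) :
    M.Step ⟨l ++ [a], s, r⟩ w ⟨l, t, a :: r⟩ :=
  ⟨a, h, by simp only [hl]; exact Mv.left _ _ _⟩

namespace LookData

variable {α Q W X M : Type*} [AddCommGroup W] {D : LookData α Q W X M}
  {T : Q → Letter α → Q → W → Prop} {I F : Q → Prop} {mem : Q → X → Prop} {triv : Bool}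

/-- A letter of the input word, as opposed to a delimiter. -/
def Inner (a : Letter α) : Prop := a ≠ .lend ∧ a ≠ .rend

/-- The set reached by a word. -/
def reach (D : LookData α Q W X M) (x : X) (u : List (Letter α)) : X := u.foldl D.δ x

omit [AddCommGroup W] in
@[simp] theorem reach_snoc (x : X) (u : List (Letter α)) (a : Letter α) :
    D.reach x (u ++ [a]) = D.δ (D.reach x u) a := by simp [reach]

omit [AddCommGroup W] in
theorem reach_append (x : X) (u v : List (Letter α)) :
    D.reach x (u ++ v) = D.reach (D.reach x u) v := by simp [reach]

theorem mem_reach (hD : D.Lawful T I F mem) {q : Q} {u : List (Letter α)} :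
    mem q (D.reach D.x₀ u) ↔ ∃ p v, I p ∧ Path T p u q v := by
  induction u using List.reverseRecOn generalizing q with
  | nil =>
    rw [reach, List.foldl_nil, hD.mem_x₀]
    constructor
    · exact fun h => ⟨q, 0, h, .nil q⟩
    · rintro ⟨p, v, hp, h⟩
      generalize hu : ([] : List (Letter α)) = u at h
      cases h with
      | nil => exact hp
      | snoc => simp at hu
  | append_singleton u a ih =>
    rw [reach_snoc, hD.mem_δ]
    constructor
    · rintro ⟨p, w, hp, h⟩
      obtain ⟨p₀, v, h₁, h₂⟩ := ih.1 hp
      exact ⟨p₀, _, h₁, .snoc h₂ h⟩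
    · rintro ⟨p, v, hp, h⟩
      generalize hu : u ++ [a] = u' at h
      cases h with
      | nil => simp at hu
      | snoc h h' =>
        obtain ⟨rfl, rfl⟩ := List.append_singleton_inj.1 hu
        exact ⟨_, _, ih.2 ⟨_, _, hp, h⟩, h'⟩

theorem reach_mem_xs (hD : D.Lawful T I F mem) (u : List (Letter α)) : D.reach D.x₀ u ∈ D.xs := by
  induction u using List.reverseRecOn with
  | nil => exact hD.x₀_mem
  | append_singleton u a _ =>
    rw [reach_snoc]
    exact hD.δ_mem _ _

/-- The transformation induced by a word. -/
def trafo (D : LookData α Q W X M) (u : List (Letter α)) : M := u.foldr D.cns D.one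

theorem act_trafo (hD : D.Lawful T I F mem) {x : X} (hx : x ∈ D.xs) (u : List (Letter α)) :
    D.act x (D.trafo u) = D.reach x u := by
  induction u generalizing x with
  | nil => exact hD.act_one x hx
  | cons a u ih =>
    rw [trafo, List.foldr_cons, hD.act_cns]
    exact ih (hD.δ_mem _ _)

/-- The race: the two sets merge where the hunt began, and at this point the first one is the
set that was hunted for. -/
theorem star_race {l u r : List (Letter α)} {a : Letter α} {x z : X}
    {q p : Q} {w : W} (hu : ∀ b ∈ u, Inner b) (ha : Inner a)
    (hne : D.reach x u ≠ D.reach z u)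
    (hm : D.δ (D.reach x u) a = D.δ (D.reach z u) a)
    (hp : D.pick (D.reach x u) a q = some (p, w)) :
    Star (D.machine triv).Step ⟨l, D.duo .race x z (some q), u ++ a :: r⟩ w
      ⟨l ++ u, D.walk .look (D.reach x u) (some p), a :: r⟩ := by
  induction u generalizing l x z with
  | nil =>
    have s₁ : (D.machine triv).Step ⟨l, D.duo .race x z (some q), a :: r⟩ w
        ⟨l ++ [a], D.walk .back x (some p), r⟩ := by
      refine Machine.step_right ?_ (by simp [machine, duo])
      have hm' : D.δ x a = D.δ z a := hm
      have hp' : D.pick x a q = some (p, w) := hp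
      simp [machine, step, duo, ha.1, ha.2, hm', lookStep, hp']
    have s₂ : (D.machine triv).Step ⟨l ++ [a], D.walk .back x (some p), r⟩ 0
        ⟨l, D.walk .look x (some p), a :: r⟩ := by
      refine Machine.step_left ?_ (by simp [machine, walk])
      simp [machine, step, walk, ha.1]
    simpa [reach] using Star.head s₁ (.single s₂)
  | cons b u ih =>
    have hb := hu b (by simp)
    have hb' : D.δ x b ≠ D.δ z b := by
      intro h
      apply hne
      simp [reach, h]
    have s₁ : (D.machine triv).Step ⟨l, D.duo .race x z (some q), b :: (u ++ a :: r)⟩ 0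
        ⟨l ++ [b], D.duo .race (D.δ x b) (D.δ z b) (some q), u ++ a :: r⟩ := by
      refine Machine.step_right ?_ (by simp [machine, duo])
      simp [machine, step, duo, hb.1, hb.2, hb']
    have := Star.head s₁ (ih (l := l ++ [b]) (fun c hc => hu c (by simp [hc])) hne hm hp)
    simpa [reach] using this

theorem exists_ne_of_sole_eq_none {β : Type*} {l : List β} (hl : l.Nodup) {y : β} (hy : y ∈ l)
    (h : sole l = none) : ∃ z ∈ l, z ≠ y := by
  rcases l with _ | ⟨a, _ | ⟨b, l⟩⟩
  · simp at hy
  · simp [sole] at h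
  · by_cases hay : a = y
    · refine ⟨b, by simp, ?_⟩
      rintro rfl
      simp [hay] at hl
    · exact ⟨a, by simp, hay⟩

theorem reach_mem_cand (hD : D.Lawful T I F mem) (l u : List (Letter α)) (a : Letter α) :
    D.reach D.x₀ (l ++ u) ∈ D.cand (D.reach D.x₀ (l ++ u ++ [a])) a (D.trafo u) := by
  refine D.mem_cand.2 ⟨reach_mem_xs hD _, by rw [reach_snoc], D.reach D.x₀ l,
    reach_mem_xs hD _, ?_⟩
  rw [act_trafo hD (reach_mem_xs hD _), reach_append]

/-- The end of a hunt, which turns into a race. -/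
theorem star_hunt_end (hD : D.Lawful T I F mem) {l u r : List (Letter α)} {a b : Letter α}
    {q p : Q} {w : W} (hb : b ≠ .rend) (hu : ∀ b ∈ u, Inner b) (ha : Inner a)
    (hp : D.pick (D.reach D.x₀ (l ++ [b] ++ u)) a q = some (p, w))
    (hs : sole (D.cand (D.reach D.x₀ (l ++ [b] ++ u ++ [a])) a (D.trafo u)) = none)
    (hstep : D.step (D.hunting (D.reach D.x₀ (l ++ [b] ++ u ++ [a])) (some q) (D.trafo u) a) b =
      D.raceStep (D.reach D.x₀ (l ++ [b] ++ u ++ [a])) (some q) (D.trafo u) a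
        (D.reach D.x₀ (l ++ [b] ++ u))) :
    Star (D.machine triv).Step
      ⟨l ++ [b], D.hunting (D.reach D.x₀ (l ++ [b] ++ u ++ [a])) (some q) (D.trafo u) a,
        u ++ a :: r⟩ w
      ⟨l ++ [b] ++ u, D.walk .look (D.reach D.x₀ (l ++ [b] ++ u)) (some p), a :: r⟩ := by
  have hmem := reach_mem_cand hD (l ++ [b]) u a
  obtain ⟨y, hy, hne⟩ := exists_ne_of_sole_eq_none (hD.xs_nodup.filter _) hmem hs
  obtain ⟨-, hy₁, z, hz, hy₂⟩ := D.mem_cand.1 hy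
  obtain ⟨-, -, x', hx', hx⟩ := D.mem_cand.1 hmem
  obtain ⟨⟨t, w'⟩, ht⟩ := raceStep_isSome (q := some q) (a := a)
    (x := D.reach D.x₀ (l ++ [b] ++ u ++ [a])) hx' hz hx
    (by rw [hy₂]; exact hne) (by rw [hy₂]; exact hy₁)
  obtain ⟨x', hx', z, hz, h₁, h₂, h₃, rfl, rfl⟩ := of_raceStep ht
  rw [act_trafo hD hx'] at h₁
  rw [act_trafo hD hz] at h₂ h₃
  have s₁ : (D.machine triv).Step
      ⟨l ++ [b], D.hunting (D.reach D.x₀ (l ++ [b] ++ u ++ [a])) (some q) (D.trafo u) a,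
        u ++ a :: r⟩ 0 ⟨l, D.duo .hop x' z (some q), b :: (u ++ a :: r)⟩ :=
    Machine.step_left (hstep.trans ht) (by simp [machine, hunting])
  have s₂ : (D.machine triv).Step ⟨l, D.duo .hop x' z (some q), b :: (u ++ a :: r)⟩ 0
      ⟨l ++ [b], D.duo .race x' z (some q), u ++ a :: r⟩ :=
    Machine.step_right (by simp [machine, step, duo, hb]) (by simp [machine, duo])
  have s₃ := star_race (D := D) (triv := triv) (l := l ++ [b]) (r := r) (x := x') (z := z) hu ha
    (by rw [h₁]; exact h₂.symm) (by rw [h₁, h₃, reach_snoc]) (by rw [h₁]; exact hp)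
  rw [h₁] at s₃
  simpa using Star.head s₁ (.head s₂ s₃)

/-- The hunt: the head moves to the left until only one predecessor is left, or the left end is
reached; then the race leads back. The letters read since the hunt began are those of `u`. -/
theorem star_hunt (hD : D.Lawful T I F mem) {v u r : List (Letter α)} {a : Letter α}
    {q p : Q} {w : W} (hv : ∀ b ∈ v, Inner b) (hu : ∀ b ∈ u, Inner b) (ha : Inner a)
    (hp : D.pick (D.reach D.x₀ (.lend :: v ++ u)) a q = some (p, w))
    (hs : sole (D.cand (D.reach D.x₀ (.lend :: v ++ u ++ [a])) a (D.trafo u)) = none) :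
    Star (D.machine triv).Step
      ⟨.lend :: v, D.hunting (D.reach D.x₀ (.lend :: v ++ u ++ [a])) (some q) (D.trafo u) a,
        u ++ a :: r⟩ w
      ⟨.lend :: v ++ u, D.walk .look (D.reach D.x₀ (.lend :: v ++ u)) (some p), a :: r⟩ := by
  induction v using List.reverseRecOn generalizing u with
  | nil =>
    refine star_hunt_end hD (l := []) (b := .lend) (by simp) hu ha hp hs ?_
    have : D.act D.x₀ (D.cns .lend (D.trafo u)) = D.reach D.x₀ (.lend :: u) :=
      act_trafo hD hD.x₀_mem (.lend :: u)
    simp [step, hunting, this]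
  | append_singleton v b ih =>
    have hb := hv b (by simp)
    have e : ∀ u : List (Letter α), Letter.lend :: (v ++ [b]) ++ u = (.lend :: v) ++ [b] ++ u :=
      fun u => by simp
    cases hs' : sole (D.cand (D.reach D.x₀ (.lend :: (v ++ [b]) ++ u ++ [a])) a
        (D.cns b (D.trafo u))) with
    | none =>
      have e' : ∀ u : List (Letter α), Letter.lend :: (v ++ [b]) ++ u = (.lend :: v) ++ b :: u :=
        fun u => by simp
      have s₁ : (D.machine triv).Step
          ⟨(.lend :: v) ++ [b], D.hunting (D.reach D.x₀ (.lend :: (v ++ [b]) ++ u ++ [a])) (some q)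
            (D.trafo u) a, u ++ a :: r⟩ 0
          ⟨.lend :: v, D.hunting (D.reach D.x₀ (.lend :: (v ++ [b]) ++ u ++ [a])) (some q)
            (D.trafo (b :: u)) a, b :: (u ++ a :: r)⟩ := by
        refine Machine.step_left ?_ (by simp [machine, hunting])
        simp only [machine, step, hunting, hb.1, hb.2, if_false, hs', Option.elim_none]
        rfl
      rw [e'] at s₁ hs' hp ⊢
      have := Star.head s₁ (ih (u := b :: u) (fun c hc => hv c (by simp [hc]))
        (fun c hc => (List.mem_cons.1 hc).elim (fun h => h ▸ hb) (hu c)) hp hs')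
      simpa using this
    | some y =>
      have hy : D.reach D.x₀ (.lend :: v ++ b :: u) = y := by
        have := reach_mem_cand hD (.lend :: v) (b :: u) a
        have hs'' := sole_eq_some.1 hs'
        rw [show Letter.lend :: (v ++ [b]) ++ u ++ [a] = .lend :: v ++ b :: u ++ [a] by simp]
          at hs''
        rw [show D.trafo (b :: u) = D.cns b (D.trafo u) from rfl, hs''] at this
        simpa using this
      rw [e] at hp hs hs' ⊢
      refine star_hunt_end hD (l := .lend :: v) (b := b) hb.2 hu ha hp hs ?_
      simp only [step, hunting, hb.1, hb.2, if_false, hs', Option.elim_some]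
      rw [← hy]
      simp

/-- One step of the machine backwards along a path of the one-way automaton. -/
theorem star_look (hD : D.Lawful T I F mem) {v r : List (Letter α)} {a : Letter α} {q : Q}
    (hv : ∀ b ∈ v, Inner b) (ha : Inner a) (hq : mem q (D.reach D.x₀ (.lend :: v ++ [a]))) :
    ∃ p w, mem p (D.reach D.x₀ (.lend :: v)) ∧ T p a q w ∧ Star (D.machine triv).Step
      ⟨.lend :: v ++ [a], D.walk .look (D.reach D.x₀ (.lend :: v ++ [a])) (some q), r⟩ w
      ⟨.lend :: v, D.walk .look (D.reach D.x₀ (.lend :: v)) (some p), a :: r⟩ := by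
  obtain ⟨p', w', hp', ht'⟩ := (hD.mem_δ _ _ _).1 (reach_snoc (D := D) _ _ _ ▸ hq)
  obtain ⟨⟨p, w⟩, hp⟩ := Option.isSome_iff_exists.1 (hD.pick_isSome hp' ht')
  refine ⟨p, w, (hD.pick_some hp).1, (hD.pick_some hp).2, ?_⟩
  cases hs : sole (D.cand (D.reach D.x₀ (.lend :: v ++ [a])) a D.one) with
  | none =>
    have s₁ : (D.machine triv).Step
        ⟨.lend :: v ++ [a], D.walk .look (D.reach D.x₀ (.lend :: v ++ [a])) (some q), r⟩ 0
        ⟨.lend :: v, D.hunting (D.reach D.x₀ (.lend :: v ++ [a])) (some q) D.one a, a :: r⟩ := by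
      refine Machine.step_left ?_ (by simp [machine, walk])
      simp only [machine, step, walk, ha.1, ha.2, if_false, hs, Option.elim_none]
    have s₂ := star_hunt hD (triv := triv) (v := v) (u := []) (r := r) (q := q) (p := p) (w := w)
      hv (by simp) ha (by simpa using hp) (by simpa [trafo] using hs)
    simpa [trafo] using Star.head s₁ (by simpa [trafo] using s₂)
  | some y =>
    have hy : D.reach D.x₀ (.lend :: v) = y := by
      have := reach_mem_cand hD (.lend :: v) [] a
      have hs' := sole_eq_some.1 hs
      simp only [List.append_nil, trafo, List.foldr_nil, hs'] at this
      simpa using this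
    refine .single (Machine.step_left ?_ (by simp [machine, walk]))
    simp only [machine, step, walk, ha.1, ha.2, if_false, hs, Option.elim_some]
    rw [← hy]
    exact lookStep_eq_some.2 ⟨q, p, rfl, hp, rfl⟩

/-- The machine runs backwards to the left end. -/
theorem star_edge (hD : D.Lawful T I F mem) {v r : List (Letter α)} {q : Q}
    (hv : ∀ b ∈ v, Inner b) (hq : mem q (D.reach D.x₀ (.lend :: v))) :
    ∃ p w, I p ∧ Path T p (.lend :: v) q w ∧ Star (D.machine triv).Step
      ⟨.lend :: v, D.walk .look (D.reach D.x₀ (.lend :: v)) (some q), r⟩ w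
      ⟨[], D.idle .edge, .lend :: v ++ r⟩ := by
  induction v using List.reverseRecOn generalizing q r with
  | nil =>
    obtain ⟨p', w', hp', ht'⟩ := (hD.mem_δ _ _ _).1 (show mem q (D.δ D.x₀ .lend) from hq)
    obtain ⟨⟨p, w⟩, hp⟩ := Option.isSome_iff_exists.1 (hD.pick_isSome hp' ht')
    obtain ⟨h₁, h₂⟩ := hD.pick_some hp
    refine ⟨p, w, (hD.mem_x₀ p).1 h₁, ?_, .single (Machine.step_left (l := []) ?_ ?_)⟩
    · simpa using Path.snoc (.nil p) h₂
    · simp [machine, step, walk, hp]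
    · simp [machine, walk]
  | append_singleton v a ih =>
    obtain ⟨p, w, h₁, h₂, h₃⟩ := star_look hD (triv := triv) (v := v) (r := r)
      (fun c hc => hv c (by simp [hc])) (hv a (by simp)) (by simpa using hq)
    obtain ⟨p₀, w₀, h₄, h₅, h₆⟩ := ih (r := a :: r) (fun c hc => hv c (by simp [hc])) h₁
    refine ⟨p₀, w₀ + w, h₄, ?_, ?_⟩
    · simpa using Path.snoc h₅ h₂
    · rw [add_comm]
      simpa using h₃.trans h₆

/-- The run of the subset automaton. -/
theorem star_scan {v v' r : List (Letter α)} (hv : ∀ b ∈ v', Inner b) :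
    Star (D.machine triv).Step ⟨v, D.walk .scan (D.reach D.x₀ v) none, v' ++ r⟩ 0
      ⟨v ++ v', D.walk .scan (D.reach D.x₀ (v ++ v')) none, r⟩ := by
  induction v' generalizing v with
  | nil => simpa using Star.refl _
  | cons a v' ih =>
    have ha := hv a (by simp)
    have s₁ : (D.machine triv).Step ⟨v, D.walk .scan (D.reach D.x₀ v) none, a :: (v' ++ r)⟩ 0
        ⟨v ++ [a], D.walk .scan (D.reach D.x₀ (v ++ [a])) none, v' ++ r⟩ := by
      refine Machine.step_right ?_ (by simp [machine, walk])
      simp [machine, step, walk, ha.1, ha.2]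
    simpa using Star.head s₁ (ih fun c hc => hv c (by simp [hc]))

theorem star_home {v v' r : List (Letter α)} (hv : ∀ b ∈ v', Inner b) :
    Star (D.machine triv).Step ⟨v, D.idle .home, v' ++ r⟩ 0 ⟨v ++ v', D.idle .home, r⟩ := by
  induction v' generalizing v with
  | nil => simpa using Star.refl _
  | cons a v' ih =>
    have ha := hv a (by simp)
    have s₁ : (D.machine triv).Step ⟨v, D.idle .home, a :: (v' ++ r)⟩ 0
        ⟨v ++ [a], D.idle .home, v' ++ r⟩ := by
      refine Machine.step_right ?_ (by simp [machine, idle])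
      simp [machine, step, idle, ha.1, ha.2]
    simpa using Star.head s₁ (ih fun c hc => hv c (by simp [hc]))

theorem inner_of_mem_map {u : List α} : ∀ b ∈ u.map Letter.sym, Inner b := by
  simp [Inner]

theorem star_start (u : List α) :
    Star (D.machine false).Step ⟨[], (D.machine false).start, tape u⟩ 0
      ⟨.lend :: u.map .sym, D.walk .scan (D.reach D.x₀ (.lend :: u.map .sym)) none, [.rend]⟩ := by
  have s₁ : (D.machine false).Step ⟨[], (D.machine false).start, tape u⟩ 0
      ⟨[.lend], D.walk .scan (D.reach D.x₀ [.lend]) none, u.map .sym ++ [.rend]⟩ := by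
    refine Machine.step_right (l := []) ?_ (by simp [machine, idle])
    simp [machine, step, idle, reach]
  simpa using Star.head s₁ (star_scan inner_of_mem_map)

/-- If the one-way automaton has an accepting path, the machine accepts, with the weight of an
accepting path. -/
theorem machine_accepts_of_path (hD : D.Lawful T I F mem) {u : List α} {p f : Q} {v : W}
    (hp : I p) (hf : F f) (h : Path T p (tape u) f v) :
    ∃ p' f' v', I p' ∧ F f' ∧ Path T p' (tape u) f' v' ∧ (D.machine false).Accepts u v' := by
  have ht : tape u = (.lend :: u.map .sym) ++ [.rend] := by simp [tape]
  generalize hu : tape u = t at h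
  cases h with
  | nil => simp [tape] at hu
  | snoc h h' =>
    rw [ht] at hu
    obtain ⟨rfl, rfl⟩ := List.append_singleton_inj.1 hu
    have hmem := (mem_reach hD).2 ⟨_, _, hp, h⟩
    obtain ⟨⟨q, w⟩, hq⟩ := Option.isSome_iff_exists.1 (hD.pickEnd_isSome hmem hf h')
    obtain ⟨h₁, f', h₂, h₃⟩ := hD.pickEnd_some hq
    obtain ⟨p₀, w₀, h₄, h₅, h₆⟩ := star_edge hD (triv := false) (v := u.map .sym) (r := [.rend])
      inner_of_mem_map h₁
    refine ⟨p₀, f', w₀ + w, h₄, h₂, ht ▸ Path.snoc h₅ h₃,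
      ⟨[.lend] ++ u.map .sym ++ [.rend], D.idle .fin, []⟩, ?_, rfl⟩
    have s₁ := star_start (D := D) u
    have s₂ : (D.machine false).Step ⟨.lend :: u.map .sym,
        D.walk .scan (D.reach D.x₀ (.lend :: u.map .sym)) none, [.rend]⟩ w
        ⟨.lend :: u.map .sym ++ [.rend],
          D.walk .back (D.reach D.x₀ (.lend :: u.map .sym)) (some q), []⟩ := by
      refine Machine.step_right ?_ (by simp [machine, walk])
      simp [machine, step, walk, hq]
    have s₃ : (D.machine false).Step ⟨.lend :: u.map .sym ++ [.rend],
        D.walk .back (D.reach D.x₀ (.lend :: u.map .sym)) (some q), []⟩ 0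
        ⟨.lend :: u.map .sym, D.walk .look (D.reach D.x₀ (.lend :: u.map .sym)) (some q),
          [.rend]⟩ := by
      refine Machine.step_left ?_ (by simp [machine, walk])
      simp [machine, step, walk]
    have s₄ : (D.machine false).Step ⟨[], D.idle .edge, .lend :: u.map .sym ++ [.rend]⟩ 0
        ⟨[.lend], D.idle .home, u.map .sym ++ [.rend]⟩ := by
      refine Machine.step_right (l := []) ?_ (by simp [machine, idle])
      simp [machine, step, idle]
    have s₅ := star_home (D := D) (triv := false) (v := [.lend]) (v' := u.map .sym)
      (r := [.rend]) inner_of_mem_map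
    have s₆ : (D.machine false).Step ⟨[.lend] ++ u.map .sym, D.idle .home, [.rend]⟩ 0
        ⟨[.lend] ++ u.map .sym ++ [.rend], D.idle .fin, []⟩ := by
      refine Machine.step_right ?_ (by simp [machine, idle])
      simp [machine, step, idle]
    have := s₁.trans (.head s₂ (.head s₃ (h₆.trans (.head s₄ (s₅.snoc s₆)))))
    simpa [add_comm] using this

/-- The machine accepts only if the one-way automaton has an accepting path. -/
theorem exists_path_of_machine_accepts (hD : D.Lawful T I F mem) {u : List α} {v : W}
    (h : (D.machine false).Accepts u v) :
    ∃ p f v, I p ∧ F f ∧ Path T p (tape u) f v := by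
  obtain ⟨c, h, hc⟩ := h
  obtain ⟨v', h', -⟩ := Star.det (r := (D.machine false).Step)
    (fun c w c' w' c'' h h' => (D.machine false).step_det h h')
    (star_start u) h (by
      rintro w c' ⟨a, h₁, -⟩
      rw [hc, (machine_lawful hD false).fin_step] at h₁
      simp at h₁)
  cases h' with
  | refl => simp [machine, walk, idle] at hc
  | head h₁ h₂ =>
    obtain ⟨a, h₃, h₄⟩ := h₁
    have hl : (D.machine false).left (D.walk .scan (D.reach D.x₀ (.lend :: u.map .sym)) none) =
      false := by simp [machine, walk]
    simp only [hl] at h₄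
    obtain rfl : a = .rend := by have := h₄.1; simp_all
    simp only [machine, step, walk] at h₃
    cases hq : D.pickEnd (D.reach D.x₀ (.lend :: u.map .sym)) with
    | none => simp [hq] at h₃
    | some pw =>
      obtain ⟨p, w⟩ := pw
      obtain ⟨h₅, f, h₆, h₇⟩ := hD.pickEnd_some hq
      obtain ⟨p₀, w₀, h₈, h₉⟩ := (mem_reach hD).1 h₅
      exact ⟨p₀, f, _, h₈, h₆, by simpa [tape] using Path.snoc h₉ h₇⟩

/-- In the trivial case the machine accepts every word with value zero. -/
theorem machine_accepts_trivial (hD : D.Lawful T I F mem) {u : List α} {v : W} :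
    (D.machine true).Accepts u v ↔ v = 0 := by
  constructor
  · rintro ⟨c, h, hc⟩
    exact Machine.star_to_fin_unique (machine_lawful hD true) h (.refl _) hc rfl
  · rintro rfl
    exact ⟨_, .refl _, rfl⟩

end LookData

namespace ParikhAutomaton

section

variable {α Q : Type*} {d : ℕ} (P : ParikhAutomaton α Q d)

open Classical in
/-- The weight of a transition, if there is one. -/
noncomputable def tr (p : Q) (a : Letter α) (q : Q) : Option (Fin d → ℤ) :=
  if h : (p, a, q) ∈ P.aut.trans then some (P.weight ⟨(p, a, q), h⟩) else none

theorem tr_eq_some {p q : Q} {a : Letter α} {w : Fin d → ℤ} :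
    P.tr p a q = some w ↔ ∃ h : (p, a, q) ∈ P.aut.trans, P.weight ⟨(p, a, q), h⟩ = w := by
  simp [tr]

/-- Acceptance of a word with a value, regardless of the constraint. -/
def AcceptsWith (u : List α) (v : Fin d → ℤ) : Prop :=
  ∃ q₀ ∈ P.aut.init, ∃ c, Star P.WStep ⟨[], q₀, tape u⟩ v c ∧ c.state ∈ P.aut.acc

theorem mem_language_iff {u : List α} :
    u ∈ P.language ↔ ∃ v, P.AcceptsWith u v ∧ P.constraint.Sat v := by
  rw [mem_language]
  constructor
  · rintro ⟨q, hq, v, c, h, hc, hs⟩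
    exact ⟨v, ⟨q, hq, c, h, hc⟩, hs⟩
  · rintro ⟨v, ⟨q, hq, c, h, hc⟩, hs⟩
    exact ⟨q, hq, v, c, h, hc, hs⟩

variable {P}

theorem wStep_iff {c c' : Config α Q} {w : Fin d → ℤ} : P.WStep c w c' ↔
    ∃ a, P.tr c.state a c'.state = some w ∧
      Mv (P.aut.side c.state).isL a c.left c.right c'.left c'.right := by
  constructor
  · rintro ⟨⟨⟨p, a, q⟩, ht⟩, hs, rfl⟩
    obtain ⟨rfl, rfl, hm⟩ := (TwoWayAutomaton.step_iff _ _ _ _).1 hs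
    exact ⟨a, P.tr_eq_some.2 ⟨ht, rfl⟩, hm⟩
  · rintro ⟨a, h, hm⟩
    obtain ⟨h, rfl⟩ := P.tr_eq_some.1 h
    exact ⟨_, (TwoWayAutomaton.step_iff _ _ _ _).2 ⟨rfl, rfl, hm⟩, rfl⟩

/-- Some word is accepted without a single step, so that all of them are. -/
def Trivial (P : ParikhAutomaton α Q d) : Prop := ∃ q ∈ P.aut.init, q ∈ P.aut.acc

theorem Trivial.acceptsWith (h : P.Trivial) (u : List α) : P.AcceptsWith u 0 := by
  obtain ⟨q, h₁, h₂⟩ := h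
  exact ⟨q, h₁, _, .refl _, h₂⟩

/-! ### One-way runs as paths -/

theorem path_of_star (hP : P.aut.OneWay) {c c' : Config α Q} {v : Fin d → ℤ}
    (h : Star P.WStep c v c') :
    ∃ u, c.right = u ++ c'.right ∧ c'.left = c.left ++ u ∧
      Path (fun p a q w => P.tr p a q = some w) c.state u c'.state v := by
  have key : ∀ {p q q' : Q} {a : Letter α} {u : List (Letter α)} {w v : Fin d → ℤ},
      P.tr p a q = some w → Path (fun p a q w => P.tr p a q = some w) q u q' v →
      Path (fun p a q w => P.tr p a q = some w) p (a :: u) q' (w + v) := by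
    intro p q q' a u w v h h'
    induction h' with
    | nil => simpa using Path.snoc (.nil p) h
    | snoc _ h₂ ih => simpa [add_assoc] using Path.snoc ih h₂
  induction h with
  | refl c => exact ⟨[], by simp, by simp, .nil _⟩
  | head h _ ih =>
    obtain ⟨u, h₁, h₂, h₃⟩ := ih
    obtain ⟨a, h₄, h₅⟩ := wStep_iff.1 h
    rw [hP] at h₅
    exact ⟨a :: u, by rw [h₅.1, h₁]; rfl, by rw [h₂, h₅.2]; simp, key h₄ h₃⟩

theorem star_of_path (hP : P.aut.OneWay) {p q : Q} {u l r : List (Letter α)} {v : Fin d → ℤ}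
    (h : Path (fun p a q w => P.tr p a q = some w) p u q v) :
    Star P.WStep ⟨l, p, u ++ r⟩ v ⟨l ++ u, q, r⟩ := by
  induction h generalizing r with
  | nil => simpa using Star.refl _
  | @snoc q q' u a v w _ h ih =>
    have : P.WStep ⟨l ++ u, q, a :: r⟩ w ⟨l ++ (u ++ [a]), q', r⟩ :=
      wStep_iff.2 ⟨a, h, by simp only [hP q, ← List.append_assoc]; exact Mv.right _ _ _⟩
    simpa using (ih (r := a :: r)).snoc this

/-- An accepting run that is not trivial reads the whole word. -/
theorem right_eq_nil_of_acc {u : List α} {c c' : Config α Q} {v : Fin d → ℤ}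
    (h : Star P.WStep c v c') (hc : c.left ++ c.right = tape u) (h₀ : c.state ∉ P.aut.acc)
    (h₁ : c'.state ∈ P.aut.acc) : c'.right = [] := by
  induction h with
  | refl => exact absurd h₁ h₀
  | @head c c' c'' w v h h' ih =>
    obtain ⟨a, h₂, h₃⟩ := wStep_iff.1 h
    have ht := h₃.append.trans hc
    by_cases h₄ : c'.state ∈ P.aut.acc
    · obtain ⟨h₅, -⟩ := P.tr_eq_some.1 h₂
      obtain ⟨h₆, rfl⟩ := P.aut.halt_entry _ _ _ h₅ (P.aut.acc_halt h₄)
      rw [h₆] at h₃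
      cases h' with
      | refl =>
        rw [h₃.2, List.append_assoc, List.singleton_append] at ht
        exact tape_eq_rend ht
      | head h₇ =>
        obtain ⟨b, h₈, -⟩ := wStep_iff.1 h₇
        exact absurd (P.aut.acc_halt h₄) (P.aut.no_exit _ _ _ (P.tr_eq_some.1 h₈).1)
    · exact ih ht h₄ h₁

theorem acceptsWith_iff_path (hP : P.aut.OneWay) (ht : ¬ P.Trivial) {u : List α}
    {v : Fin d → ℤ} : P.AcceptsWith u v ↔ ∃ p f, p ∈ P.aut.init ∧ f ∈ P.aut.acc ∧
      Path (fun p a q w => P.tr p a q = some w) p (tape u) f v := by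
  constructor
  · rintro ⟨p, hp, c, h, hc⟩
    have h₁ := right_eq_nil_of_acc h rfl (fun h' => ht ⟨p, hp, h'⟩) hc
    obtain ⟨w, h₂, -, h₃⟩ := path_of_star hP h
    rw [h₁, List.append_nil] at h₂
    exact ⟨p, _, hp, hc, (show tape u = w from h₂) ▸ h₃⟩
  · rintro ⟨p, f, hp, hf, h⟩
    exact ⟨p, hp, _, by simpa using star_of_path hP (l := []) (r := []) h, hf⟩

theorem value_unique (hP : P.IsUPA) {u : List α} {v v' : Fin d → ℤ} (h : P.AcceptsWith u v)
    (h' : P.AcceptsWith u v') : v = v' := by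
  obtain ⟨q, hq, c, h, hc⟩ := h
  obtain ⟨q', hq', c', h', hc'⟩ := h'
  obtain ⟨ts, h₁, rfl⟩ := P.star_wStep_iff.1 h
  obtain ⟨ts', h₁', rfl⟩ := P.star_wStep_iff.1 h'
  rw [(hP.2 u q ts q' ts' ⟨hq, c, h₁, hc⟩ ⟨hq', c', h₁', hc'⟩).2]

end

/-! ### The reversible automaton of an unambiguous one -/

theorem letters_nodup (m : ℕ) : (letters m).Nodup := by
  simp [letters, List.nodup_ofFn, Function.Injective]

theorem mem_letters {m : ℕ} (a : Letter (Fin m)) : a ∈ letters m := by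
  cases a <;> simp [letters]

variable {m n d : ℕ} (P : ParikhAutomaton (Fin m) (Fin n) d)

open Classical in
/-- Is the state initial? -/
noncomputable def initB (q : Fin n) : Bool := decide (q ∈ P.aut.init)

open Classical in
/-- Is the state accepting? -/
noncomputable def accB (q : Fin n) : Bool := decide (q ∈ P.aut.acc)

/-- The list of all pairs of states. -/
def pairs (n : ℕ) : List (Fin n × Fin n) :=
  (List.finRange n).flatMap fun p => (List.finRange n).map fun q => (p, q)

theorem mem_pairs (t : Fin n × Fin n) : t ∈ pairs n := by
  simp [pairs, Prod.ext_iff]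

theorem pairs_nodup (n : ℕ) : (pairs n).Nodup :=
  List.Nodup.product (List.nodup_finRange n) (List.nodup_finRange n)

/-- The subset automaton of `P`. Sets and relations are sublists of the list of all states and
of the list of all pairs of states. -/
noncomputable def lookData :
    LookData (Fin m) (Fin n) (Fin d → ℤ) (List (Fin n)) (List (Fin n × Fin n)) where
  xs := (List.finRange n).sublists'
  ms := (pairs n).sublists'
  qs := List.finRange n
  as := letters m
  δ := fun x a => (List.finRange n).filter fun q => x.any fun p => (P.tr p a q).isSome
  x₀ := (List.finRange n).filter P.initB
  act := fun x r => (List.finRange n).filter fun q => x.any fun p => decide ((p, q) ∈ r)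
  one := (pairs n).filter fun t => decide (t.1 = t.2)
  cns := fun b r => (pairs n).filter fun t =>
    (List.finRange n).any fun q => (P.tr t.1 b q).isSome && decide ((q, t.2) ∈ r)
  pick := fun x a q => (x.flatMap fun p => (P.tr p a q).elim [] fun w => [(p, w)]).head?
  pickEnd := fun x => (x.flatMap fun p => (List.finRange n).flatMap fun f =>
    if P.accB f then (P.tr p .rend f).elim [] fun w => [(p, w)] else []).head?

theorem lookData_lawful : P.lookData.Lawful (fun p a q w => P.tr p a q = some w)
    (fun q => q ∈ P.aut.init) (fun q => q ∈ P.aut.acc) (fun q x => q ∈ x) where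
  xs_nodup := List.nodup_sublists'.2 (List.nodup_finRange n)
  ms_nodup := List.nodup_sublists'.2 (pairs_nodup n)
  qs_nodup := List.nodup_finRange n
  as_nodup := letters_nodup m
  mem_as := mem_letters
  mem_qs := List.mem_finRange
  δ_mem x a := List.mem_sublists'.2 List.filter_sublist
  x₀_mem := List.mem_sublists'.2 List.filter_sublist
  one_mem := List.mem_sublists'.2 List.filter_sublist
  cns_mem a r := List.mem_sublists'.2 List.filter_sublist
  mem_δ q x a := by simp [lookData, Option.isSome_iff_exists]
  mem_x₀ q := by simp [lookData, initB]
  act_one x hx := by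
    have hx' : x.Sublist (List.finRange n) := List.mem_sublists'.1 hx
    have : ∀ q, (x.any fun p => decide ((p, q) ∈ P.lookData.one)) = decide (q ∈ x) := by
      intro q
      rw [Bool.eq_iff_iff]
      simp [lookData, mem_pairs]
    change (List.finRange n).filter _ = x
    simp only [this]
    refine List.Perm.eq_of_pairwise (le := fun a b => a < b)
      (fun a b _ _ h h' => absurd h' (lt_asymm h)) ?_ ?_ ?_
    · exact (List.pairwise_lt_finRange n).filter _
    · exact (List.pairwise_lt_finRange n).sublist hx'
    · rw [List.perm_ext_iff_of_nodup ((List.nodup_finRange n).filter _)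
        ((List.nodup_finRange n).sublist hx')]
      simp
  act_cns x a r := by
    refine List.filter_congr fun q _ => ?_
    rw [Bool.eq_iff_iff]
    simp [lookData, mem_pairs]
    constructor
    · rintro ⟨p, hp, s, h₁, h₂⟩
      exact ⟨s, ⟨p, hp, h₁⟩, h₂⟩
    · rintro ⟨s, ⟨p, hp, h₁⟩, h₂⟩
      exact ⟨p, hp, s, h₁, h₂⟩
  pick_some := by
    intro x a q p w h
    have := List.mem_of_mem_head? h
    simp only [List.mem_flatMap] at this
    obtain ⟨p', hp', h'⟩ := this
    cases ht : P.tr p' a q with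
    | none => simp [ht] at h'
    | some w' =>
      simp only [ht, Option.elim_some, List.mem_singleton, Prod.mk.injEq] at h'
      obtain ⟨rfl, rfl⟩ := h'
      exact ⟨hp', ht⟩
  pick_isSome := by
    intro x a q p w hp h
    simp only [lookData, List.isSome_head?]
    refine List.ne_nil_of_mem (a := (p, w)) ?_
    exact List.mem_flatMap.2 ⟨p, hp, by simp [h]⟩
  pickEnd_some := by
    intro x p w h
    have := List.mem_of_mem_head? h
    simp only [List.mem_flatMap] at this
    obtain ⟨p', hp', f, -, h'⟩ := this
    split_ifs at h' with hf
    · cases ht : P.tr p' .rend f with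
      | none => simp [ht] at h'
      | some w' =>
        simp only [ht, Option.elim_some, List.mem_singleton, Prod.mk.injEq] at h'
        obtain ⟨rfl, rfl⟩ := h'
        exact ⟨hp', f, by simpa [accB] using hf, ht⟩
    · simp at h'
  pickEnd_isSome := by
    intro x p f w hp hf h
    simp only [lookData, List.isSome_head?]
    refine List.ne_nil_of_mem (a := (p, w)) ?_
    exact List.mem_flatMap.2 ⟨p, hp, List.mem_flatMap.2 ⟨f, List.mem_finRange f, by
      simp [accB, hf, h]⟩⟩

/-- Does some initial state accept? -/
noncomputable def trivB : Bool := (List.finRange n).any fun q => P.initB q && P.accB q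

theorem trivB_iff : P.trivB = true ↔ P.Trivial := by
  simp [trivB, initB, accB, Trivial]

/-- The machine that runs an unambiguous automaton backwards. -/
noncomputable def lookMachine : Machine (Fin m)
    (LookState (Fin m) (Fin n) (List (Fin n)) (List (Fin n × Fin n))) (Fin d → ℤ) :=
  P.lookData.machine P.trivB

variable {P}

theorem lookMachine_accepts_iff (hP : P.IsUPA) {u : List (Fin m)} {v : Fin d → ℤ} :
    P.lookMachine.Accepts u v ↔ P.AcceptsWith u v := by
  have hD := P.lookData_lawful
  unfold lookMachine
  by_cases ht : P.Trivial
  · rw [P.trivB_iff.2 ht, LookData.machine_accepts_trivial hD]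
    constructor
    · rintro rfl
      exact ht.acceptsWith u
    · exact fun h => value_unique hP h (ht.acceptsWith u)
  · have hb : P.trivB = false := by
      rw [Bool.eq_false_iff, ne_eq, P.trivB_iff]
      exact ht
    rw [hb]
    have key : ∀ {v}, P.AcceptsWith u v → (P.lookData.machine false).Accepts u v := by
      intro v h
      obtain ⟨p, f, hp, hf, h₁⟩ := (acceptsWith_iff_path hP.1 ht).1 h
      obtain ⟨p', f', v', hp', hf', h₂, h₃⟩ := LookData.machine_accepts_of_path hD hp hf h₁
      rwa [value_unique hP h ((acceptsWith_iff_path hP.1 ht).2 ⟨p', f', hp', hf', h₂⟩)]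
    refine ⟨fun h => ?_, key⟩
    obtain ⟨p, f, v', hp, hf, h₁⟩ := LookData.exists_path_of_machine_accepts hD h
    have h₂ := (acceptsWith_iff_path hP.1 ht).2 ⟨p, f, hp, hf, h₁⟩
    obtain ⟨c, h₃, h₄⟩ := key h₂
    obtain ⟨c', h₅, h₆⟩ := h
    rwa [Machine.star_to_fin_unique (LookData.machine_lawful hD false) h₅ h₃ h₆ h₄]

variable (P) in
theorem lookMachine_lawful : P.lookMachine.Lawful :=
  LookData.machine_lawful P.lookData_lawful _

variable (P) in
theorem tour_lookMachine_states_ne_nil : P.lookMachine.tour.states ≠ [] :=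
  List.ne_nil_of_mem (P.lookMachine.mem_tour_states (ph := .up) |>.2 P.lookMachine_lawful.start_mem)

variable (P) in
/-- The reversible automaton of an unambiguous one. -/
noncomputable def toReversible :
    ParikhAutomaton (Fin m) (Fin P.lookMachine.tour.states.length) d :=
  P.lookMachine.tour.toPA P.tour_lookMachine_states_ne_nil P.constraint

variable (P) in
theorem toReversible_isReversible : P.toReversible.IsReversible2DPA :=
  Machine.tour_reversible P.lookMachine_lawful _ _

theorem language_toReversible (hP : P.IsUPA) : P.toReversible.language = P.language := by
  ext u
  rw [toReversible, Spec.mem_language_toPA, mem_language_iff]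
  simp only [Machine.tour_accepts_iff P.lookMachine_lawful, lookMachine_accepts_iff hP]

end ParikhAutomaton

namespace ParikhAutomaton

/-! ### Crossing sequences of deterministic automata -/

variable {m n d : ℕ} (P : ParikhAutomaton (Fin m) (Fin n) d)

/-- Is the state left-reading? -/
def leftB (q : Fin n) : Bool := (P.aut.side q).isL

/-- The target and the weight of the transition from `p` under `a`. -/
noncomputable def succ (p : Fin n) (a : Letter (Fin m)) : Option (Fin n × (Fin d → ℤ)) :=
  ((List.finRange n).flatMap fun q => (P.tr p a q).elim [] fun w => [(q, w)]).head?

theorem tr_of_succ {p q : Fin n} {a : Letter (Fin m)} {w : Fin d → ℤ}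
    (h : P.succ p a = some (q, w)) : P.tr p a q = some w := by
  have := List.mem_of_mem_head? h
  simp only [List.mem_flatMap] at this
  obtain ⟨q', -, h'⟩ := this
  cases ht : P.tr p a q' with
  | none => simp [ht] at h'
  | some w' =>
    simp only [ht, Option.elim_some, List.mem_singleton, Prod.mk.injEq] at h'
    obtain ⟨rfl, rfl⟩ := h'
    exact ht

variable {P} in
theorem succ_eq_some (hP : P.Is2DPA) {p q : Fin n} {a : Letter (Fin m)} {w : Fin d → ℤ} :
    P.succ p a = some (q, w) ↔ P.tr p a q = some w := by
  refine ⟨P.tr_of_succ, fun h => ?_⟩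
  cases hs : P.succ p a with
  | none =>
    simp only [succ, List.head?_eq_none_iff, List.flatMap_eq_nil_iff] at hs
    simpa [h] using hs q (List.mem_finRange q)
  | some t =>
    obtain ⟨q', w'⟩ := t
    have h' := P.tr_of_succ hs
    obtain ⟨h₁, h₂⟩ := P.tr_eq_some.1 h
    obtain ⟨h₃, h₄⟩ := P.tr_eq_some.1 h'
    obtain rfl := hP.2 _ _ _ _ h₁ h₃
    rw [← h₂, ← h₄]

/-- One step of the replay of the visits to the two ends of a cell of the tape with letter `a`:
`s.2.1` and `s.2.2` list the states of the remaining visits to the left and to the right end,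
and `s.1` tells whether the right end is the one closer to the head. -/
noncomputable def replayStep (a : Letter (Fin m)) (s : Bool × List (Fin n) × List (Fin n)) :
    Option (Bool × List (Fin n) × List (Fin n)) :=
  if s.1 then
    s.2.2.head?.bind fun q =>
      if P.accB q || !P.leftB q then some (true, s.2.1, s.2.2.tail)
      else (P.succ q a).bind fun t =>
        if s.2.1.head? = some t.1 then some (false, s.2.1, s.2.2.tail) else none
  else
    s.2.1.head?.bind fun p =>
      if P.leftB p then some (false, s.2.1.tail, s.2.2)
      else (P.succ p a).bind fun t =>
        if s.2.2.head? = some t.1 then some (true, s.2.1.tail, s.2.2) else none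

/-- The replay succeeds: it ends at the right end of the cell, with no visits left. -/
inductive Replay (a : Letter (Fin m)) : Bool × List (Fin n) × List (Fin n) → Prop where
  | done : Replay a (true, [], [])
  | step {s s'} : P.replayStep a s = some s' → Replay a s' → Replay a s

/-- A test for the success of a replay that begins at the left end. -/
noncomputable def matchB (a : Letter (Fin m)) (l r : List (Fin n)) : Bool :=
  decide ((l ++ r).foldl (fun o _ => o.bind (P.replayStep a)) (some (false, l, r)) =
    some (true, [], []))

section replay

variable {P} {a : Letter (Fin m)} {l r : List (Fin n)} {q : Fin n}

theorem replay_iff {s : Bool × List (Fin n) × List (Fin n)} : P.Replay a s ↔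
    s = (true, [], []) ∨ ∃ s', P.replayStep a s = some s' ∧ P.Replay a s' := by
  constructor
  · rintro (_ | ⟨h, h'⟩)
    · exact .inl rfl
    · exact .inr ⟨_, h, h'⟩
  · rintro (rfl | ⟨_, h, h'⟩)
    · exact .done
    · exact .step h h'

theorem length_of_replayStep {s s' : Bool × List (Fin n) × List (Fin n)}
    (h : P.replayStep a s = some s') :
    s.2.1.length + s.2.2.length = s'.2.1.length + s'.2.2.length + 1 := by
  obtain ⟨b, l, r⟩ := s
  cases b
  · cases l with
    | nil => simp [replayStep] at h
    | cons p l =>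
      simp only [replayStep, Bool.false_eq_true, if_false, List.head?_cons, Option.bind_some,
        List.tail_cons] at h
      split_ifs at h
      · simp only [Option.some.injEq] at h
        subst h
        simp only [List.length_cons]
        omega
      · obtain ⟨t, -, h⟩ := Option.bind_eq_some_iff.1 h
        split_ifs at h
        simp only [Option.some.injEq] at h
        subst h
        simp only [List.length_cons]
        omega
  · cases r with
    | nil => simp [replayStep] at h
    | cons p r =>
      simp only [replayStep, if_true, List.head?_cons, Option.bind_some, List.tail_cons] at h
      split_ifs at h
      · simp only [Option.some.injEq] at h
        subst h
        simp only [List.length_cons]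
        omega
      · obtain ⟨t, -, h⟩ := Option.bind_eq_some_iff.1 h
        split_ifs at h
        simp only [Option.some.injEq] at h
        subst h
        simp only [List.length_cons]
        omega

theorem foldl_replayStep_iff {β : Type*} (u : List β) {s : Bool × List (Fin n) × List (Fin n)}
    (hu : u.length = s.2.1.length + s.2.2.length) :
    u.foldl (fun o _ => o.bind (P.replayStep a)) (some s) = some (true, [], []) ↔
      P.Replay a s := by
  have hnone : ∀ u : List β, u.foldl (fun o _ => o.bind (P.replayStep a)) none = none := by
    intro u
    induction u with
    | nil => rfl
    | cons _ _ ih => simpa using ih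
  induction u generalizing s with
  | nil =>
    rw [replay_iff, List.foldl_nil, Option.some_inj]
    refine (or_iff_left ?_).symm
    rintro ⟨s', h, -⟩
    have := length_of_replayStep h
    simp only [List.length_nil] at hu
    omega
  | cons b u ih =>
    rw [replay_iff, List.foldl_cons, Option.bind_some]
    have hne : s ≠ (true, [], []) := by
      rintro rfl
      simp at hu
    cases h : P.replayStep a s with
    | none => simp [hnone, hne]
    | some s' =>
      have := length_of_replayStep h
      have hu' : u.length = s'.2.1.length + s'.2.2.length := by
        simp only [List.length_cons] at hu
        omega
      simp [hne, ih hu']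

theorem matchB_iff : P.matchB a l r = true ↔ P.Replay a (false, l, r) := by
  rw [matchB, decide_eq_true_iff, foldl_replayStep_iff]
  simp

theorem replay_nil : P.Replay a (true, l, []) ↔ l = [] := by
  rw [replay_iff]
  simp [replayStep]

theorem replay_pass_right (h : P.accB q = true ∨ P.leftB q = false) :
    P.Replay a (true, l, q :: r) ↔ P.Replay a (true, l, r) := by
  rw [replay_iff]
  simp [replayStep, h]

theorem replay_pass_left (h : P.leftB q = true) :
    P.Replay a (false, q :: l, r) ↔ P.Replay a (false, l, r) := by
  rw [replay_iff]
  simp [replayStep, h]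

theorem replay_to_right (h : P.leftB q = false) : P.Replay a (false, q :: l, r) ↔
    ∃ t, P.succ q a = some t ∧ r.head? = some t.1 ∧ P.Replay a (true, l, r) := by
  rw [replay_iff]
  cases hs : P.succ q a with
  | none => simp [replayStep, h, hs]
  | some t => by_cases ht : r.head? = some t.1 <;> simp [replayStep, h, hs, ht]

theorem replay_to_left (h : P.accB q = false) (h' : P.leftB q = true) :
    P.Replay a (true, l, q :: r) ↔
      ∃ t, P.succ q a = some t ∧ l.head? = some t.1 ∧ P.Replay a (false, l, r) := by
  rw [replay_iff]
  cases hs : P.succ q a with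
  | none => simp [replayStep, h, h', hs]
  | some t => by_cases ht : l.head? = some t.1 <;> simp [replayStep, h, h', hs, ht]

end replay

/-- A list of visits to the right end of the tape: the last one is accepting, and the other ones
are left-reading. -/
noncomputable def lastB (l : List (Fin n)) : Bool :=
  (l.reverse.head?.elim false P.accB) && l.reverse.tail.all fun q => P.leftB q && !P.accB q

theorem lastB_nil : P.lastB [] = false := by simp [lastB]

theorem lastB_cons {q : Fin n} {l : List (Fin n)} : P.lastB (q :: l) =
    if l = [] then P.accB q else P.leftB q && !P.accB q && P.lastB l := by
  split_ifs with h
  · simp [h, lastB]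
  · have h' : l.reverse ≠ [] := by simpa
    obtain ⟨x, t, ht⟩ := List.exists_cons_of_ne_nil h'
    simp only [lastB, List.reverse_cons, ht, List.cons_append, List.head?_cons, Option.elim_some,
      List.tail_cons, List.all_append, List.all_cons, List.all_nil, Bool.and_true]
    cases P.accB x <;> cases P.leftB q <;> simp [Bool.and_comm]

/-- The visits of an accepting run: `L i` lists the states of the visits to the position right of
the first `i` letters of the tape. The last parameter is the value of the run. -/
inductive Trace : Config (Fin m) (Fin n) → (ℕ → List (Fin n)) → (Fin d → ℤ) → Prop where
  | acc {c : Config (Fin m) (Fin n)} : c.state ∈ P.aut.acc → c.right = [] →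
      Trace c (Function.update (fun _ => []) c.left.length [c.state]) 0
  | step {c c' : Config (Fin m) (Fin n)} {L : ℕ → List (Fin n)} {w v : Fin d → ℤ} :
      P.WStep c w c' → Trace c' L v →
      Trace c (Function.update L c.left.length (c.state :: L c.left.length)) (w + v)

/-- The visits `L` are locally consistent with the remainder of an accepting run on the tape `t`
that starts right of the first `k` letters. -/
structure Consistent (t : List (Letter (Fin m))) (k : ℕ) (L : ℕ → List (Fin n)) : Prop where
  replay : ∀ i a, t[i]? = some a → P.Replay a (decide (i < k), L i, L (i + 1))
  first : ∀ q ∈ L 0, P.leftB q = false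
  last : P.lastB (L t.length) = true
  empty : ∀ i, t.length < i → L i = []

section

variable {P}

theorem notMem_acc_of_wStep {c c' : Config (Fin m) (Fin n)} {w : Fin d → ℤ}
    (h : P.WStep c w c') : c.state ∉ P.aut.acc := by
  intro hc
  obtain ⟨a, h₁, -⟩ := wStep_iff.1 h
  exact P.aut.no_exit _ _ _ (P.tr_eq_some.1 h₁).1 (P.aut.acc_halt hc)

theorem wStep_det (hP : P.Is2DPA) {c c' c'' : Config (Fin m) (Fin n)} {w w' : Fin d → ℤ}
    (h : P.WStep c w c') (h' : P.WStep c w' c'') : w = w' ∧ c' = c'' := by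
  obtain ⟨a, h₁, h₂⟩ := wStep_iff.1 h
  obtain ⟨a', h₃, h₄⟩ := wStep_iff.1 h'
  obtain ⟨rfl, h₅, h₆⟩ := h₂.det h₄
  have h₇ := (succ_eq_some hP).2 h₁
  rw [(succ_eq_some hP).2 h₃] at h₇
  cases c'; cases c''
  simp_all

theorem Trace.det (hP : P.Is2DPA) {c : Config (Fin m) (Fin n)} {L L' : ℕ → List (Fin n)}
    {v v' : Fin d → ℤ} (h : P.Trace c L v) (h' : P.Trace c L' v') : L = L' ∧ v = v' := by
  induction h generalizing L' v' with
  | acc h₁ h₂ =>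
    cases h' with
    | acc => exact ⟨rfl, rfl⟩
    | step h₃ => exact absurd h₁ (notMem_acc_of_wStep h₃)
  | step h₁ h₂ ih =>
    cases h' with
    | acc h₃ => exact absurd h₃ (notMem_acc_of_wStep h₁)
    | step h₃ h₄ =>
      obtain ⟨rfl, rfl⟩ := wStep_det hP h₁ h₃
      obtain ⟨rfl, rfl⟩ := ih h₄
      exact ⟨rfl, rfl⟩

theorem exists_trace {c c' : Config (Fin m) (Fin n)} {v : Fin d → ℤ}
    (h : Star P.WStep c v c') (hc : c'.state ∈ P.aut.acc) (hr : c'.right = []) :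
    ∃ L, P.Trace c L v := by
  induction h with
  | refl => exact ⟨_, .acc hc hr⟩
  | head h _ ih =>
    obtain ⟨L, hL⟩ := ih hc hr
    exact ⟨_, .step h hL⟩

theorem Trace.star {c : Config (Fin m) (Fin n)} {L : ℕ → List (Fin n)} {v : Fin d → ℤ}
    (h : P.Trace c L v) : ∃ c', Star P.WStep c v c' ∧ c'.state ∈ P.aut.acc := by
  induction h with
  | acc h => exact ⟨_, .refl _, h⟩
  | step h _ ih =>
    obtain ⟨c', h₁, h₂⟩ := ih
    exact ⟨c', .head h h₁, h₂⟩

theorem accB_eq_false {q : Fin n} (h : q ∉ P.aut.acc) : P.accB q = false := by simp [accB, h]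

variable {t : List (Letter (Fin m))} {k : ℕ} {L : ℕ → List (Fin n)} {a : Letter (Fin m)}
  {q q' : Fin n} {w : Fin d → ℤ}

/-- How a move to the right, from the position right of the first `k` letters, extends consistent
visits. -/
theorem consistent_right (hq : P.accB q = false) (hl : P.leftB q = false)
    (ha : t[k]? = some a) (hw : P.succ q a = some (q', w)) :
    P.Consistent t k (Function.update L k (q :: L k)) ↔
      P.Consistent t (k + 1) L ∧ (L (k + 1)).head? = some q' := by
  have hk : k < t.length := (List.getElem?_eq_some_iff.1 ha).1
  have e : ∀ i, i ≠ k → Function.update L k (q :: L k) i = L i := fun i hi =>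
    Function.update_of_ne hi _ _
  have e' : Function.update L k (q :: L k) k = q :: L k := Function.update_self _ _ _
  constructor
  · rintro ⟨h₁, h₂, h₃, h₄⟩
    have hk' := h₁ k a ha
    rw [e', e _ (by omega), decide_eq_false (by omega), replay_to_right hl] at hk'
    obtain ⟨t', ht', h₅, h₆⟩ := hk'
    obtain rfl : (q', w) = t' := by rw [hw] at ht'; exact Option.some.inj ht'
    refine ⟨⟨fun i b hb => ?_, fun p hp => ?_, ?_, fun i hi => ?_⟩, h₅⟩
    · rcases lt_trichotomy i k with hi | rfl | hi
      · have := h₁ i b hb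
        rw [e i hi.ne, decide_eq_true hi] at this
        rw [decide_eq_true (by omega)]
        by_cases hik : i + 1 = k
        · rwa [hik, e', replay_pass_right (.inr hl), ← hik] at this
        · rwa [e _ hik] at this
      · rw [ha] at hb
        obtain rfl := Option.some.inj hb
        rwa [decide_eq_true (by omega)]
      · have := h₁ i b hb
        rw [e i hi.ne', e _ (by omega), decide_eq_false (by omega)] at this
        rwa [decide_eq_false (by omega)]
    · by_cases h0 : 0 = k
      · subst h0
        exact h₂ p (by rw [e']; simp [hp])
      · exact h₂ p (by rwa [e _ h0])
    · rwa [e _ hk.ne'] at h₃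
    · have := h₄ i hi
      rwa [e _ (by omega)] at this
  · rintro ⟨⟨h₁, h₂, h₃, h₄⟩, h₅⟩
    refine ⟨fun i b hb => ?_, fun p hp => ?_, ?_, fun i hi => ?_⟩
    · have := h₁ i b hb
      rcases lt_trichotomy i k with hi | rfl | hi
      · rw [decide_eq_true (by omega)] at this
        rw [e i hi.ne, decide_eq_true hi]
        by_cases hik : i + 1 = k
        · rwa [hik, e', replay_pass_right (.inr hl), ← hik]
        · rwa [e _ hik]
      · rw [ha] at hb
        obtain rfl := Option.some.inj hb
        rw [decide_eq_true (by omega)] at this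
        rw [e', e _ (by omega), decide_eq_false (by omega), replay_to_right hl]
        exact ⟨_, hw, h₅, this⟩
      · rw [decide_eq_false (by omega)] at this
        rwa [e i hi.ne', e _ (by omega), decide_eq_false (by omega)]
    · by_cases h0 : 0 = k
      · subst h0
        rw [e'] at hp
        rcases List.mem_cons.1 hp with rfl | hp
        · exact hl
        · exact h₂ p hp
      · rw [e _ h0] at hp
        exact h₂ p hp
    · rwa [e _ hk.ne']
    · rw [e _ (by omega)]
      exact h₄ i hi

/-- How a move to the left extends consistent visits. -/
theorem consistent_left (hq : P.accB q = false) (hl : P.leftB q = true)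
    (ha : t[k]? = some a) (hw : P.succ q a = some (q', w)) :
    P.Consistent t (k + 1) (Function.update L (k + 1) (q :: L (k + 1))) ↔
      P.Consistent t k L ∧ (L k).head? = some q' ∧ (k + 1 = t.length → L (k + 1) ≠ []) := by
  have hk : k < t.length := (List.getElem?_eq_some_iff.1 ha).1
  have e : ∀ i, i ≠ k + 1 → Function.update L (k + 1) (q :: L (k + 1)) i = L i := fun i hi =>
    Function.update_of_ne hi _ _
  have e' : Function.update L (k + 1) (q :: L (k + 1)) (k + 1) = q :: L (k + 1) :=
    Function.update_self _ _ _
  constructor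
  · rintro ⟨h₁, h₂, h₃, h₄⟩
    have hk' := h₁ k a ha
    rw [e', e _ (by omega), decide_eq_true (by omega), replay_to_left hq hl] at hk'
    obtain ⟨t', ht', h₅, h₆⟩ := hk'
    obtain rfl : (q', w) = t' := by rw [hw] at ht'; exact Option.some.inj ht'
    have h₇ : k + 1 = t.length → L (k + 1) ≠ [] ∧ P.lastB (L (k + 1)) = true := by
      intro hkt
      rw [← hkt, e', lastB_cons] at h₃
      split_ifs at h₃ with h
      · simp [hq] at h₃
      · simp only [Bool.and_eq_true] at h₃
        exact ⟨h, h₃.2⟩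
    refine ⟨⟨fun i b hb => ?_, fun p hp => ?_, ?_, fun i hi => ?_⟩, h₅, fun h => (h₇ h).1⟩
    · have := h₁ i b hb
      rcases lt_trichotomy i k with hi | rfl | hi
      · rw [e i (by omega), decide_eq_true (by omega), e _ (by omega)] at this
        rwa [decide_eq_true (by omega)]
      · rw [ha] at hb
        obtain rfl := Option.some.inj hb
        rwa [decide_eq_false (by omega)]
      · rw [decide_eq_false (by omega), e (i + 1) (by omega)] at this
        rw [decide_eq_false (by omega)]
        by_cases hik : i = k + 1
        · rwa [hik, e', replay_pass_left hl, ← hik] at this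
        · rwa [e _ hik] at this
    · exact h₂ p (by rwa [e _ (by omega)])
    · by_cases h : t.length = k + 1
      · rw [h]
        exact (h₇ h.symm).2
      · rwa [e _ h] at h₃
    · have := h₄ i hi
      rwa [e _ (by omega)] at this
  · rintro ⟨⟨h₁, h₂, h₃, h₄⟩, h₅, h₆⟩
    refine ⟨fun i b hb => ?_, fun p hp => ?_, ?_, fun i hi => ?_⟩
    · have := h₁ i b hb
      rcases lt_trichotomy i k with hi | rfl | hi
      · rw [decide_eq_true (by omega)] at this
        rwa [e i (by omega), decide_eq_true (by omega), e _ (by omega)]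
      · rw [ha] at hb
        obtain rfl := Option.some.inj hb
        rw [decide_eq_false (by omega)] at this
        rw [e', e _ (by omega), decide_eq_true (by omega), replay_to_left hq hl]
        exact ⟨_, hw, h₅, this⟩
      · rw [decide_eq_false (by omega)] at this
        rw [decide_eq_false (by omega), e (i + 1) (by omega)]
        by_cases hik : i = k + 1
        · rwa [hik, e', replay_pass_left hl, ← hik]
        · rwa [e _ hik]
    · rw [e _ (by omega)] at hp
      exact h₂ p hp
    · by_cases h : t.length = k + 1
      · rw [h, e', lastB_cons, if_neg (h₆ h.symm), hl, hq]
        rw [h] at h₃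
        simpa using h₃
      · rwa [e _ h]
    · rw [e _ (by omega)]
      exact h₄ i hi

end

end ParikhAutomaton

namespace ParikhAutomaton

variable {m n d : ℕ} (P : ParikhAutomaton (Fin m) (Fin n) d)

section

variable {P} {u : List (Fin m)} {c : Config (Fin m) (Fin n)} {L : ℕ → List (Fin n)}
  {v : Fin d → ℤ}

theorem accB_eq_true {q : Fin n} : P.accB q = true ↔ q ∈ P.aut.acc := by simp [accB]

theorem getElem?_right {t : List (Letter (Fin m))} {a : Letter (Fin m)}
    {r : List (Letter (Fin m))} (h : c.left ++ c.right = t) (hr : c.right = a :: r) :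
    t[c.left.length]? = some a := by
  rw [← h, hr]; simp

/-- The visits of a run are consistent. -/
theorem Trace.consistent (hP : P.Is2DPA) (h : P.Trace c L v) (hc : c.left ++ c.right = tape u) :
    P.Consistent (tape u) c.left.length L ∧ (L c.left.length).head? = some c.state := by
  induction h with
  | @acc c h₁ h₂ =>
    rw [h₂, List.append_nil] at hc
    have e : ∀ i, i ≠ c.left.length →
        Function.update (fun _ => []) c.left.length [c.state] i = [] := fun i hi =>
      Function.update_of_ne hi _ _
    have e' : Function.update (fun _ => []) c.left.length [c.state] c.left.length = [c.state] :=
      Function.update_self _ _ _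
    have h0 : c.left.length ≠ 0 := by rw [hc]; simp [tape]
    refine ⟨⟨fun i a ha => ?_, fun q hq => ?_, ?_, fun i hi => ?_⟩, by rw [e']; rfl⟩
    · have hi := (List.getElem?_eq_some_iff.1 ha).1
      rw [← hc] at hi
      rw [decide_eq_true hi, e i hi.ne]
      by_cases h : i + 1 = c.left.length
      · rw [h, e', replay_pass_right (.inl (accB_eq_true.2 h₁)), replay_nil]
      · rw [e _ h, replay_nil]
    · rw [e _ h0.symm] at hq
      simp at hq
    · rw [← hc, e', lastB_cons, if_pos rfl]
      exact accB_eq_true.2 h₁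
    · rw [← hc] at hi
      exact e i hi.ne'
  | @step c c' L w v h h' ih =>
    obtain ⟨a, h₁, h₂⟩ := wStep_iff.1 h
    have hw := (succ_eq_some hP).2 h₁
    have hq := accB_eq_false (notMem_acc_of_wStep h)
    obtain ⟨h₃, h₄⟩ := ih (h₂.append.trans hc)
    refine ⟨?_, by rw [Function.update_self]; rfl⟩
    have hlb : (P.aut.side c.state).isL = P.leftB c.state := rfl
    rw [hlb] at h₂
    cases hl : P.leftB c.state <;> rw [hl] at h₂
    · have ha := getElem?_right hc h₂.1
      have hk : c'.left.length = c.left.length + 1 := by simp [h₂.2]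
      rw [hk] at h₃ h₄
      exact (consistent_right hq hl ha hw).2 ⟨h₃, h₄⟩
    · have ha := getElem?_right (h₂.append.trans hc) h₂.2
      have hk : c.left.length = c'.left.length + 1 := by simp [h₂.1]
      rw [hk]
      refine (consistent_left hq hl ha hw).2 ⟨h₃, h₄, fun hN hL => ?_⟩
      have := h₃.last
      rw [← hN, hL, lastB_nil] at this
      exact absurd this (by simp)

theorem succ_acc {p q : Fin n} {a : Letter (Fin m)} {w : Fin d → ℤ}
    (h : P.succ p a = some (q, w)) (hq : P.accB q = true) : P.leftB p = false ∧ a = .rend := by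
  obtain ⟨h₁, -⟩ := P.tr_eq_some.1 (P.tr_of_succ h)
  obtain ⟨h₂, rfl⟩ := P.aut.halt_entry _ _ _ h₁ (P.aut.acc_halt (accB_eq_true.1 hq))
  exact ⟨by rw [leftB, h₂]; rfl, rfl⟩

theorem getElem?_rend {k : ℕ} (h : (tape u)[k]? = some .rend) : k + 1 = (tape u).length := by
  obtain ⟨h₁, h₂⟩ := List.getElem?_eq_some_iff.1 h
  have h₃ : tape u = (tape u).take k ++ Letter.rend :: (tape u).drop (k + 1) := by
    rw [← h₂, List.cons_getElem_drop_succ, List.take_append_drop]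
  have := tape_eq_rend h₃.symm
  rw [List.drop_eq_nil_iff] at this
  omega

/-- Consistent visits are those of a run. -/
theorem Consistent.exists_trace {k : ℕ} {q : Fin n} (hP : P.Is2DPA)
    (h : P.Consistent (tape u) k L) (hq : (L k).head? = some q) (hk : k ≤ (tape u).length)
    (hacc : P.accB q = true → k = (tape u).length) :
    ∃ v, P.Trace ⟨(tape u).take k, q, (tape u).drop k⟩ L v := by
  -- Induction on the total number of visits: the first visit to the current position is removed.
  obtain ⟨s, hs⟩ : ∃ s, s = ∑ i ∈ Finset.range ((tape u).length + 1), (L i).length := ⟨_, rfl⟩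
  induction s using Nat.strong_induction_on generalizing k q L with
  | _ s ih =>
    obtain ⟨l, hl⟩ : ∃ l, L k = q :: l := by
      cases hL : L k with
      | nil => simp [hL] at hq
      | cons p l =>
        simp only [hL, List.head?_cons, Option.some.injEq] at hq
        exact ⟨l, by rw [hq]⟩
    have hupd : Function.update (Function.update L k l) k (q :: Function.update L k l k) = L := by
      rw [Function.update_self, Function.update_idem, ← hl, Function.update_eq_self]
    have hlt : ∑ i ∈ Finset.range ((tape u).length + 1), (Function.update L k l i).length < s := by
      rw [hs]
      refine Finset.sum_lt_sum (fun i _ => ?_) ⟨k, Finset.mem_range.2 (by omega), ?_⟩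
      · by_cases hi : i = k
        · subst hi; simp [hl]
        · rw [Function.update_of_ne hi]
      · simp [hl]
    have hlen : ((tape u).take k).length = k := by simp [hk]
    cases hqa : P.accB q with
    | true =>
      have hkN := hacc hqa
      have hl' : l = [] := by
        by_contra hne
        have := h.last
        rw [← hkN, hl, lastB_cons, if_neg hne, hqa] at this
        simp at this
      subst hl'
      have key : ∀ j, j < k → L (k - 1 - j) = [] := by
        intro j
        induction j with
        | zero =>
          intro hj
          obtain ⟨a, ha⟩ : ∃ a, (tape u)[k - 1 - 0]? = some a :=
            ⟨_, List.getElem?_eq_getElem (by omega)⟩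
          have := h.replay _ a ha
          rw [decide_eq_true (by omega), show k - 1 - 0 + 1 = k by omega, hl,
            replay_pass_right (.inl hqa), replay_nil] at this
          exact this
        | succ j ihj =>
          intro hj
          obtain ⟨a, ha⟩ : ∃ a, (tape u)[k - 1 - (j + 1)]? = some a :=
            ⟨_, List.getElem?_eq_getElem (by omega)⟩
          have := h.replay _ a ha
          rw [decide_eq_true (by omega), show k - 1 - (j + 1) + 1 = k - 1 - j by omega,
            ihj (by omega), replay_nil] at this
          exact this
      have hL : L = Function.update (fun _ => []) ((tape u).take k).length [q] := by
        rw [hlen]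
        funext i
        rcases lt_trichotomy i k with hi | rfl | hi
        · rw [Function.update_of_ne hi.ne]
          have := key (k - 1 - i) (by omega)
          rwa [show k - 1 - (k - 1 - i) = i by omega] at this
        · rw [hl, Function.update_self]
        · rw [Function.update_of_ne hi.ne']
          exact h.empty i (by omega)
      rw [hL]
      exact ⟨0, .acc (c := ⟨(tape u).take k, q, (tape u).drop k⟩) (accB_eq_true.1 hqa)
        (by simp [hkN])⟩
    | false =>
      have hkN : k = (tape u).length → P.leftB q = true := by
        intro hkN
        have := h.last
        rw [← hkN, hl, lastB_cons] at this
        split_ifs at this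
        · rw [hqa] at this
          exact absurd this (by simp)
        · simp only [Bool.and_eq_true] at this
          exact this.1.1
      cases hql : P.leftB q with
      | false =>
        have hk' : k < (tape u).length := by
          refine lt_of_le_of_ne hk fun h' => ?_
          rw [hkN h'] at hql
          simp at hql
        have ha : (tape u)[k]? = some (tape u)[k] := List.getElem?_eq_getElem hk'
        have hr := h.replay k _ ha
        rw [decide_eq_false (by omega), hl, replay_to_right hql] at hr
        obtain ⟨⟨q', w⟩, hw, -⟩ := hr
        rw [← hupd] at h
        obtain ⟨h₁, h₂⟩ := (consistent_right hqa hql ha hw).1 h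
        obtain ⟨v, hv⟩ := ih _ hlt h₁ h₂ (by omega) (fun h' => getElem?_rend
          ((succ_acc hw h').2 ▸ ha)) rfl
        refine ⟨w + v, ?_⟩
        have := Trace.step (c := ⟨(tape u).take k, q, (tape u).drop k⟩)
          (wStep_iff.2 ⟨_, (succ_eq_some hP).1 hw, ?_⟩) hv
        · simp only [hlen] at this
          rwa [hupd] at this
        · change Mv (P.leftB q) _ _ _ _ _
          rw [hql]
          exact ⟨(List.cons_getElem_drop_succ).symm, (List.take_append_getElem hk').symm⟩
      | true =>
        obtain ⟨k, rfl⟩ : ∃ k', k = k' + 1 := by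
          cases k with
          | zero =>
            have := h.first q (by rw [hl]; simp)
            rw [this] at hql
            simp at hql
          | succ k => exact ⟨k, rfl⟩
        have hk' : k < (tape u).length := by omega
        have ha : (tape u)[k]? = some (tape u)[k] := List.getElem?_eq_getElem hk'
        have hr := h.replay k _ ha
        rw [decide_eq_true (by omega), hl, replay_to_left hqa hql] at hr
        obtain ⟨⟨q', w⟩, hw, -⟩ := hr
        rw [← hupd] at h
        obtain ⟨h₁, h₂, -⟩ := (consistent_left hqa hql ha hw).1 h
        obtain ⟨v, hv⟩ := ih _ hlt h₁ h₂ (by omega) (fun h' => by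
          rw [(succ_acc hw h').1] at hql
          simp at hql) rfl
        refine ⟨w + v, ?_⟩
        have := Trace.step (c := ⟨(tape u).take (k + 1), q, (tape u).drop (k + 1)⟩)
          (wStep_iff.2 ⟨_, (succ_eq_some hP).1 hw, ?_⟩) hv
        · simp only [hlen] at this
          rwa [hupd] at this
        · change Mv (P.leftB q) _ _ _ _ _
          rw [hql]
          exact ⟨(List.take_append_getElem hk').symm, (List.cons_getElem_drop_succ).symm⟩

/-- Every visit is the beginning of the visits of the rest of the run. -/
theorem Trace.exists_of_mem {t : List (Letter (Fin m))} (h : P.Trace c L v)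
    (hc : c.left ++ c.right = t) {i : ℕ} {q : Fin n} (hq : q ∈ L i) :
    ∃ L' v', P.Trace ⟨t.take i, q, t.drop i⟩ L' v' ∧ ∀ j, (L' j).length ≤ (L j).length := by
  have self : ∀ {c : Config (Fin m) (Fin n)} {L v}, P.Trace c L v → c.left ++ c.right = t →
      P.Trace ⟨t.take c.left.length, c.state, t.drop c.left.length⟩ L v := by
    rintro c L v h rfl
    simpa using h
  induction h with
  | @acc c h₁ h₂ =>
    by_cases hi : i = c.left.length
    · subst hi
      rw [Function.update_self, List.mem_singleton] at hq
      subst hq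
      exact ⟨_, _, self (.acc h₁ h₂) hc, fun j => le_rfl⟩
    · rw [Function.update_of_ne hi] at hq
      simp at hq
  | @step c c' L w v h h' ih =>
    have ht : c'.left ++ c'.right = t := by
      obtain ⟨a, -, h₂⟩ := wStep_iff.1 h
      exact h₂.append.trans hc
    have hle : ∀ j, (L j).length ≤
        (Function.update L c.left.length (c.state :: L c.left.length) j).length := by
      intro j
      by_cases hj : j = c.left.length
      · subst hj; simp
      · rw [Function.update_of_ne hj]
    by_cases hqi : q ∈ L i
    · obtain ⟨L', v', h₁, h₂⟩ := ih ht hqi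
      exact ⟨L', v', h₁, fun j => (h₂ j).trans (hle j)⟩
    · by_cases hi : i = c.left.length
      · subst hi
        rw [Function.update_self, List.mem_cons] at hq
        obtain rfl := hq.resolve_right hqi
        exact ⟨_, _, self (.step h h') hc, fun j => le_rfl⟩
      · rw [Function.update_of_ne hi] at hq
        exact absurd hq hqi

/-- A run of a deterministic automaton that accepts does not loop. -/
theorem Trace.nodup (hP : P.Is2DPA) (h : P.Trace c L v) (i : ℕ) : (L i).Nodup := by
  induction h with
  | @acc c =>
    by_cases hi : i = c.left.length
    · subst hi; simp
    · rw [Function.update_of_ne hi]; simp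
  | @step c c' L w v h h' ih =>
    by_cases hi : i = c.left.length
    · subst hi
      rw [Function.update_self, List.nodup_cons]
      refine ⟨fun hmem => ?_, ih⟩
      obtain ⟨a, -, h₂⟩ := wStep_iff.1 h
      obtain ⟨L', v', h₃, h₄⟩ := h'.exists_of_mem h₂.append hmem
      rw [List.take_left, List.drop_left] at h₃
      have := (Trace.det hP h₃ (.step h h')).1
      have h₅ := h₄ c.left.length
      rw [this] at h₅
      simp at h₅
    · rwa [Function.update_of_ne hi]

theorem Trace.length_le (hP : P.Is2DPA) (h : P.Trace c L v) (i : ℕ) : (L i).length ≤ n := by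
  simpa using (h.nodup hP i).length_le_card

end

/-- The weight of the transition from `p` under `a`. -/
noncomputable def wt (a : Letter (Fin m)) (p : Fin n) : Fin d → ℤ := (P.succ p a).elim 0 Prod.snd

/-- The weight of all transitions over a cell of the tape, given the visits to its ends. -/
noncomputable def cellWeight (a : Letter (Fin m)) (l r : List (Fin n)) : Fin d → ℤ :=
  ((l.filter fun q => !P.leftB q).map (P.wt a)).sum +
    ((r.filter fun q => P.leftB q && !P.accB q).map (P.wt a)).sum

section

variable {P} {c : Config (Fin m) (Fin n)} {L : ℕ → List (Fin n)} {v : Fin d → ℤ}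

theorem Trace.value (hP : P.Is2DPA) {t : List (Letter (Fin m))} (h : P.Trace c L v)
    (hc : c.left ++ c.right = t) : v = ∑ i ∈ Finset.range t.length,
      t[i]?.elim 0 fun a => P.cellWeight a (L i) (L (i + 1)) := by
  induction h with
  | @acc c h₁ h₂ =>
    rw [h₂, List.append_nil] at hc
    refine (Finset.sum_eq_zero fun i hi => ?_).symm
    rw [Finset.mem_range, ← hc] at hi
    cases t[i]? with
    | none => rfl
    | some a =>
      rw [Option.elim_some, cellWeight, Function.update_of_ne hi.ne]
      by_cases h : i + 1 = c.left.length
      · simp [h, accB_eq_true.2 h₁]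
      · rw [Function.update_of_ne h]
        simp
  | @step c c' L w v h h' ih =>
    obtain ⟨a, h₁, h₂⟩ := wStep_iff.1 h
    have hw : P.wt a c.state = w := by rw [wt, (succ_eq_some hP).2 h₁]; rfl
    have hq := accB_eq_false (notMem_acc_of_wStep h)
    have hlb : (P.aut.side c.state).isL = P.leftB c.state := rfl
    have ih := ih (h₂.append.trans hc)
    rw [hlb] at h₂
    obtain ⟨k, hk, hka, hadd⟩ : ∃ k, k < t.length ∧ t[k]? = some a ∧ ∀ b i, (i = k → b = a) →
        P.cellWeight b (Function.update L c.left.length (c.state :: L c.left.length) i)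
          (Function.update L c.left.length (c.state :: L c.left.length) (i + 1)) =
        (if i = k then w else 0) + P.cellWeight b (L i) (L (i + 1)) := by
      cases hl : P.leftB c.state <;> rw [hl] at h₂
      · have ha := getElem?_right hc h₂.1
        refine ⟨c.left.length, (List.getElem?_eq_some_iff.1 ha).1, ha, fun b i hb => ?_⟩
        by_cases hi : i = c.left.length
        · obtain rfl := hb hi
          subst hi
          simp [cellWeight, hl, hw, add_assoc]
        · by_cases hi' : i + 1 = c.left.length
          · rw [← hi']
            simp [cellWeight, hl]
          · simp [cellWeight, hi, hi', Function.update_of_ne]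
      · have hk : c.left.length = c'.left.length + 1 := by simp [h₂.1]
        have ha := getElem?_right (h₂.append.trans hc) h₂.2
        refine ⟨c'.left.length, (List.getElem?_eq_some_iff.1 ha).1, ha, fun b i hb => ?_⟩
        by_cases hi : i = c'.left.length
        · obtain rfl := hb hi
          subst hi
          simp [hk, cellWeight, hl, hq, hw]
          abel
        · by_cases hi' : i = c.left.length
          · subst hi'
            simp [cellWeight, hl, hi]
          · have : i + 1 ≠ c.left.length := by omega
            simp [cellWeight, hi, hi', this, Function.update_of_ne]
    rw [Finset.sum_congr rfl (g := fun i => (if i = k then w else 0) +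
      t[i]?.elim 0 fun a => P.cellWeight a (L i) (L (i + 1))), Finset.sum_add_distrib, ← ih,
      Finset.sum_ite_eq' _ k, if_pos (Finset.mem_range.2 hk)]
    intro i hi
    rw [Finset.mem_range] at hi
    rw [List.getElem?_eq_getElem hi]
    refine hadd _ i ?_
    rintro rfl
    rw [List.getElem?_eq_getElem hi] at hka
    exact Option.some.inj hka

end

end ParikhAutomaton

namespace ParikhAutomaton

/-! ### The unambiguous automaton of a deterministic one -/

/-- The kinds of states of the unambiguous automaton: guessing the visits to a position inside
the tape or to its right end, and accepting all words. -/
inductive Kind where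
  | inner : Kind
  | final : Kind
  | special : Kind
deriving DecidableEq

/-- All lists of length at most `k` with entries in `qs`. -/
def words {Q : Type*} (qs : List Q) : ℕ → List (List Q)
  | 0 => [[]]
  | k + 1 => [] :: (words qs k).flatMap fun l => qs.map fun q => q :: l

theorem mem_words {Q : Type*} {qs : List Q} (h : ∀ q, q ∈ qs) {k : ℕ} {l : List Q} :
    l ∈ words qs k ↔ l.length ≤ k := by
  induction k generalizing l with
  | zero => simp [words]
  | succ k ih =>
    cases l with
    | nil => simp [words]
    | cons q l => simp [words, ih, h]

theorem words_nodup {Q : Type*} {qs : List Q} (h : qs.Nodup) (k : ℕ) : (words qs k).Nodup := by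
  induction k with
  | zero => simp [words]
  | succ k ih =>
    rw [words, List.nodup_cons]
    refine ⟨by simp, List.nodup_flatMap.2 ⟨fun l _ => h.map fun p q hpq => by simpa using hpq, ?_⟩⟩
    refine ih.imp fun {l l'} hl => ?_
    simp only [Function.onFun, List.disjoint_left, List.mem_map]
    rintro x ⟨q, -, rfl⟩ ⟨q', -, h'⟩
    rw [List.cons.injEq] at h'
    exact hl h'.2.symm

variable {m n d : ℕ} (P : ParikhAutomaton (Fin m) (Fin n) d)

open Classical in
/-- The transitions of the unambiguous automaton: the guessed visits to the two ends of a letter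
have to match, and the right delimiter, and nothing else, leads to a final state. The weight is
that of all transitions over this letter. -/
noncomputable def crossTr (s : Kind × List (Fin n)) (a : Letter (Fin m))
    (s' : Kind × List (Fin n)) : Option (Fin d → ℤ) :=
  if decide (s.1 = .inner) && !decide (s'.1 = .special) &&
      (decide (a = .rend) == decide (s'.1 = .final)) && (!decide (a = .rend) || P.lastB s'.2) &&
      P.matchB a s.2 s'.2
  then some (P.cellWeight a s.2 s'.2) else none

/-- The initial states of the unambiguous automaton: the first visit to the left end is initial.
If some initial state is accepting, all words are accepted with value zero, at once. -/
noncomputable def crossInit (s : Kind × List (Fin n)) : Bool :=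
  if P.trivB then decide (s.1 = .special) && decide (s.2 = [])
  else decide (s.1 = .inner) && s.2.head?.elim false P.initB && s.2.all fun q => !P.leftB q

/-- The automaton that guesses, at each position, the list of the states of all visits. -/
noncomputable def crossSpec : Spec (Fin m) (Kind × List (Fin n)) (Fin d → ℤ) where
  states := [Kind.inner, .final, .special].flatMap fun k =>
    (words (List.finRange n) n).map fun l => (k, l)
  left := fun _ => false
  init := P.crossInit
  acc := fun s => !decide (s.1 = .inner)
  tr := P.crossTr

theorem mem_crossSpec_states {s : Kind × List (Fin n)} :
    s ∈ P.crossSpec.states ↔ s.2.length ≤ n := by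
  obtain ⟨k, l⟩ := s
  cases k <;> simp [crossSpec, mem_words]

theorem crossSpec_states_nodup : P.crossSpec.states.Nodup := by
  have : P.crossSpec.states = [Kind.inner, .final, .special] ×ˢ words (List.finRange n) n := rfl
  rw [this]
  exact List.Nodup.product (by simp) (words_nodup (List.nodup_finRange n) n)

theorem crossSpec_states_ne_nil : P.crossSpec.states ≠ [] :=
  List.ne_nil_of_mem (a := (.special, [])) (P.mem_crossSpec_states.2 (by simp))

open Classical in
theorem crossSpec_entry {s s' : Kind × List (Fin n)} {a : Letter (Fin m)} {w : Fin d → ℤ} :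
    P.crossSpec.entry s a s' = some w ↔ s.1 = .inner ∧
      s'.1 = (if a = .rend then Kind.final else Kind.inner) ∧
      (a = .rend → P.lastB s'.2 = true) ∧ P.matchB a s.2 s'.2 = true ∧
      w = P.cellWeight a s.2 s'.2 := by
  obtain ⟨k, l⟩ := s
  obtain ⟨k', l'⟩ := s'
  rw [Spec.entry_eq_some, Spec.legal_iff]
  by_cases ha : a = .rend <;> cases k <;> cases k' <;>
    simp [crossSpec, crossTr, ha, and_assoc, eq_comm (a := w)]

/-- A sequence of visits to the right ends of the cells of a word, after the visits `l` to its
left end. -/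
inductive Chain : List (Letter (Fin m)) → List (Fin n) → List (List (Fin n)) →
    (Fin d → ℤ) → Prop where
  | nil {l} : P.lastB l = true → Chain [] l [] 0
  | cons {a t l l' ls v} : P.matchB a l l' = true → Chain t l' ls v →
      Chain (a :: t) l (l' :: ls) (P.cellWeight a l l' + v)

section

variable {P} {t : List (Letter (Fin m))} {l : List (Fin n)} {ls : List (List (Fin n))}
  {v : Fin d → ℤ}

theorem Chain.exists_visits (h : P.Chain t l ls v) : ∃ L : ℕ → List (Fin n), L 0 = l ∧
    (∀ i a, t[i]? = some a → P.matchB a (L i) (L (i + 1)) = true) ∧ P.lastB (L t.length) = true ∧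
    (∀ i, t.length < i → L i = []) ∧ ls = (List.range t.length).map (fun i => L (i + 1)) ∧
    v = ∑ i ∈ Finset.range t.length,
      t[i]?.elim 0 fun a => P.cellWeight a (L i) (L (i + 1)) := by
  induction h with
  | @nil l h =>
    refine ⟨fun i => if i = 0 then l else [], ?_⟩
    simp only [List.length_nil]
    simp [h]
    intro i hi h0
    omega
  | @cons a t l l' ls v h h' ih =>
    obtain ⟨L, h₀, h₁, h₂, h₃, h₄, h₅⟩ := ih
    refine ⟨fun i => Nat.casesOn i l L, rfl, ?_, h₂, ?_, ?_, ?_⟩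
    · rintro (_ | i) b hb
      · simp only [List.getElem?_cons_zero, Option.some.injEq] at hb
        subst hb
        simpa [h₀] using h
      · exact h₁ i b (by simpa using hb)
    · rintro (_ | i) hi
      · simp at hi
      · exact h₃ i (by simpa using hi)
    · simp [List.range_succ_eq_map, h₀, h₄]
    · rw [List.length_cons, Finset.sum_range_succ', add_comm, h₅]
      simp [h₀]

theorem chain_of_visits (L : ℕ → List (Fin n))
    (h : ∀ i a, t[i]? = some a → P.matchB a (L i) (L (i + 1)) = true)
    (h' : P.lastB (L t.length) = true) :
    P.Chain t (L 0) ((List.range t.length).map (fun i => L (i + 1)))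
      (∑ i ∈ Finset.range t.length,
        t[i]?.elim 0 fun a => P.cellWeight a (L i) (L (i + 1))) := by
  induction t generalizing L with
  | nil => simpa using Chain.nil h'
  | cons a t ih =>
    have := ih (fun i => L (i + 1)) (fun i b hb => h (i + 1) b (by simpa using hb)) h'
    have := Chain.cons (h 0 a (by simp)) this
    rw [List.length_cons, Finset.sum_range_succ', add_comm (Finset.sum _ _),
      List.range_succ_eq_map]
    simpa [Function.comp_def] using this

/-- The chains on a tape that begin in an initial state are the accepting runs. -/
theorem chain_iff_trace (hP : P.Is2DPA) {u : List (Fin m)} {q : Fin n}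
    (hq : q ∈ P.aut.init) (hl : l.head? = some q) (ht : ¬ P.Trivial) :
    (P.Chain (tape u) l ls v ∧ l.all fun q => !P.leftB q) ↔ ∃ L, P.Trace ⟨[], q, tape u⟩ L v ∧
      L 0 = l ∧ ls = (List.range (tape u).length).map (fun i => L (i + 1)) := by
  constructor
  · rintro ⟨h, hall⟩
    obtain ⟨L, rfl, h₁, h₂, h₃, rfl, rfl⟩ := h.exists_visits
    have hc : P.Consistent (tape u) 0 L :=
      ⟨fun i a ha => by simpa [matchB_iff] using h₁ i a ha, by simpa using hall, h₂, h₃⟩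
    obtain ⟨v, hv⟩ := hc.exists_trace hP hl (by simp)
      (fun h => absurd ⟨q, hq, accB_eq_true.1 h⟩ ht)
    simp only [List.take_zero, List.drop_zero] at hv
    have h₄ := hv.value hP (t := tape u) rfl
    exact ⟨L, by rwa [← h₄], rfl, rfl⟩
  · rintro ⟨L, h, rfl, rfl⟩
    obtain ⟨h₁, h₂⟩ := h.consistent hP rfl
    rw [h.value hP (t := tape u) rfl]
    exact ⟨chain_of_visits L (fun i a ha => by
      simpa [matchB_iff] using h₁.replay i a ha) h₁.last, by simpa using h₁.first⟩

theorem acceptsWith_iff_trace (ht : ¬ P.Trivial) {u : List (Fin m)} : P.AcceptsWith u v ↔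
    ∃ q ∈ P.aut.init, ∃ L, P.Trace ⟨[], q, tape u⟩ L v := by
  constructor
  · rintro ⟨q, hq, c, h, hc⟩
    exact ⟨q, hq, TwoWayParikh.ParikhAutomaton.exists_trace h hc
      (right_eq_nil_of_acc h rfl (fun h' => ht ⟨q, hq, h'⟩) hc)⟩
  · rintro ⟨q, hq, L, h⟩
    obtain ⟨c, h₁, h₂⟩ := h.star
    exact ⟨q, hq, c, h₁, h₂⟩

theorem acceptsWith_of_trivial (hP : P.Is2DPA) (ht : P.Trivial) {u : List (Fin m)} :
    P.AcceptsWith u v ↔ v = 0 := by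
  refine ⟨?_, fun h => h ▸ ht.acceptsWith u⟩
  rintro ⟨q, hq, c, h, -⟩
  obtain ⟨q', h₁, h₂⟩ := ht
  obtain rfl := hP.1 hq h₁
  cases h with
  | refl => rfl
  | head h => exact absurd h₂ (notMem_acc_of_wStep h)

end

/-- The unambiguous automaton of a deterministic one. -/
noncomputable def toUPA : ParikhAutomaton (Fin m) (Fin P.crossSpec.states.length) d :=
  P.crossSpec.toPA P.crossSpec_states_ne_nil P.constraint

/-- A run is determined by the states it visits. -/
theorem isRun_ext {α Q : Type*} {A : TwoWayAutomaton α Q} {c c' c'' : Config α Q}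
    {ts ts' : List A.trans} (h : A.IsRun c ts c') (h' : A.IsRun c ts' c'')
    (he : ts.map (fun t => t.1.2.2) = ts'.map (fun t => t.1.2.2)) : ts = ts' := by
  induction h generalizing ts' c'' with
  | nil =>
    cases ts' with
    | nil => rfl
    | cons t ts' => simp at he
  | @cons c c₁ c₂ t ts h _ ih =>
    cases h' with
    | nil => simp at he
    | @cons c c₃ c₄ t' ts' h₁ h₂ =>
      rw [List.map_cons, List.map_cons, List.cons.injEq] at he
      obtain ⟨h₃, h₄, h₅⟩ := (A.step_iff _ _ _).1 h
      obtain ⟨h₃', h₄', h₅'⟩ := (A.step_iff _ _ _).1 h₁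
      obtain ⟨h₆, h₇, h₈⟩ := h₅.det h₅'
      have ht : t = t' := Subtype.ext (Prod.ext (h₃.trans h₃'.symm) (Prod.ext h₆ he.1))
      have hc : c₁ = c₃ := by
        cases c₁; cases c₃
        simp_all
      subst ht hc
      rw [ih h₂ he.2]

section

variable {P}

theorem toUPA_step {c c' : Config (Fin m) (Fin P.crossSpec.states.length)}
    {t : P.toUPA.aut.trans} : P.toUPA.aut.Step c t c' ↔
      t.1.1 = c.state ∧ t.1.2.2 = c'.state ∧ Mv false t.1.2.1 c.left c.right c'.left c'.right :=
  TwoWayAutomaton.step_iff _ _ _ _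

open Classical in
/-- The visits guessed along a run. -/
theorem chain_of_isRun {c c' : Config (Fin m) (Fin P.crossSpec.states.length)}
    {ts : List P.toUPA.aut.trans} (h : P.toUPA.aut.IsRun c ts c') {l : List (Fin n)}
    (hc : P.crossSpec.states.get c.state = (.inner, l)) (hc' : c'.state ∈ P.toUPA.aut.acc)
    {w : List (Letter (Fin m))} (hw : c.right = w ++ [.rend]) (hw' : Letter.rend ∉ w) :
    ∃ ls, P.Chain (w ++ [.rend]) l ls (P.toUPA.value ts) ∧
      ts.map (fun t => P.crossSpec.states.get t.1.2.2) =
        List.zipWith (fun a l => (if a = .rend then Kind.final else Kind.inner, l))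
          (w ++ [.rend]) ls := by
  induction h generalizing l w with
  | nil c =>
    have : P.crossSpec.acc (P.crossSpec.states.get c.state) = true := hc'
    rw [hc] at this
    simp [crossSpec] at this
  | @cons c c₁ c₂ t ts h h' ih =>
    obtain ⟨⟨p, a, q⟩, ht⟩ := t
    obtain ⟨h₁, h₂, h₃, -⟩ := toUPA_step.1 h
    simp only at h₁ h₂ h₃
    subst h₁ h₂
    obtain ⟨v, hv⟩ := Spec.mem_trans_toPA.1 ht
    have hv' : P.toUPA.weight ⟨_, ht⟩ = v := Spec.weight_toPA ht hv
    obtain ⟨-, h₅, h₆, h₇, h₈⟩ := P.crossSpec_entry.1 hv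
    rw [hc] at h₇ h₈
    simp only at h₇ h₈
    have hval : P.toUPA.value (⟨(c.state, a, c₁.state), ht⟩ :: ts) = v + P.toUPA.value ts := by
      simp [value, hv']
    rw [hval, h₈]
    obtain ⟨l', hl'⟩ : ∃ l', (P.crossSpec.states.get c₁.state).2 = l' := ⟨_, rfl⟩
    rw [hl'] at h₆ h₇
    rw [hw] at h₃
    cases w with
    | nil =>
      simp only [List.nil_append, List.cons.injEq] at h₃
      obtain ⟨rfl, -⟩ := h₃
      rw [if_pos rfl] at h₅
      cases h' with
      | nil =>
        refine ⟨[l'], ?_, ?_⟩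
        · rw [hl']
          exact .cons h₇ (.nil (h₆ rfl))
        · rw [List.map_cons, show P.crossSpec.states.get c₁.state = (.final, l') from
            Prod.ext h₅ hl']
          simp
      | @cons _ _ _ t' _ h'' =>
        obtain ⟨⟨p', a', q'⟩, ht'⟩ := t'
        obtain ⟨v', hv'⟩ := Spec.mem_trans_toPA.1 ht'
        obtain ⟨h₉, -⟩ := toUPA_step.1 h''
        simp only at h₉
        subst h₉
        have := (P.crossSpec_entry.1 hv').1
        rw [h₅] at this
        simp at this
    | cons b w =>
      simp only [List.cons_append, List.cons.injEq] at h₃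
      obtain ⟨rfl, h₃⟩ := h₃
      rw [List.mem_cons, not_or] at hw'
      have hb : b ≠ .rend := Ne.symm hw'.1
      rw [if_neg hb] at h₅
      have h₉ : P.crossSpec.states.get c₁.state = (.inner, l') := Prod.ext h₅ hl'
      obtain ⟨ls, h₁₀, h₁₁⟩ := ih h₉ hc' h₃.symm hw'.2
      refine ⟨l' :: ls, ?_, ?_⟩
      · rw [hl']
        exact .cons h₇ h₁₀
      · rw [List.map_cons, h₁₁, h₉]
        simp [hb]

theorem star_of_chain {x w : List (Letter (Fin m))} {l : List (Fin n)} {ls : List (List (Fin n))}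
    {v : Fin d → ℤ} (h : P.Chain (w ++ [.rend]) l ls v) (hw : Letter.rend ∉ w)
    (hl : l.length ≤ n) (hls : ∀ l' ∈ ls, l'.length ≤ n) :
    ∃ l', Star P.crossSpec.WStep ⟨x, (.inner, l), w ++ [.rend]⟩ v
      ⟨x ++ (w ++ [.rend]), (.final, l'), []⟩ := by
  induction w generalizing x l ls v with
  | nil =>
    cases h with
    | @cons _ _ _ l' _ _ h₁ h₂ =>
      cases h₂ with
      | nil h₃ =>
        refine ⟨l', .head ⟨P.mem_crossSpec_states.2 hl, P.mem_crossSpec_states.2 (hls _ (by simp)),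
          _, P.crossSpec_entry.2 ⟨rfl, (if_pos rfl).symm, fun _ => h₃, h₁, rfl⟩,
          ⟨rfl, rfl⟩⟩ (.refl _)⟩
  | cons a w ih =>
    rw [List.mem_cons, not_or] at hw
    have ha : a ≠ .rend := Ne.symm hw.1
    cases h with
    | @cons _ _ _ l' _ _ h₁ h₂ =>
      obtain ⟨l'', h₃⟩ := ih (x := x ++ [a]) h₂ hw.2 (hls _ (by simp))
        fun l' h => hls _ (by simp [h])
      refine ⟨l'', ?_⟩
      rw [List.append_assoc] at h₃
      exact .head ⟨P.mem_crossSpec_states.2 hl, P.mem_crossSpec_states.2 (hls _ (by simp)),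
        _, P.crossSpec_entry.2 ⟨rfl, (if_neg ha).symm, fun h => absurd h ha, h₁, rfl⟩,
        ⟨rfl, rfl⟩⟩ h₃

theorem tape_eq (u : List (Fin m)) : tape u = (.lend :: u.map .sym) ++ [.rend] := rfl

theorem rend_notMem (u : List (Fin m)) : Letter.rend ∉ (.lend :: u.map Letter.sym) := by simp

theorem crossInit_of_not_trivial (ht : ¬ P.Trivial) {s : Kind × List (Fin n)} :
    P.crossInit s = true ↔ s.1 = .inner ∧ (∃ q ∈ P.aut.init, s.2.head? = some q) ∧
      (s.2.all fun q => !P.leftB q) = true := by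
  have hb : P.trivB = false := by rwa [Bool.eq_false_iff, ne_eq, P.trivB_iff]
  obtain ⟨k, l⟩ := s
  rw [crossInit, hb]
  cases l <;> simp [initB, and_assoc]

open Classical in
theorem exists_trace_of_run (hP : P.Is2DPA) (ht : ¬ P.Trivial) {u : List (Fin m)}
    {q : Fin P.crossSpec.states.length} {ts : List P.toUPA.aut.trans}
    (h : P.toUPA.aut.IsAcceptingRun u q ts) :
    ∃ q₀ ∈ P.aut.init, ∃ L, P.Trace ⟨[], q₀, tape u⟩ L (P.toUPA.value ts) ∧
      P.crossSpec.states.get q = (.inner, L 0) ∧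
      ts.map (fun t => P.crossSpec.states.get t.1.2.2) =
        List.zipWith (fun a l => (if a = .rend then Kind.final else Kind.inner, l))
          (tape u) ((List.range (tape u).length).map (fun i => L (i + 1))) := by
  obtain ⟨hq, c, hr, hc⟩ := h
  obtain ⟨h₁, ⟨q₀, hq₀, h₂⟩, h₃⟩ := (crossInit_of_not_trivial ht).1 hq.1
  obtain ⟨l, hl⟩ : ∃ l, (P.crossSpec.states.get q).2 = l := ⟨_, rfl⟩
  rw [hl] at h₂ h₃
  have h₄ : P.crossSpec.states.get q = (.inner, l) := Prod.ext h₁ hl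
  obtain ⟨ls, h₅, h₆⟩ := chain_of_isRun hr h₄ hc (tape_eq u) (rend_notMem u)
  obtain ⟨L, h₇, rfl, rfl⟩ := (chain_iff_trace hP hq₀ h₂ ht).1 ⟨h₅, h₃⟩
  exact ⟨q₀, hq₀, L, h₇, h₄, h₆⟩

theorem crossInit_of_trivial (ht : P.Trivial) {s : Kind × List (Fin n)} :
    P.crossInit s = true ↔ s = (.special, []) := by
  rw [crossInit, P.trivB_iff.2 ht]
  simp [Prod.ext_iff]

theorem run_of_trivial (ht : P.Trivial) {u : List (Fin m)} {q : Fin P.crossSpec.states.length}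
    {ts : List P.toUPA.aut.trans} (h : P.toUPA.aut.IsAcceptingRun u q ts) :
    P.crossSpec.states.get q = (.special, []) ∧ ts = [] := by
  obtain ⟨hq, c, hr, -⟩ := h
  have h₁ := (crossInit_of_trivial ht).1 hq.1
  refine ⟨h₁, ?_⟩
  cases hr with
  | nil => rfl
  | @cons _ _ _ t _ h =>
    obtain ⟨⟨p, a, q'⟩, ht'⟩ := t
    obtain ⟨v, hv⟩ := Spec.mem_trans_toPA.1 ht'
    obtain ⟨h₂, -⟩ := toUPA_step.1 h
    simp only at h₂
    subst h₂
    have := (P.crossSpec_entry.1 hv).1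
    rw [h₁] at this
    simp at this

theorem toUPA_isUPA (hP : P.Is2DPA) : P.toUPA.IsUPA := by
  have hone : P.toUPA.aut.OneWay := fun q => rfl
  have inj : Function.Injective P.crossSpec.states.get :=
    List.nodup_iff_injective_get.1 P.crossSpec_states_nodup
  refine ⟨hone, fun u q ts q' ts' h h' => ?_⟩
  by_cases ht : P.Trivial
  · obtain ⟨h₁, rfl⟩ := run_of_trivial ht h
    obtain ⟨h₂, rfl⟩ := run_of_trivial ht h'
    exact ⟨inj (h₁.trans h₂.symm), rfl⟩
  · obtain ⟨q₀, hq, L, h₁, h₂, h₃⟩ := exists_trace_of_run hP ht h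
    obtain ⟨q₀', hq', L', h₁', h₂', h₃'⟩ := exists_trace_of_run hP ht h'
    obtain rfl := hP.1 hq hq'
    obtain ⟨rfl, -⟩ := h₁.det hP h₁'
    obtain rfl := inj (h₂.trans h₂'.symm)
    obtain ⟨-, c, hr, -⟩ := h
    obtain ⟨-, c', hr', -⟩ := h'
    refine ⟨rfl, isRun_ext hr hr' (inj.list_map ?_)⟩
    simpa [Function.comp_def] using h₃.trans h₃'.symm

theorem language_toUPA (hP : P.Is2DPA) : P.toUPA.language = P.language := by
  ext u
  rw [P.mem_language_iff]
  constructor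
  · rintro ⟨q, ts, h, hs⟩
    refine ⟨_, ?_, hs⟩
    by_cases ht : P.Trivial
    · obtain ⟨-, rfl⟩ := run_of_trivial ht h
      exact (acceptsWith_of_trivial hP ht).2 rfl
    · obtain ⟨q₀, hq, L, h₁, -⟩ := exists_trace_of_run hP ht h
      exact (acceptsWith_iff_trace ht).2 ⟨q₀, hq, L, h₁⟩
  · rintro ⟨v, h, hs⟩
    refine Spec.mem_language_toPA.2 ⟨v, ?_, hs⟩
    by_cases ht : P.Trivial
    · obtain rfl := (acceptsWith_of_trivial hP ht).1 h
      exact ⟨(.special, []), P.mem_crossSpec_states.2 (by simp), (crossInit_of_trivial ht).2 rfl,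
        rfl, _, .refl _, rfl⟩
    · obtain ⟨q₀, hq, L, h₁⟩ := (acceptsWith_iff_trace ht).1 h
      have h₂ := (h₁.consistent hP rfl).2
      obtain ⟨h₃, h₄⟩ := (chain_iff_trace hP hq h₂ ht).2 ⟨L, h₁, rfl, rfl⟩
      obtain ⟨l', h₅⟩ := star_of_chain (x := []) h₃ (rend_notMem u) (h₁.length_le hP 0)
        (by
          intro l hl
          obtain ⟨i, -, rfl⟩ := List.mem_map.1 hl
          exact h₁.length_le hP _)
      exact ⟨(.inner, L 0), P.mem_crossSpec_states.2 (h₁.length_le hP 0),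
        (crossInit_of_not_trivial ht).2 ⟨rfl, ⟨q₀, hq, h₂⟩, h₄⟩, rfl, _, h₅, rfl⟩

end

end ParikhAutomaton

/-! ### Polynomial time -/

theorem eval_mono (q : Polynomial ℕ) {a b : ℕ} (h : a ≤ b) : q.eval a ≤ q.eval b := by
  rw [Polynomial.eval_eq_sum, Polynomial.eval_eq_sum]
  exact Finset.sum_le_sum fun i _ => Nat.mul_le_mul_left _ (Nat.pow_le_pow_left h i)

theorem Prog.Runs.size_le {p : Prog} {x y : Data} {c : ℕ} (h : p.Runs x y c) : y.size ≤ c := by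
  induction h with
  | nil => simp [Data.size]
  | id => omega
  | fst x => cases x <;> simp [Data.fst, Data.size]; omega
  | snd x => cases x <;> simp [Data.snd, Data.size]; omega
  | pair => simp only [Data.size]; omega
  | seq => omega
  | ite_node => omega
  | ite_nil => omega
  | loop_nil => omega
  | loop_node => omega

section

variable {Y S : Type} {e f g : Y → Data}

/-- The numbers `g y` are bounded by a polynomial in the size of the data `e y`. -/
def PolyBdd (e : Y → Data) (g : Y → ℕ) : Prop :=
  ∃ q : Polynomial ℕ, ∀ y, g y ≤ q.eval (e y).size

/-- Some program computes `f y` from `e y`, for all `y`, in polynomial time. The elements `y` of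
`Y` are the values of the variables of an expression `f`, and `e` encodes these values. -/
def PolyTime (e f : Y → Data) : Prop :=
  ∃ (p : Prog) (q : Polynomial ℕ), ∀ y, ∃ c, p.Runs (e y) (f y) c ∧ c ≤ q.eval (e y).size

namespace PolyBdd

variable {a b : Y → ℕ}

theorem mono (h : PolyBdd e b) (hab : ∀ y, a y ≤ b y) : PolyBdd e a := by
  obtain ⟨q, hq⟩ := h
  exact ⟨q, fun y => (hab y).trans (hq y)⟩

theorem const (k : ℕ) : PolyBdd e fun _ => k := ⟨Polynomial.C k, fun y => by simp⟩

theorem self : PolyBdd e fun y => (e y).size := ⟨Polynomial.X, fun y => by simp⟩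

theorem add (ha : PolyBdd e a) (hb : PolyBdd e b) : PolyBdd e fun y => a y + b y := by
  obtain ⟨q, hq⟩ := ha
  obtain ⟨r, hr⟩ := hb
  exact ⟨q + r, fun y => by simpa using Nat.add_le_add (hq y) (hr y)⟩

theorem mul (ha : PolyBdd e a) (hb : PolyBdd e b) : PolyBdd e fun y => a y * b y := by
  obtain ⟨q, hq⟩ := ha
  obtain ⟨r, hr⟩ := hb
  exact ⟨q * r, fun y => by simpa using Nat.mul_le_mul (hq y) (hr y)⟩

theorem eval (q : Polynomial ℕ) (ha : PolyBdd e a) : PolyBdd e fun y => q.eval (a y) := by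
  obtain ⟨r, hr⟩ := ha
  exact ⟨q.comp r, fun y => by simpa using eval_mono q (hr y)⟩

theorem comp {es : S → Data} {b : S → ℕ} (φ : Y → S)
    (h : PolyBdd e fun y => (es (φ y)).size) (hb : PolyBdd es b) : PolyBdd e fun y => b (φ y) := by
  obtain ⟨q, hq⟩ := hb
  exact (eval q h).mono fun y => hq _

end PolyBdd

theorem PolyTime.size (h : PolyTime e f) : PolyBdd e fun y => (f y).size := by
  obtain ⟨p, q, h⟩ := h
  refine ⟨q, fun y => ?_⟩
  obtain ⟨c, h₁, h₂⟩ := h y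
  exact h₁.size_le.trans h₂

namespace PolyTime

theorem of_bdd (p : Prog) {g : Y → ℕ} (hg : PolyBdd e g)
    (h : ∀ y, ∃ c, p.Runs (e y) (f y) c ∧ c ≤ g y) : PolyTime e f := by
  obtain ⟨q, hq⟩ := hg
  refine ⟨p, q, fun y => ?_⟩
  obtain ⟨c, h₁, h₂⟩ := h y
  exact ⟨c, h₁, h₂.trans (hq y)⟩

theorem congr (h : PolyTime e f) (hfg : ∀ y, g y = f y) : PolyTime e g := by
  rwa [show g = f from funext hfg]

theorem id : PolyTime e e :=
  of_bdd .id ((PolyBdd.const 1).add .self) fun _ => ⟨_, .id _, le_rfl⟩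

theorem nil : PolyTime e fun _ => .nil :=
  of_bdd .nil ((PolyBdd.const 1).add .self) fun _ => ⟨_, .nil _, le_rfl⟩

/-- Substitution: an expression in the variables `S` is evaluated at the values `φ y`. -/
theorem comp {es gs : S → Data} (φ : Y → S) (h : PolyTime e fun y => es (φ y))
    (h' : PolyTime es gs) : PolyTime e fun y => gs (φ y) := by
  have hs := h.size
  obtain ⟨p, q, h⟩ := h
  obtain ⟨p', q', h'⟩ := h'
  refine of_bdd (.seq p p') ((((PolyBdd.const 1).add .self).add (.eval q .self)).add
    (.eval q' hs)) fun y => ?_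
  obtain ⟨c, h₁, h₂⟩ := h y
  obtain ⟨c', h₃, h₄⟩ := h' (φ y)
  exact ⟨_, .seq h₁ h₃, by gcongr⟩

theorem fst (h : PolyTime e f) : PolyTime e fun y => (f y).fst :=
  comp (es := fun x => x) f h
    (of_bdd .fst ((PolyBdd.const 1).add .self) fun _ => ⟨_, .fst _, le_rfl⟩)

theorem snd (h : PolyTime e f) : PolyTime e fun y => (f y).snd :=
  comp (es := fun x => x) f h
    (of_bdd .snd ((PolyBdd.const 1).add .self) fun _ => ⟨_, .snd _, le_rfl⟩)

theorem node (hf : PolyTime e f) (hg : PolyTime e g) : PolyTime e fun y => .node (f y) (g y) := by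
  obtain ⟨p, q, h⟩ := hf
  obtain ⟨p', q', h'⟩ := hg
  refine of_bdd (.pair p p') ((((PolyBdd.const 1).add .self).add (.eval q .self)).add
    (.eval q' .self)) fun y => ?_
  obtain ⟨c, h₁, h₂⟩ := h y
  obtain ⟨c', h₃, h₄⟩ := h' y
  exact ⟨_, .pair h₁ h₃, by gcongr⟩

theorem const (x : Data) : PolyTime e fun _ => x := by
  induction x with
  | nil => exact nil
  | node l r hl hr => exact node hl hr

/-- A case distinction; each branch only has to be computed on its own domain. -/
theorem cases {b : Y → Bool} (hb : PolyTime e fun y => Data.ofBool (b y))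
    (hf : PolyTime (fun y : {y // b y = true} => e y) fun y => f y)
    (hg : PolyTime (fun y : {y // b y = false} => e y) fun y => f y) : PolyTime e f := by
  obtain ⟨p, q, h⟩ := hb
  obtain ⟨p₁, q₁, h₁⟩ := hf
  obtain ⟨p₂, q₂, h₂⟩ := hg
  refine of_bdd (.ite p p₁ p₂) ((((PolyBdd.const 1).add .self).add (.eval q .self)).add
    ((PolyBdd.eval q₁ .self).add (.eval q₂ .self))) fun y => ?_
  obtain ⟨c, h₃, h₄⟩ := h y
  cases hy : b y with
  | true =>
    simp only [hy] at h₃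
    obtain ⟨c₁, h₅, h₆⟩ := h₁ ⟨y, hy⟩
    exact ⟨_, .ite_node h₃ h₅, by dsimp only at h₆ ⊢; omega⟩
  | false =>
    simp only [hy] at h₃
    obtain ⟨c₁, h₅, h₆⟩ := h₂ ⟨y, hy⟩
    exact ⟨_, .ite_nil h₃ h₅, by dsimp only at h₆ ⊢; omega⟩

theorem restrict {p : Y → Prop} (h : PolyTime e f) :
    PolyTime (fun y : {y // p y} => e y) fun y => f y := by
  obtain ⟨p, q, h⟩ := h
  exact ⟨p, q, fun y => h y⟩

/-- Iteration of `step` while `cond` holds. The measure `μ` bounds the number of iterations, and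
the potential `G` bounds the measure and the size of all intermediate states. -/
theorem exists_while_loop {es : S → Data} {cond : S → Bool} {step fin : S → S}
    (hc : PolyTime es fun s => Data.ofBool (cond s))
    (hs : PolyTime (fun s : {s // cond s = true} => es s) fun s => es (step s))
    (hfin : ∀ s, fin s = if cond s then fin (step s) else s)
    {μ G : S → ℕ} (hsize : ∀ s, (es s).size ≤ G s) (hμG : ∀ s, μ s ≤ G s)
    (hμ : ∀ s, cond s = true → μ (step s) < μ s) (hGs : ∀ s, cond s = true → G (step s) ≤ G s) :
    ∃ (p : Prog) (q : Polynomial ℕ), ∀ s, ∃ c, p.Runs (es s) (es (fin s)) c ∧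
      c ≤ q.eval (G s) := by
  obtain ⟨p, q, h⟩ := hc
  obtain ⟨p', q', h'⟩ := hs
  have key : ∀ (k N : ℕ) (s : S), G s ≤ N → μ s ≤ k →
      ∃ c, (Prog.loop p p').Runs (es s) (es (fin s)) c ∧
        c ≤ (k + 1) * (1 + N + q.eval N + q'.eval N) := by
    intro k
    induction k with
    | zero =>
      intro N s hN hk
      have hf : cond s = false := by
        by_contra h
        have := hμ s (by simpa using h)
        omega
      obtain ⟨c, h₁, h₂⟩ := h s
      simp only [hf] at h₁
      rw [hfin, hf]
      refine ⟨_, .loop_nil h₁, ?_⟩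
      have := eval_mono q ((hsize s).trans hN)
      have := (hsize s).trans hN
      omega
    | succ k ih =>
      intro N s hN hk
      obtain ⟨c, h₁, h₂⟩ := h s
      have h₃ := eval_mono q ((hsize s).trans hN)
      have h₄ := eval_mono q' ((hsize s).trans hN)
      have h₅ := (hsize s).trans hN
      cases hcs : cond s with
      | false =>
        simp only [hcs] at h₁
        rw [hfin, hcs]
        refine ⟨_, .loop_nil h₁, ?_⟩
        nlinarith
      | true =>
        simp only [hcs] at h₁
        rw [hfin, hcs]
        obtain ⟨c', h₆, h₇⟩ := h' ⟨s, hcs⟩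
        obtain ⟨c'', h₈, h₉⟩ := ih N (step s) ((hGs s hcs).trans hN) (by have := hμ s hcs; omega)
        refine ⟨_, .loop_node h₁ h₆ h₈, ?_⟩
        dsimp only at h₇
        rw [add_mul (k + 1) 1]
        omega
  refine ⟨.loop p p', (.X + 1) * (1 + .X + q + q'), fun s => ?_⟩
  simpa using key (G s) (G s) s le_rfl (hμG s)

theorem while_loop {es : S → Data} {cond : S → Bool} {step fin : S → S}
    (hc : PolyTime es fun s => Data.ofBool (cond s))
    (hs : PolyTime (fun s : {s // cond s = true} => es s) fun s => es (step s))
    (hfin : ∀ s, fin s = if cond s then fin (step s) else s)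
    {μ G : S → ℕ} (hG : PolyBdd es G) (hsize : ∀ s, (es s).size ≤ G s) (hμG : ∀ s, μ s ≤ G s)
    (hμ : ∀ s, cond s = true → μ (step s) < μ s) (hGs : ∀ s, cond s = true → G (step s) ≤ G s) :
    PolyTime es fun s => es (fin s) := by
  obtain ⟨p, q, h⟩ := exists_while_loop hc hs hfin hsize hμG hμ hGs
  exact of_bdd p (.eval q hG) h

end PolyTime

end

/-! ### Encodings -/

/-- Encodings of the elements of a type as data. -/
class Enc (A : Type) where
  enc : A → Data

open TwoWayParikh.Enc (enc)

/-- The encoding is injective. -/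
class EncInj (A : Type) [Enc A] : Prop where
  inj : Function.Injective (enc : A → Data)

/-- Is this not `nil`? -/
def Data.isNode : Data → Bool
  | .nil => false
  | .node _ _ => true

theorem Data.ofList_injective : Function.Injective Data.ofList := by
  intro l l' h
  induction l generalizing l' with
  | nil => cases l' with
    | nil => rfl
    | cons => simp [ofList] at h
  | cons x l ih => cases l' with
    | nil => simp [ofList] at h
    | cons y l' =>
      simp only [ofList, node.injEq] at h
      rw [h.1, ih h.2]

theorem Data.unary_injective : Function.Injective Data.unary := by
  intro a b h
  simpa using congrArg List.length (ofList_injective h)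

instance : Enc Data := ⟨id⟩

instance : Enc Unit := ⟨fun _ => .nil⟩

instance : Enc ℕ := ⟨Data.unary⟩

instance : EncInj ℕ := ⟨Data.unary_injective⟩

instance {n : ℕ} : Enc (Fin n) := ⟨fun i => enc i.val⟩

instance {n : ℕ} : EncInj (Fin n) := ⟨fun _ _ h => Fin.ext (EncInj.inj h)⟩

instance : Enc Bool := ⟨Data.ofBool⟩

instance : EncInj Bool := ⟨fun a b h => by cases a <;> cases b <;> simp_all [enc, Data.ofBool]⟩

instance {A : Type} [Enc A] : Enc (List A) := ⟨fun l => Data.ofList (l.map enc)⟩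

instance {A : Type} [Enc A] [EncInj A] : EncInj (List A) :=
  ⟨fun _ _ h => EncInj.inj.list_map (Data.ofList_injective h)⟩

instance {A B : Type} [Enc A] [Enc B] : Enc (A × B) := ⟨fun p => .node (enc p.1) (enc p.2)⟩

instance {A B : Type} [Enc A] [Enc B] [EncInj A] [EncInj B] : EncInj (A × B) := by
  refine ⟨fun p q h => ?_⟩
  simp only [enc, Data.node.injEq] at h
  exact Prod.ext (EncInj.inj h.1) (EncInj.inj h.2)

instance {A : Type} [Enc A] : Enc (Option A) := ⟨fun o => o.elim .nil fun a => .node .nil (enc a)⟩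

instance {A : Type} [Enc A] [EncInj A] : EncInj (Option A) := by
  refine ⟨fun o o' h => ?_⟩
  cases o <;> cases o' <;> simp_all [enc]
  exact EncInj.inj h

/-- The number of a letter in the list of all letters. -/
def Letter.index {m : ℕ} : Letter (Fin m) → ℕ
  | .lend => 0
  | .rend => 1
  | .sym i => i + 2

instance {m : ℕ} : Enc (Letter (Fin m)) := ⟨fun a => enc a.index⟩

instance {m : ℕ} : EncInj (Letter (Fin m)) := by
  refine ⟨fun a b h => ?_⟩
  have h : a.index = b.index := EncInj.inj h
  cases a <;> cases b <;> simp_all [Letter.index]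
  exact Fin.ext h

/-- Positive and negative part, in unary. -/
instance : Enc ℤ := ⟨fun z => enc (z.toNat, (-z).toNat)⟩

instance {d : ℕ} : Enc (Fin d → ℤ) := ⟨fun v => enc (List.ofFn v)⟩

/-- The variables of `e` and one more variable. -/
abbrev ctx {Y : Type} (e : Y → Data) (A : Y → Type) [∀ y, Enc (A y)] : (Σ y, A y) → Data :=
  fun z => .node (enc z.2) (e z.1)

namespace PolyTime

variable {Y S : Type} {e : Y → Data} {f g : Y → Data} {A B C : Y → Type} [∀ y, Enc (A y)]
  [∀ y, Enc (B y)] [∀ y, Enc (C y)]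

theorem var : PolyTime (ctx e A) fun z => enc z.2 := id.fst

theorem lift (h : PolyTime e f) : PolyTime (ctx e A) fun z => f z.1 :=
  comp (fun z : Σ y, A y => z.1) (e := ctx e A) (id (e := ctx e A)).snd h

theorem prod {a : ∀ y, A y} {b : ∀ y, B y} (ha : PolyTime e fun y => enc (a y))
    (hb : PolyTime e fun y => enc (b y)) : PolyTime e fun y => enc (a y, b y) := ha.node hb

theorem prod_fst {p : ∀ y, A y × B y} (h : PolyTime e fun y => enc (p y)) :
    PolyTime e fun y => enc (p y).1 := h.fst

theorem prod_snd {p : ∀ y, A y × B y} (h : PolyTime e fun y => enc (p y)) :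
    PolyTime e fun y => enc (p y).2 := h.snd

theorem cond {b : Y → Bool} (hb : PolyTime e fun y => enc (b y)) (hf : PolyTime e f)
    (hg : PolyTime e g) : PolyTime e fun y => bif b y then f y else g y :=
  cases (b := b) hb (hf.restrict.congr fun y => by rw [y.2, cond_true])
    (hg.restrict.congr fun y => by rw [y.2, cond_false])

theorem ite {p : Y → Prop} {inst : ∀ y, Decidable (p y)} {a b : ∀ y, A y}
    (hp : PolyTime e fun y => enc (decide (p y))) (ha : PolyTime e fun y => enc (a y))
    (hb : PolyTime e fun y => enc (b y)) : PolyTime e fun y => enc (if p y then a y else b y) :=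
  (cond hp ha hb).congr fun y => by by_cases h : p y <;> simp [h]

theorem iteB {p : Y → Bool} {inst : ∀ y, Decidable (p y = true)} {a b : ∀ y, A y}
    (hp : PolyTime e fun y => enc (p y)) (ha : PolyTime e fun y => enc (a y))
    (hb : PolyTime e fun y => enc (b y)) :
    PolyTime e fun y => enc (if p y = true then a y else b y) :=
  (cond hp ha hb).congr fun y => by by_cases h : p y = Bool.true <;> simp [h]

theorem true : PolyTime e fun _ => enc true := const _

theorem false : PolyTime e fun _ => enc false := const _

theorem not {b : Y → Bool} (hb : PolyTime e fun y => enc (b y)) : PolyTime e fun y => enc (!b y) :=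
  (cond hb false true).congr fun y => by cases b y <;> rfl

theorem and {a b : Y → Bool} (ha : PolyTime e fun y => enc (a y))
    (hb : PolyTime e fun y => enc (b y)) : PolyTime e fun y => enc (a y && b y) :=
  (cond ha hb false).congr fun y => by cases a y <;> rfl

theorem or {a b : Y → Bool} (ha : PolyTime e fun y => enc (a y))
    (hb : PolyTime e fun y => enc (b y)) : PolyTime e fun y => enc (a y || b y) :=
  (cond ha true hb).congr fun y => by cases a y <;> rfl

theorem beq {a b : Y → Bool} (ha : PolyTime e fun y => enc (a y))
    (hb : PolyTime e fun y => enc (b y)) : PolyTime e fun y => enc (a y == b y) :=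
  (cond ha hb hb.not).congr fun y => by cases a y <;> cases b y <;> rfl

theorem none : PolyTime e fun y => enc (none : Option (A y)) := nil

theorem some {a : ∀ y, A y} (ha : PolyTime e fun y => enc (a y)) :
    PolyTime e fun y => enc (some (a y)) := nil.node ha

theorem isNode {f : Y → Data} (hf : PolyTime e f) :
    PolyTime e fun y => Data.ofBool (f y).isNode :=
  comp (es := fun x => x) (gs := fun x => Data.ofBool x.isNode) f hf <|
    of_bdd (.ite .id (.pair .nil .nil) .nil) (g := fun x => 6 + 6 * x.size)
      ((PolyBdd.const 6).add ((PolyBdd.const 6).mul .self)) fun x => by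
    cases x with
    | nil => exact ⟨_, .ite_nil (.id _) (.nil .nil), by simp [Data.size]⟩
    | node l r =>
      exact ⟨_, .ite_node (.id _) (.pair (.nil (.node l r)) (.nil (.node l r))), by
        simp only [Data.size]; omega⟩

theorem isSome {o : ∀ y, Option (A y)} (ho : PolyTime e fun y => enc (o y)) :
    PolyTime e fun y => enc (o y).isSome :=
  ho.isNode.congr fun y => by cases o y <;> rfl

theorem elimData {o : ∀ y, Option (A y)} {n : Y → Data} {s : ∀ y, A y → Data}
    (ho : PolyTime e fun y => enc (o y)) (hn : PolyTime e n)
    (hs : PolyTime (ctx e A) fun z => s z.1 z.2) :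
    PolyTime e fun y => (o y).elim (n y) (s y) := by
  refine cases ho.isSome ?_ ?_
  · have := comp (e := fun y : {y // (o y).isSome = Bool.true} => e y) (es := ctx e A)
      (fun y => (⟨y, (o y).get y.2⟩ : Σ y, A y)) (((ho.restrict).snd.node id).congr fun y => ?_) hs
    · refine this.congr fun y => ?_
      obtain ⟨y, hy⟩ := y
      obtain ⟨a, ha⟩ := Option.isSome_iff_exists.1 hy
      simp [ha]
    · obtain ⟨y, hy⟩ := y
      obtain ⟨a, ha⟩ := Option.isSome_iff_exists.1 hy
      simp [ha, enc, Data.snd]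
  · refine hn.restrict.congr fun y => ?_
    obtain ⟨y, hy⟩ := y
    rw [Option.isSome_eq_false_iff, Option.isNone_iff_eq_none] at hy
    simp [hy]

theorem elim {o : ∀ y, Option (A y)} {n : ∀ y, B y} {s : ∀ y, A y → B y}
    (ho : PolyTime e fun y => enc (o y)) (hn : PolyTime e fun y => enc (n y))
    (hs : PolyTime (ctx e A) fun z => enc (s z.1 z.2)) :
    PolyTime e fun y => enc ((o y).elim (n y) (s y)) :=
  (elimData (s := fun y a => enc (s y a)) ho hn hs).congr fun y => by cases o y <;> rfl

theorem option_bind {o : ∀ y, Option (A y)} {s : ∀ y, A y → Option (B y)}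
    (ho : PolyTime e fun y => enc (o y)) (hs : PolyTime (ctx e A) fun z => enc (s z.1 z.2)) :
    PolyTime e fun y => enc ((o y).bind (s y)) :=
  (elim (s := s) ho none hs).congr fun y => by cases o y <;> rfl

theorem option_map {o : ∀ y, Option (A y)} {s : ∀ y, A y → B y}
    (ho : PolyTime e fun y => enc (o y)) (hs : PolyTime (ctx e A) fun z => enc (s z.1 z.2)) :
    PolyTime e fun y => enc ((o y).map (s y)) :=
  (elim (s := fun y a => Option.some (s y a)) ho none hs.some).congr fun y => by cases o y <;> rfl

theorem list_nil : PolyTime e fun y => enc ([] : List (A y)) := nil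

theorem cons {a : ∀ y, A y} {l : ∀ y, List (A y)} (ha : PolyTime e fun y => enc (a y))
    (hl : PolyTime e fun y => enc (l y)) : PolyTime e fun y => enc (a y :: l y) := ha.node hl

theorem tail {l : ∀ y, List (A y)} (hl : PolyTime e fun y => enc (l y)) :
    PolyTime e fun y => enc (l y).tail :=
  hl.snd.congr fun y => by cases l y <;> rfl

theorem isEmpty {l : ∀ y, List (A y)} (hl : PolyTime e fun y => enc (l y)) :
    PolyTime e fun y => enc (l y).isEmpty :=
  hl.isNode.not.congr fun y => by cases l y <;> rfl

theorem head? {l : ∀ y, List (A y)} (hl : PolyTime e fun y => enc (l y)) :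
    PolyTime e fun y => enc (l y).head? :=
  (cond hl.isEmpty nil (nil.node hl.fst)).congr fun y => by cases l y <;> rfl

end PolyTime

/-! ### Programs for lists -/

section size

variable {A B : Type} [Enc A] [Enc B]

theorem Data.one_le_size (x : Data) : 1 ≤ x.size := by cases x <;> simp [size]

theorem size_enc_nil : (enc ([] : List A)).size = 1 := rfl

theorem size_enc_cons (a : A) (l : List A) :
    (enc (a :: l)).size = (enc a).size + (enc l).size + 1 := rfl

theorem size_enc_prod (p : A × B) : (enc p).size = (enc p.1).size + (enc p.2).size + 1 := rfl

theorem size_enc_append (l l' : List A) :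
    (enc (l ++ l')).size + 1 = (enc l).size + (enc l').size := by
  induction l with
  | nil => simp [size_enc_nil]; omega
  | cons a l ih => simp only [List.cons_append, size_enc_cons]; omega

theorem size_enc_reverse (l : List A) : (enc l.reverse).size = (enc l).size := by
  induction l with
  | nil => rfl
  | cons a l ih =>
    have := size_enc_append l.reverse [a]
    simp only [List.reverse_cons, size_enc_cons, size_enc_nil] at this ⊢
    omega

theorem length_lt_size (l : List A) : l.length < (enc l).size := by
  induction l with
  | nil => simp [size_enc_nil]
  | cons a l ih => simp only [List.length_cons, size_enc_cons]; omega

theorem size_lt_of_mem {a : A} {l : List A} (h : a ∈ l) : (enc a).size < (enc l).size := by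
  induction l with
  | nil => simp at h
  | cons b l ih =>
    rw [size_enc_cons]
    rcases List.mem_cons.1 h with rfl | h
    · omega
    · have := ih h; omega

theorem size_enc_le {l : List A} {k : ℕ} (h : ∀ a ∈ l, (enc a).size ≤ k) :
    (enc l).size ≤ l.length * (k + 1) + 1 := by
  induction l with
  | nil => simp [size_enc_nil]
  | cons a l ih =>
    have h₁ := h a (by simp)
    have h₂ := ih fun b hb => h b (by simp [hb])
    rw [size_enc_cons, List.length_cons, add_mul]
    omega

theorem size_enc_nat (n : ℕ) : (enc n).size = 2 * n + 1 := by
  induction n with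
  | zero => rfl
  | succ n ih =>
    have : (enc (n + 1)).size = 1 + (enc n).size + 1 := rfl
    omega

end size

namespace PolyTime

variable {Y : Type} {e : Y → Data} {f g : Y → Data} {A B C : Y → Type} [∀ y, Enc (A y)]
  [∀ y, Enc (B y)] [∀ y, Enc (C y)]

/-- Folds, provided that all intermediate results are of polynomial size. -/
theorem foldl {l : ∀ y, List (A y)} {b : ∀ y, B y} {f : ∀ y, B y → A y → B y} {g : Y → ℕ}
    (hl : PolyTime e fun y => enc (l y)) (hb : PolyTime e fun y => enc (b y))
    (hf : PolyTime (ctx (ctx e B) fun z => A z.1) fun z => enc (f z.1.1 z.1.2 z.2))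
    (hg : PolyBdd e g) (hfg : ∀ y l₁, l₁ <+: l y → (enc (l₁.foldl (f y) (b y))).size ≤ g y) :
    PolyTime e fun y => enc ((l y).foldl (f y) (b y)) := by
  let S := Σ y, {p : List (A y) × List (A y) // p.1 ++ p.2 = l y}
  let es : S → Data := fun s =>
    .node (enc s.2.1.2) (.node (enc (s.2.1.1.foldl (f s.1) (b s.1))) (e s.1))
  let step : S → S := fun s => match s with
    | ⟨y, ⟨(d, []), h⟩⟩ => ⟨y, ⟨(d, []), h⟩⟩
    | ⟨y, ⟨(d, a :: r), h⟩⟩ => ⟨y, ⟨(d ++ [a], r), by simpa using h⟩⟩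
  have hid : PolyTime es es := id
  have he : PolyTime es fun s => e s.1 := hid.snd.snd
  have hG : PolyBdd es fun s => (enc (l s.1)).size + (g s.1 + (e s.1).size + 2) :=
    (PolyBdd.comp (fun s : S => s.1) he.size hl.size).add
      (((PolyBdd.comp (fun s : S => s.1) he.size hg).add he.size).add (.const 2))
  have hr : PolyTime es fun s => enc s.2.1.2 := hid.fst
  have key : PolyTime es fun s => es ⟨s.1, ⟨(l s.1, []), by simp⟩⟩ := by
    refine while_loop (cond := fun s => !s.2.1.2.isEmpty) (step := step)
      (μ := fun s => s.2.1.2.length) hr.isEmpty.not ?_ ?_ hG ?_ ?_ ?_ ?_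
    · have h₁ : PolyTime (fun s : {s : S // (!s.2.1.2.isEmpty) = Bool.true} => es s)
          fun s => .node (es s).fst.fst (es s).snd := hid.restrict.fst.fst.node hid.restrict.snd
      have hne : ∀ s : {s : S // (!s.2.1.2.isEmpty) = Bool.true}, s.1.2.1.2 ≠ [] := by
        rintro ⟨s, hs⟩ h
        simp only [Bool.not_eq_true', List.isEmpty_eq_false_iff] at hs
        exact hs h
      have h₂ := comp (es := ctx (ctx e B) fun z => A z.1)
        (fun s : {s : S // (!s.2.1.2.isEmpty) = Bool.true} =>
          (⟨⟨s.1.1, s.1.2.1.1.foldl (f s.1.1) (b s.1.1)⟩, s.1.2.1.2.head (hne s)⟩ :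
            Σ z : (Σ y, B y), A z.1)) (h₁.congr ?_) hf
      · refine (hid.restrict.fst.snd.node (h₂.node he.restrict)).congr ?_
        rintro ⟨⟨y, ⟨⟨d, _ | ⟨a, r⟩⟩, h⟩⟩, hs⟩
        · simp at hs
        · simp [es, step, enc, Data.ofList, Data.fst, Data.snd]
      · rintro ⟨⟨y, ⟨⟨d, _ | ⟨a, r⟩⟩, h⟩⟩, hs⟩
        · simp at hs
        · simp [es, enc, Data.ofList, Data.fst, Data.snd]
    · rintro ⟨y, ⟨⟨d, _ | ⟨a, r⟩⟩, h⟩⟩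
      · simp only [List.append_nil] at h
        subst h
        simp
      · simp [step]
    · rintro ⟨y, ⟨⟨d, r⟩, h⟩⟩
      simp only at h
      have h₁ := hfg y d ⟨r, h⟩
      have h₂ := size_enc_append d r
      rw [h] at h₂
      have := (enc d).one_le_size
      simp only [es, Data.size]
      omega
    · rintro ⟨y, ⟨⟨d, r⟩, h⟩⟩
      simp only at h
      have h₁ := length_lt_size r
      have h₂ := size_enc_append d r
      rw [h] at h₂
      have := (enc d).one_le_size
      simp only
      omega
    · rintro ⟨y, ⟨⟨d, _ | ⟨a, r⟩⟩, h⟩⟩ hs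
      · simp at hs
      · simp [step]
    · rintro ⟨y, ⟨⟨d, _ | ⟨a, r⟩⟩, h⟩⟩ hs
      · simp at hs
      · simp [step]
  have := comp (es := es) (fun y => (⟨y, ⟨([], l y), rfl⟩⟩ : S)) (e := e)
    (hl.node (hb.node id)) key.snd.fst
  exact this

theorem reverse {l : ∀ y, List (A y)} (hl : PolyTime e fun y => enc (l y)) :
    PolyTime e fun y => enc (l y).reverse := by
  have hf : ∀ {A : Type} (l l' : List A), l.foldl (fun r a => a :: r) l' = l.reverse ++ l' := by
    intro A l
    induction l with
    | nil => simp
    | cons a l ih => simp [ih]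
  refine (foldl (B := fun y => List (A y)) (b := fun _ => []) (f := fun _ r a => a :: r) hl
    list_nil (var.cons var.lift) hl.size ?_).congr fun y => by rw [hf]; simp
  rintro y l₁ ⟨l₂, h⟩
  have := size_enc_append l₁ l₂
  have := (enc l₂).one_le_size
  rw [hf, List.append_nil, size_enc_reverse, ← h]
  omega

theorem map {l : ∀ y, List (A y)} {f : ∀ y, A y → B y} (hl : PolyTime e fun y => enc (l y))
    (hf : PolyTime (ctx e A) fun z => enc (f z.1 z.2)) :
    PolyTime e fun y => enc ((l y).map (f y)) := by
  have hr : ∀ {A B : Type} (f : A → B) (l : List A) l',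
      l.foldl (fun r a => f a :: r) l' = (l.map f).reverse ++ l' := by
    intro A B f l
    induction l with
    | nil => simp
    | cons a l ih => simp [ih]
  obtain ⟨q, hq⟩ := hf.size
  refine (reverse (foldl (B := fun y => List (B y)) (b := fun _ => [])
    (f := fun y r a => f y a :: r)
    (g := fun y => (enc (l y)).size * (q.eval ((enc (l y)).size + (e y).size + 1) + 1) + 1)
    hl list_nil (.cons ?_ var.lift) ?_ ?_)).congr fun y => by rw [hr]; simp
  · exact comp (e := ctx (ctx e fun y => List (B y)) fun z => A z.1) (es := ctx e A)
      (fun z => (⟨z.1.1, z.2⟩ : Σ y, A y)) (id.fst.node id.snd.snd) hf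
  · exact (hl.size.mul (((hl.size.add .self).add (.const 1)).eval q |>.add
      (.const 1))).add (.const 1)
  · rintro y l₁ ⟨l₂, h⟩
    rw [hr, List.append_nil, size_enc_reverse]
    have hlen := length_lt_size (l y)
    have : l₁.length ≤ (l y).length := by rw [← h]; simp
    refine (size_enc_le (k := q.eval ((enc (l y)).size + (e y).size + 1)) ?_).trans ?_
    · intro b hb
      obtain ⟨a, ha, rfl⟩ := List.mem_map.1 hb
      refine (hq ⟨y, a⟩).trans (eval_mono q ?_)
      have := size_lt_of_mem (a := a) (l := l y) (by rw [← h]; simp [ha])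
      simp only [Data.size]
      omega
    · rw [List.length_map]
      gcongr
      omega

theorem append {l l' : ∀ y, List (A y)} (hl : PolyTime e fun y => enc (l y))
    (hl' : PolyTime e fun y => enc (l' y)) : PolyTime e fun y => enc (l y ++ l' y) := by
  have hf : ∀ {A : Type} (l l' : List A), l.foldl (fun r a => a :: r) l' = l.reverse ++ l' := by
    intro A l
    induction l with
    | nil => simp
    | cons a l ih => simp [ih]
  refine (foldl (B := fun y => List (A y)) (f := fun _ r a => a :: r) hl.reverse hl'
    (var.cons var.lift) (hl.size.add hl'.size) ?_).congr fun y => by rw [hf]; simp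
  rintro y l₁ ⟨l₂, h⟩
  have h₁ := size_enc_append l₁ l₂
  have := (enc l₂).one_le_size
  have := size_enc_append l₁.reverse (l' y)
  rw [h, size_enc_reverse] at h₁
  rw [size_enc_reverse] at this
  rw [hf]
  omega

theorem size_enc_flatten {A : Type} [Enc A] (L : List (List A)) :
    (enc L.flatten).size ≤ (enc L).size := by
  induction L with
  | nil => exact le_rfl
  | cons l L ih =>
    have := size_enc_append l L.flatten
    rw [List.flatten_cons, size_enc_cons]
    omega

theorem flatten {L : ∀ y, List (List (A y))} (hL : PolyTime e fun y => enc (L y)) :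
    PolyTime e fun y => enc (L y).flatten := by
  have hf : ∀ {A : Type} (L : List (List A)) l', L.foldl (fun r l => r ++ l) l' =
      l' ++ L.flatten := by
    intro A L
    induction L with
    | nil => simp
    | cons a l ih => simp [ih]
  refine (foldl (B := fun y => List (A y)) (b := fun _ => []) (f := fun _ r l => r ++ l) hL
    list_nil (var.lift.append var) hL.size ?_).congr fun y => by rw [hf]; simp
  rintro y l₁ ⟨l₂, h⟩
  have h₁ := size_enc_append l₁ l₂
  have := (enc l₂).one_le_size
  rw [h] at h₁
  rw [hf, List.nil_append]
  refine (size_enc_flatten _).trans ?_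
  omega

theorem flatMap {l : ∀ y, List (A y)} {f : ∀ y, A y → List (B y)}
    (hl : PolyTime e fun y => enc (l y)) (hf : PolyTime (ctx e A) fun z => enc (f z.1 z.2)) :
    PolyTime e fun y => enc ((l y).flatMap (f y)) := (map hl hf).flatten

theorem filter {l : ∀ y, List (A y)} {p : ∀ y, A y → Bool}
    (hl : PolyTime e fun y => enc (l y)) (hp : PolyTime (ctx e A) fun z => enc (p z.1 z.2)) :
    PolyTime e fun y => enc ((l y).filter (p y)) := by
  refine (flatMap (f := fun y a => if p y a = Bool.true then [a] else []) hl
    (iteB hp (var.cons list_nil) list_nil)).congr fun y => ?_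
  congr 1
  induction l y with
  | nil => rfl
  | cons a l ih =>
    rw [List.filter_cons, List.flatMap_cons, ← ih]
    split_ifs <;> rfl

theorem any {l : ∀ y, List (A y)} {p : ∀ y, A y → Bool} (hl : PolyTime e fun y => enc (l y))
    (hp : PolyTime (ctx e A) fun z => enc (p z.1 z.2)) :
    PolyTime e fun y => enc ((l y).any (p y)) := by
  refine (filter hl hp).isEmpty.not.congr fun y => ?_
  congr 1
  rw [Bool.eq_iff_iff]
  simp

theorem all {l : ∀ y, List (A y)} {p : ∀ y, A y → Bool} (hl : PolyTime e fun y => enc (l y))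
    (hp : PolyTime (ctx e A) fun z => enc (p z.1 z.2)) :
    PolyTime e fun y => enc ((l y).all (p y)) := by
  refine (any (p := fun y a => !p y a) hl hp.not).not.congr fun y => ?_
  rw [List.not_any_eq_all_not]
  simp

theorem product {l : ∀ y, List (A y)} {l' : ∀ y, List (B y)}
    (hl : PolyTime e fun y => enc (l y)) (hl' : PolyTime e fun y => enc (l' y)) :
    PolyTime e fun y => enc (l y ×ˢ l' y) :=
  flatMap (f := fun y a => (l' y).map fun b => (a, b)) hl (map hl'.lift (var.lift.prod var))

/-! ### Programs for numbers and integers -/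

theorem enc_replicate (n : ℕ) : enc (List.replicate n ()) = enc n := by
  simp [enc, Data.unary]

theorem replicate {n : Y → ℕ} (hn : PolyTime e fun y => enc (n y)) :
    PolyTime e fun y => enc (List.replicate (n y) ()) := hn.congr fun _ => enc_replicate _

theorem of_replicate {n : Y → ℕ} (hn : PolyTime e fun y => enc (List.replicate (n y) ())) :
    PolyTime e fun y => enc (n y) := hn.congr fun _ => (enc_replicate _).symm

theorem length {l : ∀ y, List (A y)} (hl : PolyTime e fun y => enc (l y)) :
    PolyTime e fun y => enc (l y).length :=
  of_replicate ((map (B := fun _ => Unit) (f := fun _ _ => ()) hl nil).congr fun y => by simp)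

theorem succ {n : Y → ℕ} (hn : PolyTime e fun y => enc (n y)) :
    PolyTime e fun y => enc (n y + 1) := nil.node hn

theorem drop {l : ∀ y, List (A y)} {n : Y → ℕ} (hl : PolyTime e fun y => enc (l y))
    (hn : PolyTime e fun y => enc (n y)) : PolyTime e fun y => enc ((l y).drop (n y)) := by
  have hf : ∀ {A B : Type} (u : List B) (l : List A), u.foldl (fun r _ => r.tail) l =
      l.drop u.length := by
    intro A B u
    induction u with
    | nil => simp
    | cons a u ih => simp [ih]
  refine (foldl (B := fun y => List (A y)) (f := fun _ r _ => r.tail) hn.replicate hl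
    var.lift.tail hl.size ?_).congr fun y => by rw [hf]; simp
  rintro y l₁ -
  have h₁ := size_enc_append ((l y).take l₁.length) ((l y).drop l₁.length)
  have h₂ := (enc ((l y).take l₁.length)).one_le_size
  rw [List.take_append_drop] at h₁
  rw [hf]
  omega

theorem getElem? {l : ∀ y, List (A y)} {n : Y → ℕ} (hl : PolyTime e fun y => enc (l y))
    (hn : PolyTime e fun y => enc (n y)) : PolyTime e fun y => enc (l y)[n y]? :=
  (hl.drop hn).head?.congr fun y => by rw [List.head?_drop]

theorem sub {a b : Y → ℕ} (ha : PolyTime e fun y => enc (a y))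
    (hb : PolyTime e fun y => enc (b y)) : PolyTime e fun y => enc (a y - b y) :=
  of_replicate ((ha.replicate.drop hb).congr fun y => by rw [List.drop_replicate])

theorem nat_sum {l : Y → List ℕ} (hl : PolyTime e fun y => enc (l y)) :
    PolyTime e fun y => enc (l y).sum := by
  refine of_replicate ((flatMap (f := fun _ n => List.replicate n ()) hl
    (replicate var)).congr fun y => ?_)
  congr 1
  induction l y with
  | nil => rfl
  | cons a l ih => rw [List.sum_cons, List.replicate_add, ih, List.flatMap_cons]

theorem finRange {n : Y → ℕ} (hn : PolyTime e fun y => enc (n y)) :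
    PolyTime e fun y => enc (List.finRange (n y)) := by
  have hf : ∀ (u : List Unit) (k : ℕ) (l : List ℕ), u.foldl (fun (s : List ℕ × ℕ) _ =>
      (s.1 ++ [s.2], s.2 + 1)) (l, k) = (l ++ List.range' k u.length, k + u.length) := by
    intro u
    induction u with
    | nil => simp
    | cons a u ih =>
      intro k l
      rw [List.foldl_cons, ih]
      simp [List.range'_succ]
      omega
  refine (foldl (B := fun _ => List ℕ × ℕ) (b := fun _ => ([], 0)) (f := fun _ s _ =>
    (s.1 ++ [s.2], s.2 + 1)) (g := fun y => (n y * (2 * n y + 1 + 1) + 1) + (2 * n y + 1) + 1)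
    hn.replicate (const _) ?_ ?_ ?_).fst.congr fun y => ?_
  · exact (append (prod_fst var.lift) ((prod_snd var.lift).cons list_nil)).prod
      (prod_snd var.lift).succ
  · have h₁ : PolyBdd e n := hn.size.mono fun y => by rw [size_enc_nat]; omega
    have h₂ : PolyBdd e fun y => 2 * n y + 1 := ((PolyBdd.const 2).mul h₁).add (.const 1)
    exact (((h₁.mul (h₂.add (.const 1))).add (.const 1)).add h₂).add (.const 1)
  · rintro y l₁ ⟨l₂, h⟩
    have hlen : l₁.length ≤ n y := by
      have := congrArg List.length h
      simp only [List.length_append, List.length_replicate] at this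
      omega
    rw [hf, size_enc_prod, List.nil_append, size_enc_nat]
    have : (enc (List.range' 0 l₁.length)).size ≤ n y * (2 * n y + 1 + 1) + 1 := by
      refine (size_enc_le (k := 2 * n y + 1) ?_).trans ?_
      · intro i hi
        rw [List.mem_range'_1] at hi
        rw [size_enc_nat]
        omega
      · rw [List.length_range']
        gcongr
    dsimp only
    omega
  · rw [hf]
    have : (List.finRange (n y)).map (fun i => enc i) = (List.range (n y)).map enc := by
      rw [← List.map_coe_finRange_eq_range, List.map_map]
      rfl
    change Data.ofList _ = Data.ofList _
    rw [this]
    simp [List.range_eq_range']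

theorem fin_val {n : Y → ℕ} {i : ∀ y, Fin (n y)} (hi : PolyTime e fun y => enc (i y)) :
    PolyTime e fun y => enc (i y).val := hi

theorem toNat {z : Y → ℤ} (hz : PolyTime e fun y => enc (z y)) :
    PolyTime e fun y => enc (z y).toNat := hz.fst

theorem toNat_neg {z : Y → ℤ} (hz : PolyTime e fun y => enc (z y)) :
    PolyTime e fun y => enc (-z y).toNat := hz.snd

theorem int_neg {z : Y → ℤ} (hz : PolyTime e fun y => enc (z y)) :
    PolyTime e fun y => enc (-z y) :=
  (hz.toNat_neg.node hz.toNat).congr fun y => by simp [enc]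

theorem int_sum {l : Y → List ℤ} (hl : PolyTime e fun y => enc (l y)) :
    PolyTime e fun y => enc (l y).sum := by
  have hp : PolyTime e fun y => enc ((l y).map Int.toNat).sum :=
    nat_sum (map (B := fun _ => ℕ) (f := fun _ z => z.toNat) hl var.toNat)
  have hn : PolyTime e fun y => enc ((l y).map fun z => (-z).toNat).sum :=
    nat_sum (map (B := fun _ => ℕ) (f := fun _ z => (-z).toNat) hl var.toNat_neg)
  refine ((hp.sub hn).node (hn.sub hp)).congr fun y => ?_
  have : (l y).sum = (((l y).map Int.toNat).sum : ℤ) - ((l y).map fun z => (-z).toNat).sum := by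
    induction l y with
    | nil => rfl
    | cons a l ih =>
      simp only [List.sum_cons, List.map_cons, Nat.cast_add, ih]
      omega
  have h₁ : (l y).sum.toNat = ((l y).map Int.toNat).sum - ((l y).map fun z => (-z).toNat).sum := by
    omega
  have h₂ : (-(l y).sum).toNat =
      ((l y).map fun z => (-z).toNat).sum - ((l y).map Int.toNat).sum := by omega
  rw [← h₁, ← h₂]
  rfl

theorem int_add {z w : Y → ℤ} (hz : PolyTime e fun y => enc (z y))
    (hw : PolyTime e fun y => enc (w y)) : PolyTime e fun y => enc (z y + w y) :=
  (int_sum (hz.cons (hw.cons list_nil))).congr fun y => by simp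

variable {d : Y → ℕ}

theorem ofFn {v : ∀ y, Fin (d y) → ℤ} (hd : PolyTime e fun y => enc (d y))
    (hv : PolyTime (ctx e fun y => Fin (d y)) fun z => enc (v z.1 z.2)) :
    PolyTime e fun y => enc (v y) :=
  (map (B := fun _ => ℤ) (f := v) hd.finRange hv).congr fun y => by
    change enc (List.ofFn (v y)) = _
    rw [List.ofFn_eq_map]

theorem get {l : ∀ y, List (A y)} {n : Y → ℕ} {a : ∀ y, A y} (hl : PolyTime e fun y => enc (l y))
    (hn : PolyTime e fun y => enc (n y)) (ha : ∀ y, (l y)[n y]? = .some (a y)) :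
    PolyTime e fun y => enc (a y) :=
  (getElem? hl hn).snd.congr fun y => by rw [ha]; rfl

theorem app {v : ∀ y, Fin (d y) → ℤ} {i : ∀ y, Fin (d y)} (hv : PolyTime e fun y => enc (v y))
    (hi : PolyTime e fun y => enc (i y)) : PolyTime e fun y => enc (v y (i y)) :=
  get (A := fun _ => ℤ) (l := fun y => List.ofFn (v y)) hv hi.fin_val fun y => by simp

theorem vec_zero (hd : PolyTime e fun y => enc (d y)) :
    PolyTime e fun y => enc (0 : Fin (d y) → ℤ) := ofFn hd (const (enc (0 : ℤ)))

theorem vec_neg {v : ∀ y, Fin (d y) → ℤ} (hd : PolyTime e fun y => enc (d y))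
    (hv : PolyTime e fun y => enc (v y)) : PolyTime e fun y => enc (-v y) :=
  ofFn hd (app hv.lift var).int_neg

theorem vec_add {v w : ∀ y, Fin (d y) → ℤ} (hd : PolyTime e fun y => enc (d y))
    (hv : PolyTime e fun y => enc (v y)) (hw : PolyTime e fun y => enc (w y)) :
    PolyTime e fun y => enc (v y + w y) :=
  ofFn hd (int_add (app hv.lift var) (app hw.lift var))

theorem vec_sum {l : ∀ y, List (Fin (d y) → ℤ)} (hd : PolyTime e fun y => enc (d y))
    (hl : PolyTime e fun y => enc (l y)) : PolyTime e fun y => enc (l y).sum := by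
  have := ofFn (v := fun y i => ((l y).map fun v => v i).sum) hd
    (int_sum (map (A := fun z : Σ y, Fin (d y) => Fin (d z.1) → ℤ) (B := fun _ => ℤ)
      (f := fun z v => v z.2) hl.lift (app var var.lift)))
  refine this.congr fun y => ?_
  congr 1
  funext i
  rw [Pi.list_sum_apply]

end PolyTime

/-! ### Programs for trees: size and equality -/

theorem PolyBdd.lift {Y : Type} {e : Y → Data} {A : Y → Type} [∀ y, Enc (A y)] {g : Y → ℕ}
    (h : PolyBdd e g) : PolyBdd (ctx e A) fun z => g z.1 :=
  PolyBdd.comp (fun z : Σ y, A y => z.1) (e := ctx e A)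
    (PolyTime.id (e := ctx e A)).snd.size h

namespace PolyTime

variable {Y : Type} {e : Y → Data}

theorem data_size {f : Y → Data} (hf : PolyTime e f) : PolyTime e fun y => enc (f y).size := by
  -- The worklist holds the subtrees that still have to be counted.
  let es : List Data × ℕ → Data := enc
  let step : List Data × ℕ → List Data × ℕ := fun s => match s with
    | ([], n) => ([], n)
    | (.nil :: w, n) => (w, n + 1)
    | (.node l r :: w, n) => (l :: r :: w, n + 1)
  let total : List Data → ℕ := fun w => (w.map Data.size).sum
  have hid : PolyTime es es := id
  have htot : ∀ w, 2 * total w ≤ 2 * (enc w).size := by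
    intro w
    induction w with
    | nil => simp [total]
    | cons a w ih =>
      simp only [total, List.map_cons, List.sum_cons] at ih ⊢
      rw [size_enc_cons]
      have : (enc a).size = a.size := rfl
      omega
  have key : PolyTime es fun s => es ([], s.2 + total s.1) := by
    refine while_loop (cond := fun s => !s.1.isEmpty) (step := step) (μ := fun s => total s.1)
      (G := fun s => (es s).size + 2 * total s.1) (isEmpty (A := fun _ => Data) hid.fst).not ?_ ?_
      (((PolyBdd.const 3).mul .self).mono ?_) ?_ ?_ ?_ ?_
    · have h₁ : PolyTime (fun s : {s : List Data × ℕ // (!s.1.isEmpty) = Bool.true} => es s)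
          fun s => es s := id
      refine (cond h₁.fst.fst.isNode
        ((h₁.fst.fst.fst.node (h₁.fst.fst.snd.node h₁.fst.snd)).node (nil.node h₁.snd))
        (h₁.fst.snd.node (nil.node h₁.snd))).congr ?_
      rintro ⟨⟨_ | ⟨_ | ⟨l, r⟩, w⟩, n⟩, hs⟩
      · simp at hs
      · rfl
      · rfl
    · rintro ⟨_ | ⟨_ | ⟨l, r⟩, w⟩, n⟩
      · simp [total]
      · simp [total, step, Data.size]
        omega
      · simp [total, step, Data.size]
        omega
    · rintro ⟨w, n⟩
      have h₁ := htot w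
      have h₂ : (es (w, n)).size = _ := size_enc_prod (w, n)
      dsimp only at h₂ ⊢
      omega
    · intro s; omega
    · rintro ⟨w, n⟩
      dsimp only
      omega
    · rintro ⟨_ | ⟨_ | ⟨l, r⟩, w⟩, n⟩ hs
      · simp at hs
      · simp [total, step, Data.size]
      · simp [total, step, Data.size]
        omega
    · rintro ⟨_ | ⟨_ | ⟨l, r⟩, w⟩, n⟩ hs
      · simp at hs
      · simp only [es, step, size_enc_prod, size_enc_cons, size_enc_nat, total, List.map_cons,
          List.sum_cons, Data.size]
        omega
      · have h₁ : (enc (Data.node l r)).size = l.size + r.size + 1 := rfl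
        have h₂ : ∀ x : Data, (enc x).size = x.size := fun _ => rfl
        simp only [es, step, size_enc_prod, size_enc_cons, size_enc_nat, total, List.map_cons,
          List.sum_cons, Data.size, h₁, h₂]
        omega
  have := comp (es := es) (fun y => ([f y], 0)) (e := e) ((hf.node nil).node nil) key.snd
  refine this.congr fun y => ?_
  simp [total]
  rfl

theorem data_eq {f g : Y → Data} (hf : PolyTime e f) (hg : PolyTime e g)
    {inst : ∀ y, Decidable (f y = g y)} : PolyTime e fun y => enc (decide (f y = g y)) := by
  -- The worklist holds the pairs of subtrees that still have to be compared.
  let es : Bool × List (Data × Data) → Data := enc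
  let step : Bool × List (Data × Data) → Bool × List (Data × Data) := fun s => match s with
    | (b, []) => (b, [])
    | (b, (.nil, .nil) :: w) => (b, w)
    | (b, (.node l r, .node l' r') :: w) => (b, (l, l') :: (r, r') :: w)
    | (_, (.nil, .node _ _) :: _) => (Bool.false, [])
    | (_, (.node _ _, .nil) :: _) => (Bool.false, [])
  let total : List (Data × Data) → ℕ := fun w => (w.map fun p => p.1.size).sum
  have hid : PolyTime es es := id
  have htot : ∀ w, total w ≤ (enc w).size := by
    intro w
    induction w with
    | nil => simp [total]
    | cons a w ih =>
      simp only [total, List.map_cons, List.sum_cons] at ih ⊢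
      rw [size_enc_cons, size_enc_prod]
      have : (enc a.1).size = a.1.size := rfl
      omega
  let allEq : List (Data × Data) → Prop := fun w => ∀ p ∈ w, p.1 = p.2
  classical
  have hEnc : ∀ x : Data, (enc x).size = x.size := fun _ => rfl
  have key : PolyTime es fun s => es (s.1 && decide (allEq s.2), []) := by
    refine while_loop (cond := fun s => !s.2.isEmpty) (step := step) (μ := fun s => total s.2)
      (G := fun s => (es s).size) (isEmpty (A := fun _ => Data × Data) hid.snd).not ?_ ?_
      .self ?_ ?_ ?_ ?_
    · have h₁ : PolyTime (fun s : {s : Bool × List (Data × Data) //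
          (!s.2.isEmpty) = Bool.true} => es s) fun s => es s := id
      have hx := h₁.snd.fst.fst
      have hy := h₁.snd.fst.snd
      refine (cond hx.isNode
        (cond hy.isNode (h₁.fst.node ((hx.fst.node hy.fst).node ((hx.snd.node hy.snd).node
          h₁.snd.snd))) (nil.node nil))
        (cond hy.isNode (nil.node nil) (h₁.fst.node h₁.snd.snd))).congr ?_
      rintro ⟨⟨b, _ | ⟨⟨_ | ⟨l, r⟩, _ | ⟨l', r'⟩⟩, w⟩⟩, hs⟩
      · simp at hs
      all_goals rfl
    · rintro ⟨b, _ | ⟨⟨_ | ⟨l, r⟩, _ | ⟨l', r'⟩⟩, w⟩⟩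
      all_goals simp [allEq, step, List.forall_mem_cons, and_assoc, -Prod.forall]
    · intro s; exact le_rfl
    · rintro ⟨b, w⟩
      have h₁ := htot w
      have h₂ : (es (b, w)).size = _ := size_enc_prod (b, w)
      dsimp only at h₂ ⊢
      omega
    · rintro ⟨b, _ | ⟨⟨_ | ⟨l, r⟩, _ | ⟨l', r'⟩⟩, w⟩⟩ hs
      · simp at hs
      all_goals simp [total, step, Data.size]
      omega
    · have hb : ∀ b : Bool, 1 ≤ (enc b).size := fun b => (enc b).one_le_size
      have hf : (enc Bool.false).size = 1 := rfl
      rintro ⟨b, _ | ⟨⟨_ | ⟨l, r⟩, _ | ⟨l', r'⟩⟩, w⟩⟩ hs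
      · simp at hs
      all_goals
        have := hb b
        simp only [es, step, size_enc_prod, size_enc_cons, size_enc_nil, hEnc, Data.size, hf]
        omega
  have := comp (es := es) (fun y => (Bool.true, [(f y, g y)])) (e := e)
    ((nil.node nil).node ((hf.node hg).node nil)) key.fst
  refine this.congr fun y => ?_
  by_cases h : f y = g y <;> simp [allEq, h] <;> rfl

theorem eq {A : Y → Type} [∀ y, Enc (A y)] [∀ y, EncInj (A y)] {a b : ∀ y, A y}
    {inst : ∀ y, Decidable (a y = b y)} (ha : PolyTime e fun y => enc (a y))
    (hb : PolyTime e fun y => enc (b y)) : PolyTime e fun y => enc (decide (a y = b y)) := by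
  classical
  refine (data_eq (inst := fun _ => Classical.propDecidable _) ha hb).congr fun y => ?_
  by_cases h : a y = b y
  · simp [h]
  · have : enc (a y) ≠ enc (b y) := fun h' => h (EncInj.inj h')
    simp [h, this]

theorem nat_add {a b : Y → ℕ} (ha : PolyTime e fun y => enc (a y))
    (hb : PolyTime e fun y => enc (b y)) : PolyTime e fun y => enc (a y + b y) :=
  (nat_sum (ha.cons (hb.cons list_nil))).congr fun y => by simp

theorem nat_mul {a b : Y → ℕ} (ha : PolyTime e fun y => enc (a y))
    (hb : PolyTime e fun y => enc (b y)) : PolyTime e fun y => enc (a y * b y) :=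
  (nat_sum (map (B := fun _ => ℕ) (f := fun y _ => b y) ha.replicate hb.lift)).congr
    fun y => by simp

end PolyTime

/-! ### Exponential time -/

/-- The full binary tree of height `k`. -/
def fullTree : ℕ → Data
  | 0 => .nil
  | k + 1 => .node (fullTree k) (fullTree k)

theorem size_fullTree (k : ℕ) : (fullTree k).size + 1 = 2 ^ (k + 1) := by
  induction k with
  | zero => rfl
  | succ k ih =>
    rw [fullTree, Data.size, pow_succ]
    omega

theorem eval_le (q : Polynomial ℕ) {x : ℕ} (hx : 1 ≤ x) :
    q.eval x ≤ q.eval 1 * x ^ q.natDegree := by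
  rw [Polynomial.eval_eq_sum_range, Polynomial.eval_eq_sum_range, Finset.sum_mul]
  refine Finset.sum_le_sum fun i hi => ?_
  rw [one_pow, mul_one]
  exact Nat.mul_le_mul_left _ (Nat.pow_le_pow_right hx (by
    rw [Finset.mem_range] at hi; omega))

theorem exists_eval_le_two_pow (q r : Polynomial ℕ) :
    ∃ t : Polynomial ℕ, ∀ s, q.eval (2 ^ r.eval s) ≤ 2 ^ t.eval s := by
  refine ⟨.C (q.eval 1) + .C q.natDegree * r, fun s => ?_⟩
  refine (eval_le q Nat.one_le_two_pow).trans ?_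
  simp only [Polynomial.eval_add, Polynomial.eval_mul, Polynomial.eval_C]
  rw [pow_add, ← pow_mul, mul_comm (r.eval s)]
  exact Nat.mul_le_mul_right _ Nat.lt_two_pow_self.le

/-- Exponentially large data are available in exponential time; polynomial time in their size is
exponential time. -/
theorem exists_prog_of_polyTime {Y : Type} {e f : Y → Data}
    (h : PolyTime (fun y => .node (e y) (fullTree ((e y).size * (e y).size))) f) :
    ∃ (prog : Prog) (time : Polynomial ℕ), ∀ y, ∃ c, prog.Runs (e y) (f y) c ∧
      c ≤ 2 ^ time.eval (e y).size := by
  obtain ⟨p₃, q₃, h₃⟩ := h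
  let es : Data × ℕ × ℕ → Data := fun s => .node (enc s.2.1) (.node s.1 (fullTree s.2.2))
  let G : Data × ℕ × ℕ → ℕ := fun s => s.1.size + 2 * (s.2.1 + s.2.2) + 2 ^ (s.2.1 + s.2.2 + 1) + 2
  obtain ⟨p₁, q₁, h₁⟩ : PolyTime e fun y => es (e y, (e y).size * (e y).size, 0) :=
    (PolyTime.nat_mul PolyTime.id.data_size PolyTime.id.data_size).node
      (PolyTime.id.node PolyTime.nil)
  have hid : PolyTime es es := .id
  have hrest : ∀ {p : Data × ℕ × ℕ → Prop}, PolyTime (fun s : {s // p s} => es s) fun s => es s :=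
    .id
  obtain ⟨p₂, q₂, h₂⟩ := PolyTime.exists_while_loop (es := es) (cond := fun s => s.2.1 != 0)
    (step := fun s => (s.1, s.2.1 - 1, s.2.2 + 1)) (fin := fun s => (s.1, 0, s.2.1 + s.2.2))
    (μ := fun s => s.2.1) (G := G)
    (hid.fst.isNode.congr fun s => by
      obtain ⟨x, _ | k, j⟩ := s <;> rfl)
    ((hrest.fst.snd.node (hrest.snd.fst.node (hrest.snd.snd.node hrest.snd.snd))).congr fun s => by
      obtain ⟨⟨x, _ | k, j⟩, hs⟩ := s
      · simp at hs
      · rfl)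
    (fun s => by
      obtain ⟨x, _ | k, j⟩ := s
      · simp
      · simp only [bne_iff_ne, ne_eq, Nat.add_eq_zero_iff, one_ne_zero, and_false,
          not_false_eq_true, if_true, add_tsub_cancel_right]
        rw [add_assoc, add_comm 1])
    (fun s => by
      have h₁ := size_fullTree s.2.2
      have h₂ : 2 ^ (s.2.2 + 1) ≤ 2 ^ (s.2.1 + s.2.2 + 1) :=
        Nat.pow_le_pow_right (by norm_num) (by omega)
      simp only [es, G, Data.size, size_enc_nat]
      omega)
    (fun s => by
      have := Nat.two_pow_pos (s.2.1 + s.2.2 + 1)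
      simp only [G]
      omega)
    (fun s hs => by
      simp only [bne_iff_ne] at hs
      simp only
      omega)
    (fun s hs => by
      simp only [bne_iff_ne] at hs
      simp only [G]
      rw [show s.2.1 - 1 + (s.2.2 + 1) = s.2.1 + s.2.2 by omega])
  obtain ⟨p₄, q₄, h₄⟩ := hid.snd
  -- The size of all data and the cost of all parts are polynomial in `2 ^ r.eval (e y).size`.
  let r : Polynomial ℕ := .X + .X * .X + .X * .X + 3
  let q : Polynomial ℕ := 4 * .X + q₁ + q₂.comp (5 * .X) + q₄.comp (4 * .X) + q₃.comp (4 * .X) + 4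
    + 3 * (q₁ + q₂.comp (5 * .X))
  obtain ⟨t, ht⟩ := exists_eval_le_two_pow q r
  refine ⟨.seq p₁ (.seq p₂ (.seq p₄ p₃)), t, fun y => ?_⟩
  obtain ⟨c₁, h₅, h₆⟩ := h₁ y
  obtain ⟨c₂, h₇, h₈⟩ := h₂ (e y, (e y).size * (e y).size, 0)
  obtain ⟨c₄, h₉, h₁₀⟩ := h₄ (e y, 0, (e y).size * (e y).size)
  obtain ⟨c₃, h₁₁, h₁₂⟩ := h₃ y
  refine ⟨_, .seq h₅ (.seq h₇ (.seq h₉ h₁₁)), le_trans ?_ (ht (e y).size)⟩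
  have hs₁ := h₅.size_le
  have hs₂ := h₇.size_le
  dsimp only at hs₁ hs₂
  obtain ⟨s, hs⟩ : ∃ s, s = (e y).size := ⟨_, rfl⟩
  obtain ⟨N, hN⟩ : ∃ N, N = 2 ^ r.eval s := ⟨_, rfl⟩
  have hr : r.eval s = s + s * s + s * s + 3 := by simp [r]
  have hsN : s + s * s + s * s + 3 ≤ N := by
    rw [hN, hr]
    exact Nat.lt_two_pow_self.le
  have hpN : 2 ^ (s * s + 1) ≤ N := by
    rw [hN, hr]
    exact Nat.pow_le_pow_right (by norm_num) (by omega)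
  have htree := size_fullTree (s * s)
  have hG : G (e y, (e y).size * (e y).size, 0) ≤ 5 * N := by
    simp only [G, ← hs, add_zero]
    omega
  have hz : (enc (0 : ℕ)).size = 1 := rfl
  have e₁ : c₁ ≤ q₁.eval N := h₆.trans (eval_mono _ (by omega))
  have e₂ : c₂ ≤ q₂.eval (5 * N) := h₈.trans (eval_mono _ hG)
  have e₄ : c₄ ≤ q₄.eval (4 * N) := h₁₀.trans (eval_mono _ (by
    simp only [es, Data.size, ← hs, hz]
    omega))
  have e₃ : c₃ ≤ q₃.eval (4 * N) := h₁₂.trans (eval_mono _ (by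
    simp only [Data.size, ← hs]
    omega))
  simp only [← hs, ← hN, add_zero] at hs₁ hs₂ ⊢
  simp only [q, Polynomial.eval_add, Polynomial.eval_mul, Polynomial.eval_comp, Polynomial.eval_X,
    Polynomial.eval_ofNat]
  omega

namespace PolyTime

variable {Y : Type} {e : Y → Data} {A : Y → Type} [∀ y, Enc (A y)]

/-! ### Programs for binary numbers -/

theorem foldr_bit_bits (n : ℕ) : n.bits.foldr Nat.bit 0 = n := by
  induction n using Nat.binaryRec' with
  | zero => simp
  | bit b n h ih => rw [Nat.bits_append_bit n b h, List.foldr_cons, ih]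

/-- Binary to unary, for numbers of polynomial size. -/
theorem of_binary {n : Y → ℕ} (hn : PolyTime e fun y => Data.binary (n y)) (hb : PolyBdd e n) :
    PolyTime e fun y => enc (n y) := by
  have hl : PolyTime e fun y => enc (n y).bits := hn
  have hbit : ∀ (b : Bool) (k : ℕ), Nat.bit b k = k + (k + if b = Bool.true then 1 else 0) := by
    intro b k
    cases b <;> simp [Nat.bit] <;> omega
  have hmono : ∀ (l : List Bool) k, k ≤ l.foldl (fun k b => Nat.bit b k) k := by
    intro l
    induction l with
    | nil => simp
    | cons b l ih =>
      intro k
      refine le_trans ?_ (ih _)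
      have := hbit b k
      dsimp only
      omega
  refine (foldl (B := fun _ => ℕ) (b := fun _ => 0) (f := fun _ k b => Nat.bit b k)
    (g := fun y => 2 * n y + 1) hl.reverse (const (enc 0)) ?_ ?_ ?_).congr fun y => ?_
  · refine (nat_add (a := fun z => z.1.2) (b := fun z => z.1.2 + if z.2 = Bool.true then 1 else 0)
      var.lift (nat_add (a := fun z : Σ _ : (Σ _ : Y, ℕ), Bool => z.1.2) var.lift
        (iteB (A := fun _ => ℕ) var (const (enc 1)) (const (enc 0))))).congr
          fun z => congrArg enc (hbit _ _)
  · exact ((PolyBdd.const 2).mul hb).add (.const 1)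
  · rintro y l₁ ⟨l₂, h⟩
    rw [size_enc_nat]
    have := hmono l₂ (l₁.foldl (fun k b => Nat.bit b k) 0)
    rw [← List.foldl_append, h, List.foldl_reverse, foldr_bit_bits] at this
    omega
  · rw [List.foldl_reverse, foldr_bit_bits]

/-- Increment of a number in binary. -/
def incr : List Bool → List Bool
  | [] => [Bool.true]
  | Bool.false :: l => Bool.true :: l
  | Bool.true :: l => Bool.false :: incr l

theorem bits_succ (n : ℕ) : (n + 1).bits = incr n.bits := by
  induction n using Nat.binaryRec' with
  | zero => simp [incr]
  | bit b n h ih =>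
    rw [Nat.bits_append_bit n b h]
    cases b with
    | false =>
      rw [incr, ← Nat.bits_append_bit n Bool.true (fun _ => rfl)]
      simp [Nat.bit]
    | true =>
      rw [incr, ← ih, ← Nat.bits_append_bit (n + 1) Bool.false (by simp)]
      congr 1

theorem size_enc_bool (b : Bool) : (enc b).size ≤ 3 := by
  cases b <;> simp [enc, Data.ofBool, Data.size]

theorem poly_incr {l : Y → List Bool} (hl : PolyTime e fun y => enc (l y)) :
    PolyTime e fun y => enc (incr (l y)) := by
  have hf : ∀ (l o : List Bool) (c : Bool), l.foldl (fun (s : List Bool × Bool) b =>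
      ((s.2 != b) :: s.1, s.2 && b)) (o, c) =
        let r := l.foldl (fun (s : List Bool × Bool) b => ((s.2 != b) :: s.1, s.2 && b)) ([], c)
        (r.1 ++ o, r.2) := by
    intro l
    induction l with
    | nil => simp
    | cons b l ih =>
      intro o c
      rw [List.foldl_cons, ih, List.foldl_cons, ih [c != b]]
      simp
  have hfalse : ∀ l : List Bool, l.foldl (fun (s : List Bool × Bool) b =>
      ((s.2 != b) :: s.1, s.2 && b)) ([], Bool.false) = (l.reverse, Bool.false) := by
    intro l
    induction l with
    | nil => simp
    | cons b l ih => rw [List.foldl_cons, hf]; simp [ih]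
  have hincr : ∀ l : List Bool, let r := l.foldl (fun (s : List Bool × Bool) b =>
      ((s.2 != b) :: s.1, s.2 && b)) ([], Bool.true)
      incr l = r.1.reverse ++ if r.2 = Bool.true then [Bool.true] else [] := by
    intro l
    induction l with
    | nil => simp [incr]
    | cons b l ih =>
      cases b with
      | false => rw [List.foldl_cons, hf]; simp [hfalse, incr]
      | true =>
        rw [List.foldl_cons, hf, incr, ih]
        simp
  have hlen : ∀ (l : List Bool) (s : List Bool × Bool), (l.foldl (fun s b =>
      ((s.2 != b) :: s.1, s.2 && b)) s).1.length = l.length + s.1.length := by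
    intro l
    induction l with
    | nil => simp
    | cons b l ih =>
      intro s
      rw [List.foldl_cons, ih]
      simp
      omega
  have key : PolyTime e fun y => enc ((l y).foldl (fun (s : List Bool × Bool) b =>
      ((s.2 != b) :: s.1, s.2 && b)) ([], Bool.true)) := by
    refine foldl (A := fun _ => Bool) (B := fun _ => List Bool × Bool)
      (b := fun _ => ([], Bool.true)) (f := fun _ s b => ((s.2 != b) :: s.1, s.2 && b)) hl
      (const (enc (([] : List Bool), Bool.true)))
      ?_ ((((hl.size).mul (.const 4)).add (.const 1)).add (.const 4)) ?_
    · exact ((beq (prod_snd var.lift) var).not.cons (prod_fst var.lift)).prod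
        (and (prod_snd var.lift) var)
    · rintro y l₁ ⟨l₂, h⟩
      have h₁ := size_enc_le (l := (l₁.foldl (fun (s : List Bool × Bool) b =>
        ((s.2 != b) :: s.1, s.2 && b)) ([], Bool.true)).1) (k := 3) fun b _ => size_enc_bool b
      have h₂ := size_enc_bool (l₁.foldl (fun (s : List Bool × Bool) b =>
        ((s.2 != b) :: s.1, s.2 && b)) ([], Bool.true)).2
      have h₃ := length_lt_size (l y)
      rw [← h, List.length_append] at h₃
      rw [hlen] at h₁
      rw [size_enc_prod]
      rw [← h]
      simp only [List.length_nil] at h₁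
      omega
  refine (append (prod_fst key).reverse (iteB (A := fun _ => List Bool)
    (inst := fun _ => inferInstance) (prod_snd key)
    (const (enc [Bool.true])) list_nil)).congr fun y => ?_
  rw [hincr]

theorem length_bits_le (n : ℕ) : n.bits.length ≤ n := by
  rw [Nat.size_eq_bits_len, Nat.size_le]
  exact Nat.lt_two_pow_self

theorem binary {n : Y → ℕ} (hn : PolyTime e fun y => enc (n y)) :
    PolyTime e fun y => Data.binary (n y) := by
  have hf : ∀ u : List Unit, u.foldl (fun l _ => incr l) [] = u.length.bits := by
    intro u
    induction u using List.reverseRecOn with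
    | nil => simp
    | append_singleton u a ih => rw [List.foldl_append, ih]; simp [bits_succ]
  refine (foldl (B := fun _ => List Bool) (b := fun _ => []) (f := fun _ l _ => incr l)
    (g := fun y => (enc (n y)).size * 4 + 1) hn.replicate list_nil
    (poly_incr var.lift) ((hn.size.mul (.const 4)).add (.const 1)) ?_).congr fun y => ?_
  · rintro y l₁ ⟨l₂, h⟩
    rw [hf, size_enc_nat]
    refine (size_enc_le (k := 3) fun b _ => size_enc_bool b).trans ?_
    have h₁ := length_bits_le l₁.length
    have h₂ := congrArg List.length h
    simp only [List.length_append, List.length_replicate] at h₂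
    omega
  · rw [hf, List.length_replicate]
    rfl

theorem ofInt {z : Y → ℤ} (hz : PolyTime e fun y => enc (z y)) :
    PolyTime e fun y => Data.ofInt (z y) := by
  refine ((eq (A := fun _ => ℕ) (inst := fun _ => inferInstance) hz.toNat_neg
    (const (enc 0))).not.node (nat_add hz.toNat hz.toNat_neg).binary).congr fun y => ?_
  have h₁ : decide (z y < 0) = !decide ((-z y).toNat = 0) := by
    rw [Bool.eq_iff_iff]
    simp
  have h₂ : (z y).natAbs = (z y).toNat + (-z y).toNat := by omega
  rw [Data.ofInt, h₁, h₂]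
  rfl

theorem of_ofInt {z : Y → ℤ} (hz : PolyTime e fun y => Data.ofInt (z y))
    (hb : PolyBdd e fun y => (z y).natAbs) : PolyTime e fun y => enc (z y) := by
  have h₁ : PolyTime e fun y => enc (decide (z y < 0)) := hz.fst
  have h₂ : PolyTime e fun y => enc (z y).natAbs := of_binary hz.snd hb
  refine (node (cond h₁ (const (enc (0 : ℕ))) h₂) (cond h₁ h₂ (const (enc (0 : ℕ))))).congr
    fun y => ?_
  have h₃ : enc (z y) = .node (enc (z y).toNat) (enc (-z y).toNat) := rfl
  rw [h₃]
  by_cases h : z y < 0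
  · rw [show (z y).toNat = 0 by omega, show (-z y).toNat = (z y).natAbs by omega]
    simp [h]
  · rw [show (z y).toNat = (z y).natAbs by omega, show (-z y).toNat = 0 by omega]
    simp [h]

variable {d : Y → ℕ}

theorem ofVec {v : ∀ y, Fin (d y) → ℤ} (hd : PolyTime e fun y => enc (d y))
    (hv : PolyTime e fun y => enc (v y)) : PolyTime e fun y => Data.ofVec (v y) :=
  (map (B := fun _ => Data) (f := fun y i => Data.ofInt (v y i)) hd.finRange
    (ofInt (app hv.lift var))).congr fun y => by
      rw [Data.ofVec, List.ofFn_eq_map]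
      simp only [enc, List.map_map]
      rfl

theorem of_ofVec {v : ∀ y, Fin (d y) → ℤ} (hd : PolyTime e fun y => enc (d y))
    (hv : PolyTime e fun y => Data.ofVec (v y)) {g : Y → ℕ} (hg : PolyBdd e g)
    (hb : ∀ y i, (v y i).natAbs ≤ g y) : PolyTime e fun y => enc (v y) := by
  have hv' : PolyTime e fun y => enc (List.ofFn fun i => Data.ofInt (v y i)) :=
    hv.congr fun y => by
      rw [Data.ofVec]
      simp only [enc, List.map_ofFn]
      rfl
  refine ofFn hd (of_ofInt ?_ (hg.lift.mono fun z => hb z.1 z.2))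
  exact get (A := fun _ => Data) (n := fun z : Σ y, Fin (d y) => z.2.val) hv'.lift var
    fun z => by simp; rfl

theorem natAbs_lt_two_pow (z : ℤ) : z.natAbs < 2 ^ (Data.ofInt z).size := by
  have h₁ : z.natAbs < 2 ^ z.natAbs.bits.length := by
    rw [Nat.size_eq_bits_len]
    exact Nat.lt_size_self _
  refine h₁.trans_le (Nat.pow_le_pow_right (by norm_num) ?_)
  have h₂ := length_lt_size z.natAbs.bits
  have h₃ : (enc z.natAbs.bits).size = (Data.binary z.natAbs).size := rfl
  simp only [Data.ofInt, Data.size]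
  omega

theorem size_ofInt_lt {d : ℕ} (v : Fin d → ℤ) (i : Fin d) :
    (Data.ofInt (v i)).size < (Data.ofVec v).size := by
  have h₁ : Data.ofVec v = enc (List.ofFn fun i => Data.ofInt (v i)) := by
    rw [Data.ofVec]
    simp only [enc, List.map_ofFn]
    rfl
  rw [h₁]
  exact size_lt_of_mem (a := Data.ofInt (v i)) (by simp)

/-! ### Programs for exponentially many sets and words -/

theorem size_enc_le_of_sublist {A : Type} [Enc A] {l l' : List A} (h : l.Sublist l') :
    (enc l).size ≤ (enc l').size := by
  induction h with
  | slnil => exact le_rfl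
  | cons a _ ih => rw [size_enc_cons]; omega
  | cons_cons a _ ih => rw [size_enc_cons, size_enc_cons]; omega

theorem sublists' {l : ∀ y, List (A y)} (hl : PolyTime e fun y => enc (l y))
    (hb : PolyBdd e fun y => 2 ^ (l y).length) : PolyTime e fun y => enc (l y).sublists' := by
  have hf : ∀ {A : Type} (l : List A), l.foldr (fun a r => r ++ r.map (a :: ·)) [[]] =
      l.sublists' := by
    intro A l
    induction l with
    | nil => rfl
    | cons a l ih => rw [List.foldr_cons, ih, List.sublists'_cons]
  refine (foldl (B := fun y => List (List (A y))) (b := fun _ => [[]])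
    (f := fun _ r a => r ++ r.map (a :: ·))
    (g := fun y => 2 ^ (l y).length * ((enc (l y)).size + 1) + 1) hl.reverse
    (list_nil.cons list_nil) ?_ ?_ ?_).congr fun y => ?_
  · exact append var.lift (map var.lift (var.lift.cons var))
  · exact (hb.mul (hl.size.add (.const 1))).add (.const 1)
  · rintro y l₁ ⟨l₂, h⟩
    have h₁ : l y = l₂.reverse ++ l₁.reverse := by
      rw [← List.reverse_append, h, List.reverse_reverse]
    rw [← List.foldr_reverse, hf]
    refine (size_enc_le (k := (enc (l y)).size) fun l' hl' => ?_).trans ?_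
    · rw [List.mem_sublists'] at hl'
      exact size_enc_le_of_sublist (hl'.trans (h₁ ▸ List.sublist_append_right _ _))
    · rw [List.length_sublists']
      gcongr
      · norm_num
      · rw [h₁]
        simp
  · rw [List.foldl_reverse, hf]

theorem length_words_le {Q : Type} (qs : List Q) (k : ℕ) :
    (ParikhAutomaton.words qs k).length ≤ (qs.length + 1) ^ k := by
  induction k with
  | zero => simp [ParikhAutomaton.words]
  | succ k ih =>
    have h₁ : (ParikhAutomaton.words qs (k + 1)).length =
        (ParikhAutomaton.words qs k).length * qs.length + 1 := by
      simp [ParikhAutomaton.words, List.length_flatMap]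
    have h₂ : 1 ≤ (qs.length + 1) ^ k := Nat.one_le_pow _ _ (by omega)
    rw [h₁, pow_succ, mul_add, mul_one]
    gcongr

theorem mem_words_length {Q : Type} {qs : List Q} {k : ℕ} {l : List Q}
    (h : l ∈ ParikhAutomaton.words qs k) : l.length ≤ k ∧ ∀ q ∈ l, q ∈ qs := by
  induction k generalizing l with
  | zero =>
    simp only [ParikhAutomaton.words, List.mem_singleton] at h
    simp [h]
  | succ k ih =>
    simp only [ParikhAutomaton.words, List.mem_cons, List.mem_flatMap, List.mem_map] at h
    rcases h with rfl | ⟨l', h, q, hq, rfl⟩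
    · simp
    · obtain ⟨h₁, h₂⟩ := ih h
      refine ⟨by simpa using h₁, ?_⟩
      simp only [List.mem_cons]
      rintro p (rfl | hp)
      · exact hq
      · exact h₂ p hp

theorem words {qs : ∀ y, List (A y)} {k : Y → ℕ} (hq : PolyTime e fun y => enc (qs y))
    (hk : PolyTime e fun y => enc (k y)) (hb : PolyBdd e fun y => ((qs y).length + 1) ^ k y) :
    PolyTime e fun y => enc (ParikhAutomaton.words (qs y) (k y)) := by
  have hf : ∀ {A : Type} (qs : List A) (u : List Unit), u.foldl (fun r _ => [] :: r.flatMap fun l =>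
      qs.map fun q => q :: l) [[]] = ParikhAutomaton.words qs u.length := by
    intro A qs u
    induction u using List.reverseRecOn with
    | nil => rfl
    | append_singleton u a ih =>
      rw [List.foldl_append, ih, List.length_append, List.length_singleton, ParikhAutomaton.words]
      rfl
  refine (foldl (B := fun y => List (List (A y))) (b := fun _ => [[]])
    (f := fun y r _ => [] :: r.flatMap fun l => (qs y).map fun q => q :: l)
    (g := fun y => ((qs y).length + 1) ^ k y * (k y * ((enc (qs y)).size + 1) + 1 + 1) + 1)
    hk.replicate (list_nil.cons list_nil) ?_ ?_ ?_).congr fun y => ?_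
  · exact list_nil.cons (flatMap var.lift (map hq.lift.lift.lift (var.cons var.lift)))
  · have h₁ : PolyBdd e k := hk.size.mono fun y => by rw [size_enc_nat]; omega
    exact (hb.mul (((h₁.mul (hq.size.add (.const 1))).add (.const 1)).add
      (.const 1))).add (.const 1)
  · rintro y l₁ ⟨l₂, h⟩
    have hlen : l₁.length ≤ k y := by
      have := congrArg List.length h
      simp only [List.length_append, List.length_replicate] at this
      omega
    rw [hf]
    refine (size_enc_le (k := k y * ((enc (qs y)).size + 1) + 1) fun l hl => ?_).trans ?_
    · obtain ⟨h₁, h₂⟩ := mem_words_length hl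
      refine (size_enc_le fun q hq => (size_lt_of_mem (h₂ q hq)).le).trans ?_
      gcongr
      omega
    · gcongr
      refine (length_words_le _ _).trans ?_
      gcongr
      omega
  · rw [hf, List.length_replicate]

end PolyTime

open TwoWayParikh.ParikhAutomaton (letters)

theorem enc_list_data {A : Type} (l : List A) (f : A → Data) :
    enc (l.map f) = Data.ofList (l.map f) := by
  simp only [enc, List.map_map]
  rfl

theorem enc_map {A B : Type} [Enc B] (l : List A) (f : A → B) :
    enc (l.map f) = Data.ofList (l.map fun a => enc (f a)) := by
  simp only [enc, List.map_map]
  rfl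

namespace PolyTime

variable {Y : Type} {e : Y → Data} {m n d : Y → ℕ}

/-- Substitution for the variables of `e` and for one more variable. -/
theorem subst {Y' : Type} {e' : Y' → Data} {A : Y → Type} [∀ y, Enc (A y)] {f : (Σ y, A y) → Data}
    (h : PolyTime (ctx e A) f) (φ : Y' → Y) {a : ∀ y, A (φ y)}
    (he : PolyTime e' fun y => e (φ y)) (ha : PolyTime e' fun y => enc (a y)) :
    PolyTime e' fun y => f ⟨φ y, a y⟩ :=
  comp (fun y => (⟨φ y, a y⟩ : Σ y, A y)) (ha.node he) h

/-! ### Programs for automata -/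

theorem lend : PolyTime e fun y => enc (Letter.lend : Letter (Fin (m y))) := const (enc 0)

theorem rend : PolyTime e fun y => enc (Letter.rend : Letter (Fin (m y))) := const (enc 1)

theorem letters (hm : PolyTime e fun y => enc (m y)) :
    PolyTime e fun y => enc (letters (m y)) := by
  have h : PolyTime (ctx e fun y => Fin (m y)) fun z => enc (Letter.sym z.2) :=
    (succ (n := fun z : Σ y, Fin (m y) => z.2.val + 1)
      (succ (n := fun z : Σ y, Fin (m y) => z.2.val) var))
  refine (lend.cons (rend.cons (map (B := fun y => Letter (Fin (m y)))
    (f := fun y i => Letter.sym i) hm.finRange h))).congr fun y => ?_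
  rw [ParikhAutomaton.letters, List.ofFn_eq_map]

theorem letters_getElem? {m : ℕ} (a : Letter (Fin m)) :
    (ParikhAutomaton.letters m)[a.index]? = .some a := by
  cases a <;> simp [ParikhAutomaton.letters, Letter.index]

section access

variable {P : ∀ y, ParikhAutomaton (Fin (m y)) (Fin (n y)) (d y)}

theorem numLetters (hP : PolyTime e fun y => (P y).encode) : PolyTime e fun y => enc (m y) := hP.fst

theorem dim (hP : PolyTime e fun y => (P y).encode) : PolyTime e fun y => enc (d y) := hP.snd.fst

theorem constraint (hP : PolyTime e fun y => (P y).encode) :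
    PolyTime e fun y => (P y).constraint.encode := hP.snd.snd.snd.snd.fst

theorem stateInfo (hP : PolyTime e fun y => (P y).encode) :
    PolyTime e fun y => enc (List.ofFn (P y).encodeState) :=
  hP.snd.snd.fst.congr fun y => by
    rw [List.ofFn_eq_map, enc_list_data, ← List.ofFn_eq_map]
    rfl

theorem numStates (hP : PolyTime e fun y => (P y).encode) : PolyTime e fun y => enc (n y) :=
  (length (A := fun _ => Data) hP.stateInfo).congr fun y => by rw [List.length_ofFn]

variable {p q : ∀ y, Fin (n y)} {a : ∀ y, Letter (Fin (m y))}

theorem encodeState (hP : PolyTime e fun y => (P y).encode) (hq : PolyTime e fun y => enc (q y)) :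
    PolyTime e fun y => (P y).encodeState (q y) :=
  get (A := fun _ => Data) (n := fun y => (q y).val) hP.stateInfo hq fun y => by simp; rfl

theorem leftB (hP : PolyTime e fun y => (P y).encode) (hq : PolyTime e fun y => enc (q y)) :
    PolyTime e fun y => enc ((P y).leftB (q y)) :=
  (hP.encodeState hq).fst.congr fun y => by
    have : (P y).leftB (q y) = @decide _ (Classical.propDecidable ((P y).aut.side (q y) = .L)) := by
      rw [Bool.eq_iff_iff, ParikhAutomaton.leftB, Side.isL_eq_true]
      simp
    rw [this]
    rfl

theorem initB (hP : PolyTime e fun y => (P y).encode) (hq : PolyTime e fun y => enc (q y)) :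
    PolyTime e fun y => enc ((P y).initB (q y)) := (hP.encodeState hq).snd.fst

theorem accB (hP : PolyTime e fun y => (P y).encode) (hq : PolyTime e fun y => enc (q y)) :
    PolyTime e fun y => enc ((P y).accB (q y)) := (hP.encodeState hq).snd.snd.snd.fst

/-- The table of transitions. -/
noncomputable def table {m n d : ℕ} (P : ParikhAutomaton (Fin m) (Fin n) d) :
    List (List (List Data)) :=
  (List.finRange n).map fun p => (ParikhAutomaton.letters m).map fun a =>
    (List.finRange n).map fun q => P.encodeEntry p a q

theorem enc_table {m n d : ℕ} (P : ParikhAutomaton (Fin m) (Fin n) d) :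
    enc (table P) = P.encode.snd.snd.snd.fst := by
  simp only [table, enc_map, ParikhAutomaton.encode, List.ofFn_eq_map]
  rfl

theorem encodeEntry_eq {m n d : ℕ} (P : ParikhAutomaton (Fin m) (Fin n) d) (p : Fin n)
    (a : Letter (Fin m)) (q : Fin n) :
    P.encodeEntry p a q = (P.tr p a q).elim .nil fun w => .node .nil (Data.ofVec w) := by
  rw [ParikhAutomaton.encodeEntry, ParikhAutomaton.tr]
  split_ifs <;> rfl

theorem encodeEntry (hP : PolyTime e fun y => (P y).encode) (hp : PolyTime e fun y => enc (p y))
    (ha : PolyTime e fun y => enc (a y)) (hq : PolyTime e fun y => enc (q y)) :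
    PolyTime e fun y => (P y).encodeEntry (p y) (a y) (q y) := by
  have h₁ : PolyTime e fun y => enc (table (P y)) :=
    hP.snd.snd.snd.fst.congr fun y => enc_table _
  have h₂ := get (A := fun _ => List (List Data)) (n := fun y => (p y).val)
    (a := fun y => (ParikhAutomaton.letters (m y)).map fun a =>
      (List.finRange (n y)).map fun q => (P y).encodeEntry (p y) a q) h₁ hp
    fun y => by simp [table]
  have h₃ := get (A := fun _ => List Data) (n := fun y => (a y).index)
    (a := fun y => (List.finRange (n y)).map fun q => (P y).encodeEntry (p y) (a y) q) h₂ ha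
    fun y => by rw [List.getElem?_map, letters_getElem?]; rfl
  exact get (A := fun _ => Data) (n := fun y => (q y).val) h₃ hq fun y => by simp; rfl

theorem size_enc_table_le {m n d : ℕ} (P : ParikhAutomaton (Fin m) (Fin n) d) :
    (enc (table P)).size ≤ P.encode.size := by
  have hs : ∀ x : Data, x.fst.size ≤ x.size := fun x => by
    cases x <;> simp [Data.fst, Data.size]; omega
  have hs' : ∀ x : Data, x.snd.size ≤ x.size := fun x => by
    cases x <;> simp [Data.snd, Data.size]; omega
  rw [enc_table]
  exact (hs _).trans ((hs' _).trans ((hs' _).trans (hs' _)))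

theorem size_encodeEntry_lt {m n d : ℕ} (P : ParikhAutomaton (Fin m) (Fin n) d) (p : Fin n)
    (a : Letter (Fin m)) (q : Fin n) : (P.encodeEntry p a q).size < P.encode.size := by
  have h₁ : (P.encodeEntry p a q).size < _ := size_lt_of_mem (a := P.encodeEntry p a q)
    (List.mem_map.2 ⟨q, List.mem_finRange q, rfl⟩)
  have h₂ := size_lt_of_mem (a := (List.finRange n).map fun q => P.encodeEntry p a q)
    (l := (ParikhAutomaton.letters m).map fun a =>
      (List.finRange n).map fun q => P.encodeEntry p a q)
    (List.mem_map.2 ⟨a, ParikhAutomaton.mem_letters a, rfl⟩)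
  have h₃ := size_lt_of_mem (l := table P) (List.mem_map.2 ⟨p, List.mem_finRange p, rfl⟩)
  exact h₁.trans (h₂.trans (h₃.trans_le (size_enc_table_le P)))

/-- The weights are available in unary since exponential growth is allowed by `hb`. -/
theorem tr (hP : PolyTime e fun y => (P y).encode) (hb : PolyBdd e fun y => 2 ^ (P y).encode.size)
    (hp : PolyTime e fun y => enc (p y)) (ha : PolyTime e fun y => enc (a y))
    (hq : PolyTime e fun y => enc (q y)) :
    PolyTime e fun y => enc ((P y).tr (p y) (a y) (q y)) := by
  have h := hP.encodeEntry hp ha hq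
  refine cases (b := fun y => ((P y).tr (p y) (a y) (q y)).isSome) (h.isNode.congr fun y => ?_)
    ?_ ?_
  · rw [encodeEntry_eq]
    cases (P y).tr (p y) (a y) (q y) <;> rfl
  · obtain ⟨b, hb⟩ := hb
    have h' : PolyTime (fun y : {y // ((P y).tr (p y) (a y) (q y)).isSome = Bool.true} => e y)
        fun y => Data.ofVec (((P y).tr (p y) (a y) (q y)).get y.2) := by
      refine h.restrict.snd.congr ?_
      rintro ⟨y, hy⟩
      obtain ⟨w, hw⟩ := Option.isSome_iff_exists.1 hy
      simp [encodeEntry_eq, hw, Data.snd]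
    refine (nil.node (of_ofVec hP.restrict.dim h' (g := fun y => 2 ^ (P y).encode.size)
      ⟨b, fun y => hb y⟩ ?_)).congr ?_
    · rintro ⟨y, hy⟩ i
      obtain ⟨w, hw⟩ := Option.isSome_iff_exists.1 hy
      rw [show ((P y).tr (p y) (a y) (q y)).get hy = w from Option.get_of_mem _ hw]
      refine (natAbs_lt_two_pow (w i)).le.trans (Nat.pow_le_pow_right (by norm_num) ?_)
      have h₁ := size_encodeEntry_lt (P y) (p y) (a y) (q y)
      have h₂ := size_ofInt_lt w i
      rw [encodeEntry_eq, hw] at h₁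
      simp only [Option.elim_some, Data.size] at h₁
      dsimp only
      omega
    · rintro ⟨y, hy⟩
      obtain ⟨w, hw⟩ := Option.isSome_iff_exists.1 hy
      simp [enc, hw]
  · refine nil.congr ?_
    rintro ⟨y, hy⟩
    rw [Option.isSome_eq_false_iff, Option.isNone_iff_eq_none] at hy
    simp [enc, hy]

end access

section output

variable {σ : Y → Type} [∀ y, Enc (σ y)] {S : ∀ y, Spec (Fin (m y)) (σ y) (Fin (d y) → ℤ)}

theorem ofFn_get {A B : Type} (l : List A) (f : A → B) :
    List.ofFn (fun i => f (l.get i)) = l.map f := by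
  conv_rhs => rw [← List.ofFn_get l]
  rw [List.map_ofFn]
  rfl

theorem encode_toPA {m d : ℕ} {σ : Type} (S : Spec (Fin m) σ (Fin d → ℤ)) (hne : S.states ≠ [])
    (ψ : ExFormula d) : (S.toPA hne ψ).encode = Data.ofList [Data.unary m, Data.unary d,
      enc (S.states.map fun s => [S.left s, S.init s && !S.left s, S.acc s, S.acc s]),
      enc (S.states.map fun p => (ParikhAutomaton.letters m).map fun a => S.states.map fun q =>
        (S.entry p a q).elim Data.nil fun w => .node .nil (Data.ofVec w)), ψ.encode] := by
  have h₁ : ∀ i, (S.toPA hne ψ).encodeState i = enc [S.left (S.states.get i),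
      S.init (S.states.get i) && !S.left (S.states.get i), S.acc (S.states.get i),
      S.acc (S.states.get i)] := by
    intro i
    have hp : ∀ {p : Prop} {b : Bool}, (p ↔ b = Bool.true) → Data.ofProp p = enc b := by
      intro p b h
      rw [Data.ofProp]
      by_cases hp : p
      · rw [@decide_eq_true _ (_) hp, h.1 hp]
        rfl
      · rw [@decide_eq_false _ (_) hp, Bool.eq_false_iff.2 fun hb => hp (h.2 hb)]
        rfl
    rw [ParikhAutomaton.encodeState, hp (p := (S.toPA hne ψ).aut.side i = Side.L)
        (b := S.left (S.states.get i)) Side.ofBool_eq_L,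
      hp (p := i ∈ (S.toPA hne ψ).aut.halt) (b := S.acc (S.states.get i)) Iff.rfl,
      hp (p := i ∈ (S.toPA hne ψ).aut.acc) (b := S.acc (S.states.get i)) Iff.rfl,
      hp (p := i ∈ (S.toPA hne ψ).aut.init)
        (b := S.init (S.states.get i) && !S.left (S.states.get i)) (by simp [Spec.toPA])]
    rfl
  have h₂ : ∀ i a j, (S.toPA hne ψ).encodeEntry i a j =
      (S.entry (S.states.get i) a (S.states.get j)).elim Data.nil
        fun w => .node .nil (Data.ofVec w) := by
    intro i a j
    rw [ParikhAutomaton.encodeEntry]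
    cases h : S.entry (S.states.get i) a (S.states.get j) with
    | none =>
      rw [dif_neg (fun ht => by
        obtain ⟨w, hw⟩ := Spec.mem_trans_toPA.1 ht
        rw [h] at hw
        simp at hw)]
      rfl
    | some w =>
      have ht : (i, a, j) ∈ (S.toPA hne ψ).aut.trans := Spec.mem_trans_toPA.2 ⟨w, h⟩
      rw [dif_pos ht, Spec.weight_toPA ht h]
      rfl
  rw [ParikhAutomaton.encode]
  simp only [h₁, h₂]
  rw [ofFn_get S.states fun s => enc [S.left s, S.init s && !S.left s, S.acc s, S.acc s]]
  have h₃ : ∀ p a, List.ofFn (fun j => (S.entry p a (S.states.get j)).elim Data.nil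
      fun w => .node .nil (Data.ofVec w)) = S.states.map fun q => (S.entry p a q).elim Data.nil
        fun w => .node .nil (Data.ofVec w) := fun p a =>
    ofFn_get S.states fun q => (S.entry p a q).elim Data.nil fun w => .node .nil (Data.ofVec w)
  simp only [h₃]
  rw [ofFn_get S.states fun p => Data.ofList ((ParikhAutomaton.letters m).map fun a =>
    Data.ofList (S.states.map fun q => (S.entry p a q).elim Data.nil
      fun w => .node .nil (Data.ofVec w)))]
  simp only [enc_map]
  rfl

theorem entry (hleft : PolyTime (ctx e σ) fun z => enc ((S z.1).left z.2))
    (hacc : PolyTime (ctx e σ) fun z => enc ((S z.1).acc z.2))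
    (htr : PolyTime (ctx (ctx (ctx e σ) fun z => Letter (Fin (m z.1))) fun z => σ z.1.1)
      fun z => enc ((S z.1.1.1).tr z.1.1.2 z.1.2 z.2)) :
    PolyTime (ctx (ctx (ctx e σ) fun z => Letter (Fin (m z.1))) fun z => σ z.1.1)
      fun z => enc ((S z.1.1.1).entry z.1.1.2 z.1.2 z.2) := by
  have hp : PolyTime (ctx (ctx (ctx e σ) fun z => Letter (Fin (m z.1))) fun z => σ z.1.1)
      fun z => enc z.1.1.2 := var.lift.lift
  have hq : PolyTime (ctx (ctx (ctx e σ) fun z => Letter (Fin (m z.1))) fun z => σ z.1.1)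
      fun z => enc z.2 := var
  have ha : PolyTime (ctx (ctx (ctx e σ) fun z => Letter (Fin (m z.1))) fun z => σ z.1.1)
      fun z => enc z.1.2 := var.lift
  have he : PolyTime (ctx (ctx (ctx e σ) fun z => Letter (Fin (m z.1))) fun z => σ z.1.1)
      fun z => e z.1.1.1 := id.lift.lift.lift
  let T := Σ z : (Σ z : (Σ y, σ y), Letter (Fin (m z.1))), σ z.1.1
  have hpl := hleft.subst (fun z : T => z.1.1.1) he hp
  have hql := hleft.subst (fun z : T => z.1.1.1) he hq
  have hpa := hacc.subst (fun z : T => z.1.1.1) he hp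
  have hqa := hacc.subst (fun z : T => z.1.1.1) he hq
  refine iteB ?_ htr none
  exact ((hpa.not.and (((eq ha lend).and (hpl.and hql)).not)).and
      (((eq ha rend).and (hpl.not.and (hql.not.and hqa.not))).not)).and
      (hqa.not.or (hpl.not.and (eq ha rend)))

/-- The table of a function of three arguments. -/
theorem map_map_map {A B : Y → Type} [∀ y, Enc (A y)] [∀ y, Enc (B y)] {l : ∀ y, List (A y)}
    {l' : ∀ y, List (B y)} {F : ∀ y, A y → B y → A y → Data} (hl : PolyTime e fun y => enc (l y))
    (hl' : PolyTime e fun y => enc (l' y))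
    (hF : PolyTime (ctx (ctx (ctx e A) fun z => B z.1) fun z => A z.1.1)
      fun z => F z.1.1.1 z.1.1.2 z.1.2 z.2) :
    PolyTime e fun y => enc ((l y).map fun p => (l' y).map fun a => (l y).map fun q =>
      F y p a q) := by
  have h₁ : PolyTime (ctx (ctx e A) fun z => B z.1) fun z =>
      enc ((l z.1.1).map fun q => F z.1.1 z.1.2 z.2 q) :=
    map (B := fun _ => Data) (f := fun (z : Σ z : (Σ y, A y), B z.1) q => F z.1.1 z.1.2 z.2 q)
      hl.lift.lift hF
  have h₂ : PolyTime (ctx e A) fun z =>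
      enc ((l' z.1).map fun a => (l z.1).map fun q => F z.1 z.2 a q) :=
    map (B := fun _ => List Data) (f := fun (z : Σ y, A y) a => (l z.1).map fun q => F z.1 z.2 a q)
      hl'.lift h₁
  exact map (B := fun _ => List (List Data)) (f := fun y p =>
    (l' y).map fun a => (l y).map fun q => F y p a q) hl h₂

/-- An automaton given by lists and Boolean functions is computable if these are. -/
theorem toPA {hne : ∀ y, (S y).states ≠ []} {ψ : ∀ y, ExFormula (d y)}
    (hm : PolyTime e fun y => enc (m y)) (hd : PolyTime e fun y => enc (d y))
    (hψ : PolyTime e fun y => (ψ y).encode) (hs : PolyTime e fun y => enc (S y).states)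
    (hleft : PolyTime (ctx e σ) fun z => enc ((S z.1).left z.2))
    (hinit : PolyTime (ctx e σ) fun z => enc ((S z.1).init z.2))
    (hacc : PolyTime (ctx e σ) fun z => enc ((S z.1).acc z.2))
    (htr : PolyTime (ctx (ctx (ctx e σ) fun z => Letter (Fin (m z.1))) fun z => σ z.1.1)
      fun z => enc ((S z.1.1.1).tr z.1.1.2 z.1.2 z.2)) :
    PolyTime e fun y => ((S y).toPA (hne y) (ψ y)).encode := by
  have hinfo : PolyTime e fun y => enc ((S y).states.map fun s =>
      [(S y).left s, (S y).init s && !(S y).left s, (S y).acc s, (S y).acc s]) :=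
    map (B := fun _ => List Bool) (f := fun y s =>
      [(S y).left s, (S y).init s && !(S y).left s, (S y).acc s, (S y).acc s]) hs
      (hleft.cons ((hinit.and hleft.not).cons (hacc.cons (hacc.cons list_nil))))
  have hentry := entry hleft hacc htr
  have hcell : PolyTime (ctx (ctx (ctx e σ) fun z => Letter (Fin (m z.1))) fun z => σ z.1.1)
      fun z => ((S z.1.1.1).entry z.1.1.2 z.1.2 z.2).elim Data.nil
        fun w => .node .nil (Data.ofVec w) :=
    elimData (s := fun _ w => .node .nil (Data.ofVec w)) hentry nil
      (nil.node (ofVec hd.lift.lift.lift.lift var))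
  have htable := map_map_map (F := fun y p a q => ((S y).entry p a q).elim Data.nil
    fun w => .node .nil (Data.ofVec w)) hs (letters hm) hcell
  have hall := hm.node (hd.node (hinfo.node (htable.node (hψ.node nil))))
  refine hall.congr fun y => ?_
  rw [encode_toPA]
  rfl

end output

end PolyTime

/-! ### A program that computes crossing sequences -/

namespace ParikhAutomaton

variable {m n d : ℕ} (P : ParikhAutomaton (Fin m) (Fin n) d)

theorem suffix_of_replayStep {a : Letter (Fin m)} {s s' : Bool × List (Fin n) × List (Fin n)}
    (h : P.replayStep a s = some s') : s'.2.1 <:+ s.2.1 ∧ s'.2.2 <:+ s.2.2 := by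
  simp only [replayStep] at h
  split_ifs at h
  all_goals
    obtain ⟨q, -, h⟩ := Option.bind_eq_some_iff.1 h
    split_ifs at h
  on_goal 2 => obtain ⟨t, -, h⟩ := Option.bind_eq_some_iff.1 h; split_ifs at h
  on_goal 4 => obtain ⟨t, -, h⟩ := Option.bind_eq_some_iff.1 h; split_ifs at h
  all_goals
    obtain rfl := Option.some.inj h
    simp [List.tail_suffix]

/-- A replay only removes visits, which bounds the data of the program for `matchB`. -/
theorem suffix_of_foldl_replayStep {a : Letter (Fin m)} (u : List (Fin n))
    {s s' : Bool × List (Fin n) × List (Fin n)}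
    (h : u.foldl (fun o _ => o.bind (P.replayStep a)) (some s) = some s') :
    s'.2.1 <:+ s.2.1 ∧ s'.2.2 <:+ s.2.2 := by
  induction u using List.reverseRecOn generalizing s' with
  | nil =>
    obtain rfl := Option.some.inj h
    simp
  | append_singleton u q ih =>
    rw [List.foldl_append] at h
    obtain ⟨t, h₁, h₂⟩ := Option.bind_eq_some_iff.1 h
    exact ⟨(P.suffix_of_replayStep h₂).1.trans (ih h₁).1,
      (P.suffix_of_replayStep h₂).2.trans (ih h₁).2⟩

/-- The number of a kind. -/
def Kind.index : Kind → ℕ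
  | .inner => 0
  | .final => 1
  | .special => 2

instance : Enc Kind := ⟨fun k => enc k.index⟩

instance : EncInj Kind := ⟨fun k k' h => by
  have := EncInj.inj (A := ℕ) h
  cases k <;> cases k' <;> simp_all [Kind.index]⟩

end ParikhAutomaton

open TwoWayParikh.ParikhAutomaton (Kind)

namespace PolyTime

variable {Y : Type} {e : Y → Data} {m n d : Y → ℕ}
  {P : ∀ y, ParikhAutomaton (Fin (m y)) (Fin (n y)) (d y)}

section

variable {p : ∀ y, Fin (n y)} {a : ∀ y, Letter (Fin (m y))} {l r : ∀ y, List (Fin (n y))}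
  {s s' : ∀ y, Kind × List (Fin (n y))}

theorem kind (k : Kind) : PolyTime e fun _ => enc k := const (enc k)

theorem trivB (hP : PolyTime e fun y => (P y).encode) : PolyTime e fun y => enc (P y).trivB :=
  any (A := fun y => Fin (n y)) (p := fun y q => (P y).initB q && (P y).accB q)
    hP.numStates.finRange ((hP.lift.initB var).and (hP.lift.accB var))

theorem target (hP : PolyTime e fun y => (P y).encode)
    (hb : PolyBdd e fun y => 2 ^ (P y).encode.size) (hp : PolyTime e fun y => enc (p y))
    (ha : PolyTime e fun y => enc (a y)) : PolyTime e fun y => enc ((P y).succ (p y) (a y)) :=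
  head? (flatMap (A := fun y => Fin (n y)) (B := fun y => Fin (n y) × (Fin (d y) → ℤ))
    (f := fun y q => ((P y).tr (p y) (a y) q).elim [] fun w => [(q, w)]) hP.numStates.finRange
    (elim (B := fun z : Σ y, Fin (n y) => List (Fin (n z.1) × (Fin (d z.1) → ℤ)))
      (s := fun z w => [(z.2, w)])
      (hP.lift.tr hb.lift hp.lift ha.lift var) list_nil ((var.lift.prod var).cons list_nil)))

theorem replayStep {s : ∀ y, Bool × List (Fin (n y)) × List (Fin (n y))}
    (hP : PolyTime e fun y => (P y).encode) (hb : PolyBdd e fun y => 2 ^ (P y).encode.size)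
    (ha : PolyTime e fun y => enc (a y)) (hs : PolyTime e fun y => enc (s y)) :
    PolyTime e fun y => enc ((P y).replayStep (a y) (s y)) := by
  have hl := hs.prod_snd.prod_fst
  have hr := hs.prod_snd.prod_snd
  refine iteB hs.prod_fst ?_ ?_
  · refine option_bind (A := fun y => Fin (n y)) (head? hr) (iteB ?_ ?_ ?_)
    · exact (hP.lift.accB var).or (hP.lift.leftB var).not
    · exact some (true.prod (hl.lift.prod (tail hr.lift)))
    · refine option_bind (target hP.lift hb.lift var ha.lift) (ite (eq ?_ ?_) ?_ none)
      · exact head? hl.lift.lift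
      · exact some var.prod_fst
      · exact some (false.prod (hl.lift.lift.prod (tail hr.lift.lift)))
  · refine option_bind (A := fun y => Fin (n y)) (head? hl) (iteB ?_ ?_ ?_)
    · exact hP.lift.leftB var
    · exact some (false.prod ((tail hl.lift).prod hr.lift))
    · refine option_bind (target hP.lift hb.lift var ha.lift) (ite (eq ?_ ?_) ?_ none)
      · exact head? hr.lift.lift
      · exact some var.prod_fst
      · exact some (true.prod ((tail hl.lift.lift).prod hr.lift.lift))

theorem matchB (hP : PolyTime e fun y => (P y).encode)
    (hb : PolyBdd e fun y => 2 ^ (P y).encode.size) (ha : PolyTime e fun y => enc (a y))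
    (hl : PolyTime e fun y => enc (l y)) (hr : PolyTime e fun y => enc (r y)) :
    PolyTime e fun y => enc ((P y).matchB (a y) (l y) (r y)) := by
  refine eq ?_ (some (true.prod (list_nil.prod list_nil)))
  refine foldl (A := fun y => Fin (n y))
    (B := fun y => Option (Bool × List (Fin (n y)) × List (Fin (n y))))
    (f := fun y o _ => o.bind ((P y).replayStep (a y)))
    (g := fun y => (enc (l y)).size + (enc (r y)).size + 7) (append hl hr)
    (some (false.prod (hl.prod hr))) ?_ ?_ ?_
  · exact option_bind (s := fun (z : Σ z : (Σ y, Option (Bool × List (Fin (n y)) ×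
        List (Fin (n y)))), Fin (n z.1)) t => (P z.1.1).replayStep (a z.1.1) t) var.lift
      (replayStep hP.lift.lift.lift hb.lift.lift.lift ha.lift.lift.lift var)
  · exact (hl.size.add hr.size).add (.const 7)
  · intro y u _
    cases h : u.foldl (fun o _ => Option.bind o ((P y).replayStep (a y)))
        (Option.some (Bool.false, l y, r y)) with
    | none => simp [enc, Data.size]
    | some t =>
      obtain ⟨h₁, h₂⟩ := (P y).suffix_of_foldl_replayStep u h
      have h₃ := size_enc_le_of_sublist h₁.sublist
      have h₄ := size_enc_le_of_sublist h₂.sublist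
      have h₅ := size_enc_bool t.1
      have h₆ : (enc (.some t : Option (Bool × List (Fin (n y)) × List (Fin (n y))))).size =
          1 + ((enc t.1).size + ((enc t.2.1).size + (enc t.2.2).size + 1) + 1) + 1 := rfl
      rw [h₆]
      dsimp only at h₃ h₄
      omega

theorem lastB (hP : PolyTime e fun y => (P y).encode) (hl : PolyTime e fun y => enc (l y)) :
    PolyTime e fun y => enc ((P y).lastB (l y)) :=
  and (elim (s := fun y q => (P y).accB q) (head? (reverse hl)) false (hP.lift.accB var))
    (all (p := fun y q => (P y).leftB q && !(P y).accB q) (tail (reverse hl))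
      ((hP.lift.leftB var).and (hP.lift.accB var).not))

theorem wt (hP : PolyTime e fun y => (P y).encode)
    (hb : PolyBdd e fun y => 2 ^ (P y).encode.size) (hp : PolyTime e fun y => enc (p y))
    (ha : PolyTime e fun y => enc (a y)) : PolyTime e fun y => enc ((P y).wt (a y) (p y)) :=
  elim (target hP hb hp ha) (vec_zero hP.dim) var.prod_snd

theorem cellWeight (hP : PolyTime e fun y => (P y).encode)
    (hb : PolyBdd e fun y => 2 ^ (P y).encode.size) (ha : PolyTime e fun y => enc (a y))
    (hl : PolyTime e fun y => enc (l y)) (hr : PolyTime e fun y => enc (r y)) :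
    PolyTime e fun y => enc ((P y).cellWeight (a y) (l y) (r y)) := by
  refine vec_add hP.dim (vec_sum hP.dim ?_) (vec_sum hP.dim ?_)
  · exact map (f := fun y q => (P y).wt (a y) q) (filter (p := fun y q => !(P y).leftB q) hl
      (hP.lift.leftB var).not) (wt hP.lift hb.lift var ha.lift)
  · exact map (f := fun y q => (P y).wt (a y) q)
      (filter (p := fun y q => (P y).leftB q && !(P y).accB q) hr
        ((hP.lift.leftB var).and (hP.lift.accB var).not)) (wt hP.lift hb.lift var ha.lift)

theorem crossTr (hP : PolyTime e fun y => (P y).encode)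
    (hb : PolyBdd e fun y => 2 ^ (P y).encode.size) (hs : PolyTime e fun y => enc (s y))
    (ha : PolyTime e fun y => enc (a y)) (hs' : PolyTime e fun y => enc (s' y)) :
    PolyTime e fun y => enc ((P y).crossTr (s y) (a y) (s' y)) := by
  refine iteB ?_ (some (cellWeight hP hb ha hs.prod_snd hs'.prod_snd)) none
  exact ((((eq hs.prod_fst (kind _)).and (eq hs'.prod_fst (kind _)).not).and
    (beq (eq ha rend) (eq hs'.prod_fst (kind _)))).and
    ((eq ha rend).not.or (lastB hP hs'.prod_snd))).and (matchB hP hb ha hs.prod_snd hs'.prod_snd)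

theorem crossInit (hP : PolyTime e fun y => (P y).encode) (hs : PolyTime e fun y => enc (s y)) :
    PolyTime e fun y => enc ((P y).crossInit (s y)) := by
  refine iteB hP.trivB ((eq hs.prod_fst (kind _)).and (eq hs.prod_snd list_nil))
    (((eq hs.prod_fst (kind _)).and ?_).and ?_)
  · exact elim (s := fun y q => (P y).initB q) (head? hs.prod_snd) false (hP.lift.initB var)
  · exact all (p := fun y q => !(P y).leftB q) hs.prod_snd (hP.lift.leftB var).not

end

theorem numStates_lt_size {m n d : ℕ} (P : ParikhAutomaton (Fin m) (Fin n) d) :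
    n < P.encode.size := by
  have h := length_lt_size (table P)
  rw [table, List.length_map, List.length_finRange] at h
  exact h.trans_le (size_enc_table_le P)

theorem toUPA (hP : PolyTime e fun y => (P y).encode)
    (hb : PolyBdd e fun y => 2 ^ ((P y).encode.size * (P y).encode.size)) :
    PolyTime e fun y => (P y).toUPA.encode := by
  have hb' : PolyBdd e fun y => 2 ^ (P y).encode.size := hb.mono fun y =>
    Nat.pow_le_pow_right (by norm_num) (Nat.le_mul_self _)
  have hw : PolyBdd e fun y => ((List.finRange (n y)).length + 1) ^ n y := hb.mono fun y => by
    rw [List.length_finRange, pow_mul]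
    have h₁ := numStates_lt_size (P y)
    refine (Nat.pow_le_pow_left ?_ _).trans (Nat.pow_le_pow_right (by positivity) h₁.le)
    exact (Nat.succ_le_of_lt h₁).trans Nat.lt_two_pow_self.le
  refine toPA (S := fun y => (P y).crossSpec) (σ := fun y => Kind × List (Fin (n y)))
    hP.numLetters hP.dim hP.constraint ?_ ?_ ?_ ?_ ?_
  · refine flatMap (A := fun _ => Kind) (l := fun _ => [Kind.inner, .final, .special])
      (f := fun y k => (ParikhAutomaton.words (List.finRange (n y)) (n y)).map fun l => (k, l))
      ((kind _).cons ((kind _).cons ((kind _).cons list_nil))) ?_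
    exact map (f := fun (z : Σ _, Kind) l => (z.2, l))
      (words hP.numStates.finRange hP.numStates hw).lift (var.lift.prod var)
  · exact false
  · exact crossInit hP.lift var
  · exact (eq var.prod_fst (kind _)).not
  · exact crossTr hP.lift.lift.lift hb'.lift.lift.lift var.lift.lift var.lift var

end PolyTime

/-- The conversions run on the encoding of an automaton, padded with a tree of exponential size. -/
theorem polyBdd_padding {Y : Type} (e : Y → Data) :
    PolyBdd (fun y => .node (e y) (fullTree ((e y).size * (e y).size)))
      fun y => 2 ^ ((e y).size * (e y).size) :=
  PolyBdd.self.mono fun y => by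
    have := size_fullTree ((e y).size * (e y).size)
    rw [pow_succ] at this
    simp only [Data.size]
    omega

theorem exists_prog_toUPA : ∃ (prog : Prog) (time : Polynomial ℕ),
    ∀ (m n d : ℕ) (P : ParikhAutomaton (Fin m) (Fin n) d), ∃ c,
      prog.Runs P.encode P.toUPA.encode c ∧ c ≤ 2 ^ time.eval P.encode.size := by
  obtain ⟨prog, time, h⟩ := exists_prog_of_polyTime
    (Y := Σ m n d, ParikhAutomaton (Fin m) (Fin n) d) (e := fun y => y.2.2.2.encode)
    (f := fun y => y.2.2.2.toUPA.encode) (PolyTime.id.fst.toUPA (polyBdd_padding _))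
  exact ⟨prog, time, fun m n d P => h ⟨m, n, d, P⟩⟩

/-! ### A program that computes reversible automata -/

/-- The number of a mode. -/
def Mode.index : Mode → ℕ
  | .start => 0
  | .scan => 1
  | .back => 2
  | .look => 3
  | .hunt => 4
  | .hop => 5
  | .race => 6
  | .edge => 7
  | .home => 8
  | .fin => 9

instance : Enc Mode := ⟨fun t => enc t.index⟩

instance : EncInj Mode := ⟨fun t t' h => by
  have := EncInj.inj (A := ℕ) h
  cases t <;> cases t' <;> simp_all [Mode.index]⟩

/-- The number of a phase. -/
def Machine.Phase.index : Machine.Phase → ℕ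
  | .up => 0
  | .down => 1
  | .cross => 2
  | .turn => 3

instance : Enc Machine.Phase := ⟨fun t => enc t.index⟩

instance : EncInj Machine.Phase := ⟨fun t t' h => by
  have := EncInj.inj (A := ℕ) h
  cases t <;> cases t' <;> simp_all [Machine.Phase.index]⟩

/-- The states of the machine that runs a one-way automaton with states `Fin n` backwards. -/
abbrev LookStateFin (m n : ℕ) : Type :=
  LookState (Fin m) (Fin n) (List (Fin n)) (List (Fin n × Fin n))

instance {m n : ℕ} : Enc (LookStateFin m n) := ⟨fun s => enc (s.mode, s.x, s.z, s.m, s.q, s.a)⟩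

instance {m n : ℕ} : EncInj (LookStateFin m n) := ⟨fun s s' h => by
  have := EncInj.inj (A := Mode × List (Fin n) × List (Fin n) × List (Fin n × Fin n) ×
    Option (Fin n) × Letter (Fin m)) h
  cases s
  cases s'
  simp_all⟩

/-- The automaton `P y` is computable from `y`, whose encoding is padded so that the size of
objects like the set of all relations on the states of `P y` is polynomial. -/
structure Padded {Y : Type} {m n d : Y → ℕ} (e : Y → Data)
    (P : ∀ y, ParikhAutomaton (Fin (m y)) (Fin (n y)) (d y)) : Prop where
  poly : PolyTime e fun y => (P y).encode
  bdd : PolyBdd e fun y => 2 ^ ((P y).encode.size * (P y).encode.size)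

namespace Padded

variable {Y : Type} {m n d : Y → ℕ} {e : Y → Data}
    {P : ∀ y, ParikhAutomaton (Fin (m y)) (Fin (n y)) (d y)}

theorem lift (h : Padded e P) {A : Y → Type} [∀ y, Enc (A y)] :
    Padded (ctx e A) fun z => P z.1 := ⟨h.poly.lift, h.bdd.lift⟩

theorem bdd_two_pow (h : Padded e P) : PolyBdd e fun y => 2 ^ (P y).encode.size :=
  h.bdd.mono fun _ => Nat.pow_le_pow_right (by norm_num) (Nat.le_mul_self _)

end Padded

/-- The step function of the machine without pattern matching. -/
theorem LookData.step_eq {α Q W X M : Type*} [Zero W] (D : LookData α Q W X M)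
    (s : LookState α Q X M) (b : Letter α) {inst : ∀ a : Letter α, Decidable (b = a)}
    {inst' : Decidable (D.δ s.x b = D.δ s.z b)} : D.step s b =
    if s.mode = .start then
      if b = .lend then some (D.walk .scan (D.δ D.x₀ b) none, 0) else none
    else if s.mode = .scan then if b = .lend then none else if b = .rend then
        (D.pickEnd s.x).map fun pw => (D.walk .back s.x (some pw.1), pw.2)
      else some (D.walk .scan (D.δ s.x b) none, 0)
    else if s.mode = .back then if b = .lend then none else some (D.walk .look s.x s.q, 0)
    else if s.mode = .look then if b = .rend then none else if b = .lend then
        (s.q.bind (D.pick D.x₀ b)).map fun pw => (D.idle .edge, pw.2)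
      else (sole (D.cand s.x b D.one)).elim (some (D.hunting s.x s.q D.one b, 0)) fun y =>
        D.lookStep y b s.q .look
    else if s.mode = .hunt then if b = .rend then none else
      (if b = .lend then some (D.act D.x₀ (D.cns b s.m))
        else sole (D.cand s.x s.a (D.cns b s.m))).elim
      (some (D.hunting s.x s.q (D.cns b s.m) s.a, 0)) (D.raceStep s.x s.q s.m s.a)
    else if s.mode = .hop then if b = .rend then none else some (D.duo .race s.x s.z s.q, 0)
    else if s.mode = .race then if b = .lend then none else if b = .rend then none else
      if D.δ s.x b = D.δ s.z b then D.lookStep s.x b s.q .back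
      else some (D.duo .race (D.δ s.x b) (D.δ s.z b) s.q, 0)
    else if s.mode = .edge then if b = .lend then some (D.idle .home, 0) else none
    else if s.mode = .home then if b = .lend then none else
      if b = .rend then some (D.idle .fin, 0) else some (D.idle .home, 0)
    else none := by
  cases h : s.mode <;> simp only [step, h, reduceCtorEq, if_false, if_true] <;> congr

namespace PolyTime

variable {Y : Type} {e : Y → Data} {m n d : Y → ℕ}
  {P : ∀ y, ParikhAutomaton (Fin (m y)) (Fin (n y)) (d y)}

section lists

variable {A : Y → Type} [∀ y, Enc (A y)] {l : ∀ y, List (A y)}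

theorem find? {p : ∀ y, A y → Bool} (hl : PolyTime e fun y => enc (l y))
    (hp : PolyTime (ctx e A) fun z => enc (p z.1 z.2)) :
    PolyTime e fun y => enc ((l y).find? (p y)) :=
  (head? (filter hl hp)).congr fun y => by rw [List.head?_filter]

theorem sole (hl : PolyTime e fun y => enc (l y)) : PolyTime e fun y => enc (sole (l y)) :=
  iteB (isEmpty (tail hl)) (head? hl) none

variable [∀ y, EncInj (A y)] {a : ∀ y, A y}

theorem mem {inst : ∀ y, Decidable (a y ∈ l y)} (ha : PolyTime e fun y => enc (a y))
    (hl : PolyTime e fun y => enc (l y)) : PolyTime e fun y => enc (decide (a y ∈ l y)) := by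
  classical
  refine (any (p := fun y b => decide (a y = b)) hl (eq ha.lift var)).congr fun y => ?_
  congr 1
  rw [Bool.eq_iff_iff]
  simp

/-- Lists are searched by a fold that remembers whether `a y` has been seen and what followed it. -/
theorem next {inst : ∀ y, DecidableEq (A y)} (ha : PolyTime e fun y => enc (a y))
    (hl : PolyTime e fun y => enc (l y)) :
    PolyTime e fun y => enc (TwoWayParikh.next (a y) (l y)) := by
  have hf : ∀ {A : Type} [DecidableEq A] (a : A) (l : List A),
      (l.foldl (fun (s : Bool × Option A) b => if s.2.isSome then s else
        if s.1 then (Bool.true, .some b) else (decide (b = a), Option.none))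
          (Bool.false, Option.none)).2 = TwoWayParikh.next a l := by
    intro A _ a l
    have h₁ : ∀ (l : List A) c b, l.foldl (fun (s : Bool × Option A) b => if s.2.isSome then s else
        if s.1 then (Bool.true, .some b) else (decide (b = a), Option.none)) (c, .some b) =
        (c, .some b) := by
      intro l c b
      induction l with
      | nil => rfl
      | cons b' l ih => exact ih
    induction l with
    | nil => rfl
    | cons b l ih =>
      rw [List.foldl_cons, TwoWayParikh.next]
      by_cases hb : b = a
      · cases l with
        | nil => simp [hb]
        | cons b' l => simpa [hb] using congrArg Prod.snd (h₁ l Bool.true b')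
      · simpa [hb] using ih
  refine (prod_snd (A := fun _ => Bool) (B := fun y => Option (A y))
    (foldl (b := fun _ => (Bool.false, Option.none))
    (f := fun y (s : Bool × Option (A y)) b => if s.2.isSome = Bool.true then s else
        if s.1 = Bool.true then (Bool.true, .some b) else (decide (b = a y), Option.none))
    (g := fun y => (enc (l y)).size + 6) hl (false.prod none)
    ?_ (hl.size.add (.const 6)) ?_)).congr fun y => ?_
  · exact iteB (isSome (prod_snd var.lift)) var.lift (iteB (prod_fst var.lift)
      (true.prod (some var)) ((eq var ha.lift.lift).prod none))
  · rintro y l₁ ⟨l₂, h⟩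
    rw [size_enc_prod, hf]
    have h₁ := size_enc_bool (l₁.foldl (fun (s : Bool × Option (A y)) b =>
      if s.2.isSome then s else if s.1 then (Bool.true, .some b)
        else (decide (b = a y), Option.none)) (Bool.false, Option.none)).1
    have h₂ : (enc (TwoWayParikh.next (a y) l₁)).size ≤ (enc (l y)).size + 2 := by
      cases hn : TwoWayParikh.next (a y) l₁ with
      | none => simp [enc, Data.size]
      | some b =>
        have hb : b ∈ l y := h ▸ List.mem_append_left _ (List.mem_of_mem_tail (next_mem hn))
        have := size_lt_of_mem hb
        have h₃ : (enc (Option.some b)).size = 1 + (enc b).size + 1 := rfl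
        omega
    omega
  · rw [hf]

end lists

section look

variable {x x' z : ∀ y, List (Fin (n y))} {r : ∀ y, List (Fin (n y) × Fin (n y))}
  {a b : ∀ y, Letter (Fin (m y))} {q : ∀ y, Fin (n y)} {o : ∀ y, Option (Fin (n y))}
  {s : ∀ y, LookStateFin (m y) (n y)} {t : Y → Mode}

theorem pairs (hn : PolyTime e fun y => enc (n y)) :
    PolyTime e fun y => enc (ParikhAutomaton.pairs (n y)) :=
  flatMap (f := fun y p => (List.finRange (n y)).map fun q => (p, q)) hn.finRange
    (map (f := fun (z : Σ y, Fin (n y)) q => (z.2, q)) hn.finRange.lift (var.lift.prod var))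

theorem mode (t : Mode) : PolyTime e fun _ => enc t := const (enc t)

theorem phase (t : Machine.Phase) : PolyTime e fun _ => enc t := const (enc t)

theorem lookXs (h : Padded e P) : PolyTime e fun y => enc (P y).lookData.xs :=
  sublists' h.poly.numStates.finRange (h.bdd_two_pow.mono fun y => by
    rw [List.length_finRange]
    exact Nat.pow_le_pow_right (by norm_num) (numStates_lt_size _).le)

theorem lookMs (h : Padded e P) : PolyTime e fun y => enc (P y).lookData.ms :=
  sublists' (pairs h.poly.numStates) (h.bdd.mono fun y => by
    have hl : (ParikhAutomaton.pairs (n y)).length = n y * n y := by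
      simp [ParikhAutomaton.pairs, List.length_flatMap]
    have hn := (numStates_lt_size (P y)).le
    rw [hl]
    exact Nat.pow_le_pow_right (by norm_num) (Nat.mul_le_mul hn hn))

theorem lookδ (h : Padded e P) (hx : PolyTime e fun y => enc (x y))
    (ha : PolyTime e fun y => enc (a y)) :
    PolyTime e fun y => enc ((P y).lookData.δ (x y) (a y)) :=
  filter (p := fun y q => (x y).any fun p => ((P y).tr p (a y) q).isSome) h.poly.numStates.finRange
    (any (p := fun (z : Σ y, Fin (n y)) p => ((P z.1).tr p (a z.1) z.2).isSome) hx.lift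
      (isSome (tr h.lift.lift.poly h.lift.lift.bdd_two_pow var ha.lift.lift var.lift)))

theorem lookInit (h : Padded e P) : PolyTime e fun y => enc (P y).lookData.x₀ :=
  filter h.poly.numStates.finRange (h.poly.lift.initB var)

theorem lookAct (h : Padded e P) (hx : PolyTime e fun y => enc (x y))
    (hr : PolyTime e fun y => enc (r y)) :
    PolyTime e fun y => enc ((P y).lookData.act (x y) (r y)) :=
  filter (p := fun y q => (x y).any fun p => decide ((p, q) ∈ r y)) h.poly.numStates.finRange
    (any (p := fun (z : Σ y, Fin (n y)) p => decide ((p, z.2) ∈ r z.1)) hx.lift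
      (mem (var.prod var.lift) hr.lift.lift))

theorem lookOne (h : Padded e P) : PolyTime e fun y => enc (P y).lookData.one :=
  filter (pairs h.poly.numStates) (eq var.prod_fst var.prod_snd)

theorem lookCns (h : Padded e P) (ha : PolyTime e fun y => enc (a y))
    (hr : PolyTime e fun y => enc (r y)) :
    PolyTime e fun y => enc ((P y).lookData.cns (a y) (r y)) :=
  filter (p := fun y (t : Fin (n y) × Fin (n y)) => (List.finRange (n y)).any fun q =>
      ((P y).tr t.1 (a y) q).isSome && decide ((q, t.2) ∈ r y)) (pairs h.poly.numStates)
    (any (p := fun (z : Σ y, Fin (n y) × Fin (n y)) q =>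
        ((P z.1).tr z.2.1 (a z.1) q).isSome && decide ((q, z.2.2) ∈ r z.1))
      h.poly.numStates.finRange.lift
      ((isSome (tr h.lift.lift.poly h.lift.lift.bdd_two_pow (prod_fst var.lift) ha.lift.lift
        var)).and (mem (var.prod (prod_snd var.lift)) hr.lift.lift)))

theorem lookPick (h : Padded e P) (hx : PolyTime e fun y => enc (x y))
    (ha : PolyTime e fun y => enc (a y)) (hq : PolyTime e fun y => enc (q y)) :
    PolyTime e fun y => enc ((P y).lookData.pick (x y) (a y) (q y)) :=
  head? (flatMap (A := fun y => Fin (n y)) (B := fun y => Fin (n y) × (Fin (d y) → ℤ))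
    (f := fun y p => ((P y).tr p (a y) (q y)).elim [] fun w => [(p, w)]) hx
    (elim (B := fun z : Σ y, Fin (n y) => List (Fin (n z.1) × (Fin (d z.1) → ℤ)))
      (s := fun z w => [(z.2, w)]) (tr h.lift.poly h.lift.bdd_two_pow var ha.lift hq.lift) list_nil
      ((var.lift.prod var).cons list_nil)))

theorem lookPickEnd (h : Padded e P) (hx : PolyTime e fun y => enc (x y)) :
    PolyTime e fun y => enc ((P y).lookData.pickEnd (x y)) :=
  head? (flatMap (A := fun y => Fin (n y)) (B := fun y => Fin (n y) × (Fin (d y) → ℤ))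
    (f := fun y p => (List.finRange (n y)).flatMap fun f =>
      if (P y).accB f then ((P y).tr p .rend f).elim [] fun w => [(p, w)] else []) hx
    (flatMap (A := fun z : Σ y, Fin (n y) => Fin (n z.1))
      (B := fun z : Σ y, Fin (n y) => Fin (n z.1) × (Fin (d z.1) → ℤ))
      (f := fun (z : Σ y, Fin (n y)) f => if (P z.1).accB f then
        ((P z.1).tr z.2 .rend f).elim [] fun w => [(z.2, w)] else []) h.poly.numStates.finRange.lift
      (iteB (h.poly.lift.lift.accB var)
        (elim (A := fun z : Σ z : (Σ y, Fin (n y)), Fin (n z.1) => Fin (d z.1.1) → ℤ)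
          (B := fun z : Σ z : (Σ y, Fin (n y)), Fin (n z.1) =>
            List (Fin (n z.1.1) × (Fin (d z.1.1) → ℤ))) (s := fun z w => [(z.1.2, w)])
          (tr h.lift.lift.poly h.lift.lift.bdd_two_pow var.lift rend var)
          list_nil ((prod (lift var.lift) var).cons list_nil)) list_nil)))

theorem lookState (ht : PolyTime e fun y => enc (t y)) (hx : PolyTime e fun y => enc (x y))
    (hz : PolyTime e fun y => enc (z y)) (hr : PolyTime e fun y => enc (r y))
    (ho : PolyTime e fun y => enc (o y)) (ha : PolyTime e fun y => enc (a y)) :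
    PolyTime e fun y => enc (⟨t y, x y, z y, r y, o y, a y⟩ : LookStateFin (m y) (n y)) :=
  ht.node (hx.node (hz.node (hr.node (ho.node ha))))

theorem lookState_mode (hs : PolyTime e fun y => enc (s y)) :
    PolyTime e fun y => enc (s y).mode := hs.fst

theorem lookState_x (hs : PolyTime e fun y => enc (s y)) :
    PolyTime e fun y => enc (s y).x := hs.snd.fst

theorem lookState_z (hs : PolyTime e fun y => enc (s y)) :
    PolyTime e fun y => enc (s y).z := hs.snd.snd.fst

theorem lookState_m (hs : PolyTime e fun y => enc (s y)) :
    PolyTime e fun y => enc (s y).m := hs.snd.snd.snd.fst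

theorem lookState_q (hs : PolyTime e fun y => enc (s y)) :
    PolyTime e fun y => enc (s y).q := hs.snd.snd.snd.snd.fst

theorem lookState_a (hs : PolyTime e fun y => enc (s y)) :
    PolyTime e fun y => enc (s y).a := hs.snd.snd.snd.snd.snd

theorem idle (h : Padded e P) (t : Mode) : PolyTime e fun y => enc ((P y).lookData.idle t) :=
  lookState (mode t) (lookInit h) (lookInit h) (lookOne h) none lend

theorem walk (h : Padded e P) (t : Mode) (hx : PolyTime e fun y => enc (x y))
    (ho : PolyTime e fun y => enc (o y)) :
    PolyTime e fun y => enc ((P y).lookData.walk t (x y) (o y)) :=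
  lookState (mode t) hx (lookInit h) (lookOne h) ho lend

theorem duo (h : Padded e P) (t : Mode) (hx : PolyTime e fun y => enc (x y))
    (hz : PolyTime e fun y => enc (z y)) (ho : PolyTime e fun y => enc (o y)) :
    PolyTime e fun y => enc ((P y).lookData.duo t (x y) (z y) (o y)) :=
  lookState (mode t) hx hz (lookOne h) ho lend

theorem hunting (h : Padded e P) (hx : PolyTime e fun y => enc (x y))
    (ho : PolyTime e fun y => enc (o y)) (hr : PolyTime e fun y => enc (r y))
    (ha : PolyTime e fun y => enc (a y)) :
    PolyTime e fun y => enc ((P y).lookData.hunting (x y) (o y) (r y) (a y)) :=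
  lookState (mode .hunt) hx (lookInit h) hr ho ha

theorem cand (h : Padded e P) (hx : PolyTime e fun y => enc (x y))
    (ha : PolyTime e fun y => enc (a y)) (hr : PolyTime e fun y => enc (r y)) :
    PolyTime e fun y => enc ((P y).lookData.cand (x y) (a y) (r y)) := by
  unfold LookData.cand
  refine filter (lookXs h) (and (eq (lookδ h.lift var ha.lift) hx.lift) (any (lookXs h.lift) ?_))
  exact eq (lookAct h.lift.lift var hr.lift.lift) var.lift

theorem lookStep (h : Padded e P) (hx : PolyTime e fun y => enc (x y))
    (ha : PolyTime e fun y => enc (a y)) (ho : PolyTime e fun y => enc (o y)) (t : Mode) :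
    PolyTime e fun y => enc ((P y).lookData.lookStep (x y) (a y) (o y) t) :=
  option_map (A := fun y => Fin (n y) × (Fin (d y) → ℤ))
    (s := fun y pw => ((P y).lookData.walk t (x y) (.some pw.1), pw.2))
    (option_bind (s := fun y q => (P y).lookData.pick (x y) (a y) q) ho
      (lookPick h.lift hx.lift ha.lift var))
    ((walk h.lift t hx.lift (some var.prod_fst)).prod var.prod_snd)

theorem raceStep (h : Padded e P) (hx : PolyTime e fun y => enc (x y))
    (ho : PolyTime e fun y => enc (o y)) (hr : PolyTime e fun y => enc (r y))
    (ha : PolyTime e fun y => enc (a y)) (hz : PolyTime e fun y => enc (z y)) :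
    PolyTime e fun y => enc ((P y).lookData.raceStep (x y) (o y) (r y) (a y) (z y)) := by
  unfold LookData.raceStep
  refine option_bind (find? (lookXs h) (eq (lookAct h.lift var hr.lift) hz.lift))
    (option_map (find? (lookXs h.lift) ?_) ?_)
  · have hact := lookAct (x := fun z : Σ y : (Σ y, List (Fin (n y))), List (Fin (n y.1)) => z.2)
      h.lift.lift var hr.lift.lift
    exact (eq hact hz.lift.lift).not.and (eq (lookδ h.lift.lift hact ha.lift.lift) hx.lift.lift)
  · exact (duo h.lift.lift .hop var.lift var ho.lift.lift).prod (vec_zero h.lift.lift.poly.dim)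

theorem step (h : Padded e P) (hs : PolyTime e fun y => enc (s y))
    (hb : PolyTime e fun y => enc (b y)) :
    PolyTime e fun y => enc ((P y).lookData.step (s y) (b y)) := by
  classical
  have h₀ := vec_zero h.poly.dim
  have hx := lookState_x hs
  have hz := lookState_z hs
  have hr := lookState_m hs
  have hq := lookState_q hs
  have ha := lookState_a hs
  have hl : PolyTime e fun y => enc (decide (b y = .lend)) := eq hb lend
  have hr' : PolyTime e fun y => enc (decide (b y = .rend)) := eq hb rend
  have hm : ∀ t, PolyTime e fun y => enc (decide ((s y).mode = t)) := fun t =>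
    eq (lookState_mode hs) (mode t)
  simp only [LookData.step_eq]
  refine ite (hm _) ?_ (ite (hm _) ?_ (ite (hm _) ?_ (ite (hm _) ?_ (ite (hm _) ?_
    (ite (hm _) ?_ (ite (hm _) ?_ (ite (hm _) ?_ (ite (hm _) ?_ none))))))))
  · exact ite hl (some ((walk h .scan (lookδ h (lookInit h) hb) none).prod h₀)) none
  · refine ite hl none (ite hr' ?_ (some ((walk h .scan (lookδ h hx hb) none).prod h₀)))
    exact option_map (lookPickEnd h hx)
      ((walk h.lift .back hx.lift (some var.prod_fst)).prod var.prod_snd)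
  · exact ite hl none (some ((walk h .look hx hq).prod h₀))
  · refine ite hr' none (ite hl ?_ ?_)
    · exact option_map (option_bind hq (lookPick h.lift (lookInit h.lift) hb.lift var))
        ((idle h.lift .edge).prod var.prod_snd)
    · exact elim (sole (cand h hx hb (lookOne h)))
        (some ((hunting h hx hq (lookOne h) hb).prod h₀))
        (lookStep h.lift var hb.lift hq.lift .look)
  · have hc := lookCns h hb hr
    exact ite hr' none (elim
      (ite hl (some (lookAct h (lookInit h) hc)) (sole (cand h hx ha hc)))
      (some ((hunting h hx hq hc ha).prod h₀))
      (raceStep h.lift hx.lift hq.lift hr.lift ha.lift var))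
  · exact ite hr' none (some ((duo h .race hx hz hq).prod h₀))
  · refine ite hl none (ite hr' none (ite (eq (lookδ h hx hb) (lookδ h hz hb)) ?_ ?_))
    · exact lookStep h hx hb hq .back
    · exact some ((duo h .race (lookδ h hx hb) (lookδ h hz hb) hq).prod h₀)
  · exact ite hl (some ((idle h .home).prod h₀)) none
  · exact ite hl none (ite hr' (some ((idle h .fin).prod h₀)) (some ((idle h .home).prod h₀)))

end look

end PolyTime

/-- The step function of the tour without pattern matching. -/
theorem Machine.tourStep_eq {α σ W : Type*} [DecidableEq σ] [AddCommGroup W] (M : Machine α σ W)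
    (s : Phase × σ) (a : Letter α) : M.tourStep s a =
    if s.1 = .up then (M.step s.2 a).map fun t =>
      (((next s.2 (M.preds t.1 a)).elim (.up, t.1) fun p' => (.cross, p')), t.2)
    else if s.1 = .down then (M.preds s.2 a).head?.elim (some ((.turn, s.2), 0)) fun p =>
      (M.step p a).map fun t => ((.down, p), -t.2)
    else if s.1 = .cross then (M.step s.2 a).bind fun t =>
      if (M.preds t.1 a).head? = some s.2 then none else some ((.down, s.2), -t.2)
    else if (M.preds s.2 a).head? = none then some ((.up, s.2), 0) else none := by
  obtain ⟨_ | _, _⟩ := s <;> rfl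

theorem Machine.tour_left_eq {α σ W : Type*} [DecidableEq σ] [AddCommGroup W] (M : Machine α σ W)
    (s : Phase × σ) : M.tour.left s =
    if s.1 = .up then M.left s.2 else if s.1 = .down then !M.back s.2
    else if s.1 = .cross then !M.left s.2 else M.back s.2 := by
  obtain ⟨_ | _, _⟩ := s <;> rfl

namespace PolyTime

variable {Y : Type} {e : Y → Data} {m n d : Y → ℕ}
  {P : ∀ y, ParikhAutomaton (Fin (m y)) (Fin (n y)) (d y)}

section look

variable {a : ∀ y, Letter (Fin (m y))} {s : ∀ y, LookStateFin (m y) (n y)}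
  {p p' : ∀ y, Machine.Phase × LookStateFin (m y) (n y)}

theorem machine_states (h : Padded e P) : PolyTime e fun y => enc (P y).lookMachine.states :=
  map (A := fun y => Mode × List (Fin (n y)) × List (Fin (n y)) × List (Fin (n y) × Fin (n y)) ×
      Option (Fin (n y)) × Letter (Fin (m y)))
    (B := fun y => LookStateFin (m y) (n y))
    (f := fun _ t => ⟨t.1, t.2.1, t.2.2.1, t.2.2.2.1, t.2.2.2.2.1, t.2.2.2.2.2⟩)
    (product (const (enc LookData.modes)) (product (lookXs h) (product (lookXs h)
      (product (lookMs h) (product (none.cons (map (f := fun _ q => Option.some q)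
        h.poly.numStates.finRange (some var))) (letters h.poly.numLetters)))))) var

theorem machine_left (hs : PolyTime e fun y => enc (s y)) :
    PolyTime e fun y => enc ((P y).lookMachine.left (s y)) :=
  have h := fun t => eq (lookState_mode hs) (mode t)
  ((h _).or (h _)).or (h _)

theorem machine_back (hs : PolyTime e fun y => enc (s y)) :
    PolyTime e fun y => enc ((P y).lookMachine.back (s y)) :=
  have h := fun t => eq (lookState_mode hs) (mode t)
  ((((h _).or (h _)).or (h _)).or (h _)).or (h _)

theorem machine_start (h : Padded e P) : PolyTime e fun y => enc (P y).lookMachine.start :=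
  iteB h.poly.trivB (idle h .fin) (idle h .start)

theorem machine_fin (h : Padded e P) : PolyTime e fun y => enc (P y).lookMachine.fin :=
  idle h .fin

theorem machine_step (h : Padded e P) (hs : PolyTime e fun y => enc (s y))
    (ha : PolyTime e fun y => enc (a y)) :
    PolyTime e fun y => enc ((P y).lookMachine.step (s y) (a y)) :=
  step h hs ha

theorem machine_preds (h : Padded e P) (hs : PolyTime e fun y => enc (s y))
    (ha : PolyTime e fun y => enc (a y)) :
    PolyTime e fun y => enc ((P y).lookMachine.preds (s y) (a y)) := by
  unfold Machine.preds
  exact filter (machine_states h)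
    (eq (option_map (machine_step h.lift var ha.lift) var.prod_fst) (some hs.lift))

theorem tourStep (h : Padded e P) (hp : PolyTime e fun y => enc (p y))
    (ha : PolyTime e fun y => enc (a y)) :
    PolyTime e fun y => enc ((P y).lookMachine.tourStep (p y) (a y)) := by
  have hd := h.poly.dim
  have hs := hp.prod_snd
  have hph : ∀ t, PolyTime e fun y => enc (decide ((p y).1 = t)) := fun t =>
    eq hp.prod_fst (phase t)
  simp only [Machine.tourStep_eq]
  refine ite (hph _) ?_ (ite (hph _) ?_ (ite (hph _) ?_ ?_))
  · refine option_map (machine_step h hs ha) (prod (elim (next hs.lift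
      (machine_preds h.lift var.prod_fst ha.lift)) ?_ ?_) var.prod_snd)
    · exact (phase _).prod var.prod_fst
    · exact (phase _).prod var
  · refine elim (head? (machine_preds h hs ha)) (some (((phase _).prod hs).prod (vec_zero hd))) ?_
    exact option_map (machine_step h.lift var ha.lift)
      (((phase _).prod var.lift).prod (vec_neg hd.lift.lift var.prod_snd))
  · exact option_bind (machine_step h hs ha) (ite
      (eq (head? (machine_preds h.lift var.prod_fst ha.lift)) (some hs.lift)) none
      (some (((phase _).prod hs.lift).prod (vec_neg hd.lift var.prod_snd))))
  · exact ite (eq (head? (machine_preds h hs ha)) none)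
      (some (((phase _).prod hs).prod (vec_zero hd))) none

theorem tour_left (hp : PolyTime e fun y => enc (p y)) :
    PolyTime e fun y => enc ((P y).lookMachine.tour.left (p y)) := by
  have hph : ∀ t, PolyTime e fun y => enc (decide ((p y).1 = t)) := fun t =>
    eq hp.prod_fst (phase t)
  have hl := machine_left (P := P) hp.prod_snd
  have hb := machine_back (P := P) hp.prod_snd
  simp only [Machine.tour_left_eq]
  exact ite (hph _) hl (ite (hph _) hb.not (ite (hph _) hl.not hb))

end look

theorem toReversible (h : Padded e P) : PolyTime e fun y => (P y).toReversible.encode := by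
  refine toPA (S := fun y => (P y).lookMachine.tour)
    (σ := fun y => Machine.Phase × LookStateFin (m y) (n y))
    h.poly.numLetters h.poly.dim h.poly.constraint ?_ ?_ ?_ ?_ ?_
  · exact flatMap (A := fun _ => Machine.Phase) (l := fun _ => [.up, .down, .cross, .turn])
      (f := fun y ph => (P y).lookMachine.states.map fun q => (ph, q))
      ((phase _).cons ((phase _).cons ((phase _).cons ((phase _).cons list_nil))))
      (map (f := fun (z : Σ _, Machine.Phase) q => (z.2, q)) (machine_states h).lift
        (var.lift.prod var))
  · exact tour_left var
  · exact eq var ((phase _).prod (machine_start h.lift))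
  · exact eq var ((phase _).prod (machine_fin h.lift))
  · unfold Machine.tour
    exact option_bind (tourStep h.lift.lift.lift var.lift.lift var.lift)
      (ite (eq var.prod_fst var.lift) (some var.prod_snd) none)

end PolyTime

theorem exists_prog_toReversible : ∃ (prog : Prog) (time : Polynomial ℕ),
    ∀ (m n d : ℕ) (P : ParikhAutomaton (Fin m) (Fin n) d), ∃ c,
      prog.Runs P.encode P.toReversible.encode c ∧ c ≤ 2 ^ time.eval P.encode.size := by
  obtain ⟨prog, time, h⟩ := exists_prog_of_polyTime
    (Y := Σ m n d, ParikhAutomaton (Fin m) (Fin n) d) (e := fun y => y.2.2.2.encode)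
    (f := fun y => y.2.2.2.toReversible.encode)
    (PolyTime.toReversible ⟨PolyTime.id.fst, polyBdd_padding _⟩)
  exact ⟨prog, time, fun m n d P => h ⟨m, n, d, P⟩⟩

/-! ### The classes of languages -/

section languages

variable {α : Type*} [Finite α]

theorem UPALanguages_subset : UPALanguages α ⊆ ReversibleLanguages α := by
  rintro _ ⟨Q, d, P, hP, rfl⟩
  have := P.aut.finite
  obtain ⟨m, ⟨f⟩⟩ := Finite.exists_equiv_fin α
  obtain ⟨n, ⟨g⟩⟩ := Finite.exists_equiv_fin Q
  have hP' := P.isUPA_comap f.symm g.symm hP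
  refine ⟨_, d, (P.comap f.symm g.symm).toReversible.comap f (.refl _),
    ParikhAutomaton.isReversible2DPA_comap _ _ _ (ParikhAutomaton.toReversible_isReversible _), ?_⟩
  ext u
  rw [ParikhAutomaton.mem_language_comap, ParikhAutomaton.language_toReversible hP',
    ParikhAutomaton.mem_language_comap]
  simp

theorem TwoDPALanguages_subset : TwoDPALanguages α ⊆ UPALanguages α := by
  rintro _ ⟨Q, d, P, hP, rfl⟩
  have := P.aut.finite
  obtain ⟨m, ⟨f⟩⟩ := Finite.exists_equiv_fin α
  obtain ⟨n, ⟨g⟩⟩ := Finite.exists_equiv_fin Q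
  have hP' := P.is2DPA_comap f.symm g.symm hP
  refine ⟨_, d, (P.comap f.symm g.symm).toUPA.comap f (.refl _),
    ParikhAutomaton.isUPA_comap _ _ _ (ParikhAutomaton.toUPA_isUPA hP'), ?_⟩
  ext u
  rw [ParikhAutomaton.mem_language_comap, ParikhAutomaton.language_toUPA hP',
    ParikhAutomaton.mem_language_comap]
  simp

end languages

theorem ReversibleLanguages_subset (α : Type*) : ReversibleLanguages α ⊆ TwoDPALanguages α :=
  fun _ ⟨Q, d, P, hP, h⟩ => ⟨Q, d, P, hP.1, h⟩

end TwoWayParikh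

open TwoWayParikh
/-- Unambiguous Parikh automata, two-way deterministic Parikh automata and two-way reversible
Parikh automata accept the same languages over every finite alphabet, and there are programs
that convert unambiguous Parikh automata to reversible ones, and two-way deterministic ones to
unambiguous ones, in time exponential in a polynomial of the size of the input. -/
theorem mainTheorem3 :
    (∀ (α : Type*) [Finite α],
      UPALanguages α = TwoDPALanguages α ∧ UPALanguages α = ReversibleLanguages α) ∧
    (∃ (prog : Prog) (time : Polynomial ℕ),
      ∀ (m n d : ℕ) (P : ParikhAutomaton (Fin m) (Fin n) d), P.IsUPA →
        ∃ (n' d' : ℕ) (P' : ParikhAutomaton (Fin m) (Fin n') d') (c : ℕ),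
          P'.IsReversible2DPA ∧ P'.language = P.language ∧
          prog.Runs P.encode P'.encode c ∧ c ≤ 2 ^ time.eval P.encode.size) ∧
    (∃ (prog : Prog) (time : Polynomial ℕ),
      ∀ (m n d : ℕ) (P : ParikhAutomaton (Fin m) (Fin n) d), P.Is2DPA →
        ∃ (n' d' : ℕ) (P' : ParikhAutomaton (Fin m) (Fin n') d') (c : ℕ),
          P'.IsUPA ∧ P'.language = P.language ∧
          prog.Runs P.encode P'.encode c ∧ c ≤ 2 ^ time.eval P.encode.size) := by
  refine ⟨fun α _ => ?_, ?_, ?_⟩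
  · have h := UPALanguages_subset (α := α)
    have h' := ReversibleLanguages_subset α
    have h'' := TwoDPALanguages_subset (α := α)
    exact ⟨(h.trans h').antisymm h'', h.antisymm (h'.trans h'')⟩
  · obtain ⟨prog, time, h⟩ := exists_prog_toReversible
    refine ⟨prog, time, fun m n d P hP => ?_⟩
    obtain ⟨c, h₁, h₂⟩ := h m n d P
    exact ⟨_, d, P.toReversible, c, P.toReversible_isReversible,
      ParikhAutomaton.language_toReversible hP, h₁, h₂⟩
  · obtain ⟨prog, time, h⟩ := exists_prog_toUPA
    refine ⟨prog, time, fun m n d P hP => ?_⟩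
    obtain ⟨c, h₁, h₂⟩ := h m n d P
    exact ⟨_, d, P.toUPA, c, ParikhAutomaton.toUPA_isUPA hP, ParikhAutomaton.language_toUPA hP,
      h₁, h₂⟩
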